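/- Let $n\ge 1$ and index rows and columns of real $(n+1)\times(n+1)$ matrices by $0,\dots,n$. Let $J$ be the matrix with $1$'s on the first sub-diagonal and $0$'s elsewhere; $A_{\le 0}$ and $A_{\ge 0}$ denote the lower and upper triangular parts of $A$ (diagonal included). The $m$-th flow of the Kostant–Toda hierarchy ($1\le m\le n$) is $$\dot X=[X,(X^m)_{\le 0}].$$ For an index set $I=\{i_1<\dots<i_r\}$ with $0<i_1$, $i_r=n$, put $X_I=e_{0i_1}+\sum_{j=1}^{r-1}e_{i_ji_{j+1}}$ (elementary matrices) and $$M_I=\bigcup_{\nu\in\mathbb R}\{\,J+(b(X_I+\nu\mathbf 1)b^{-1})_{\ge 0}\;:\; b \text{ invertible lower triangular}\,\},$$ the union of the one-parameter family of coadjoint orbits attached to $I$. Let $Rat'_{n+1}$ be the manifold of rational functions $M=q/p$, where $p,q$ are monic real polynomials of degrees $n+1$ and $n$, coordinatized by the non-leading coefficients of $p$ and $q$ (common factors are allowed and not cancelled). Let $W$ be the Moser map, which sends $X$ to its Weyl function $M(\lambda,X)=((\lambda\mathbf 1-X)^{-1}e_0,e_0)$, with $p$ the characteristic polynomial of $X$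 and $q$ that of $X$ with row and column $0$ deleted. For a rational function $r$, $r_-$ denotes $r$ minus its polynomial part. **Theorem.** There are Poisson brackets $\{\,,\}_k$, $k=0,\dots,n$, on $Rat'_{n+1}$, compatible in the sense that every linear combination of them with constant coefficients is a Poisson bracket, such that $$\{M(\lambda),M(\mu)\}_k=\big((\lambda^kM(\lambda))_--(\mu^kM(\mu))_-\big)\Big(\frac{M(\lambda)-M(\mu)}{\lambda-\mu}+M(\lambda)M(\mu)\Big)$$ for real $\lambda\neq\mu$ that are not roots of $p$; and for every index set $I$ the following holds. 1. Every flow of the hierarchy restricts to $M_I$: through each point of $M_I$ there is a local solution, and a solution on an open interval that meets $M_I$ stays in $M_I$. 2. The Moser map is almost everywhere invertible on $M_I$: there is a relatively open dense subset $U\subseteq M_I$ such that $W(U)$ is open in $Rat'_{n+1}$ and, for $X\in U$, the entries of $X$ are rational functions (with denominator not vanishing on $W(U)$) of the coefficients of $p$ and $q$. 3. There are compatible Poisson brackets $\{\,,\}^I_k$, $k=0,\dots,n$, on $U$ that are the pull-backs of $\{\,,\}_k$ via $W$, that is, $\{F\circ W,G\circ W\}^I_k=\{F,G\}_k\circ W$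 for all locally defined smooth functions $F,G$. 4. For all $m=1,\dots,n$ and $k=0,\dots,n$ the $m$-th flow is generated on $U$, in the bracket $\{\,,\}^I_k$, by the Hamiltonian $H_{m+1-k}$, where $H_j=\frac1j\operatorname{Tr}(X^j)$ for $j\ne0$ and $H_0=\ln|\det X|$: along every solution $X(t)$, whenever $X(t)\in U$ (and $\det X(t)\neq0$ if $m+1-k\le 0$), $\frac{d}{dt}f(X(t))=\{f,H_{m+1-k}\}^I_k(X(t))$ for every smooth function $f$ on a neighbourhood of $X(t)$ in $U$. -/

import Mathlib

open Set Filter Topology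
open scoped ContDiff

attribute [local instance] Matrix.normedAddCommGroup Matrix.normedSpace

/-! ### Poisson brackets on a submanifold of a vector space

A manifold is given as a subset `U` of a normed space `E`; a function on `U` is represented by a
function on `E` whose values outside `U` are irrelevant. -/

/-- `f` restricts to a smooth function on a neighbourhood of `x` in `U`. -/
def SmoothNear {E : Type*} [NormedAddCommGroup E] [NormedSpace ℝ E]
    (U : Set E) (f : E → ℝ) (x : E) : Prop :=
  ∀ᶠ y in 𝓝[U] x, ContDiffWithinAt ℝ ∞ f U y

/-- `B` is a Poisson bracket on (the sheaf of germs of smooth functions on) `U`: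
a local, bilinear, skew-symmetric operation that satisfies the Leibniz rule and the Jacobi
identity. Nothing is required of `B f g x` when `f` or `g` is not smooth near `x`. -/
structure IsPoissonBracketOn {E : Type*} [NormedAddCommGroup E] [NormedSpace ℝ E]
    (U : Set E) (B : (E → ℝ) → (E → ℝ) → E → ℝ) : Prop where
  congr : ∀ x ∈ U, ∀ f f' g : E → ℝ, SmoothNear U f x → SmoothNear U g x →
    f =ᶠ[𝓝[U] x] f' → B f g x = B f' g x
  smooth : ∀ x ∈ U, ∀ f g : E → ℝ, SmoothNear U f x → SmoothNear U g x →
    SmoothNear U (B f g) x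
  add : ∀ x ∈ U, ∀ f g h : E → ℝ, SmoothNear U f x → SmoothNear U g x → SmoothNear U h x →
    B (f + g) h x = B f h x + B g h x
  smul : ∀ x ∈ U, ∀ (c : ℝ) (f g : E → ℝ), SmoothNear U f x → SmoothNear U g x →
    B (c • f) g x = c * B f g x
  skew : ∀ x ∈ U, ∀ f g : E → ℝ, SmoothNear U f x → SmoothNear U g x →
    B f g x = - B g f x
  leibniz : ∀ x ∈ U, ∀ f g h : E → ℝ, SmoothNear U f x → SmoothNear U g x →
    SmoothNear U h x → B (f * g) h x = f x * B g h x + g x * B f h x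
  jacobi : ∀ x ∈ U, ∀ f g h : E → ℝ, SmoothNear U f x → SmoothNear U g x →
    SmoothNear U h x → B f (B g h) x + B g (B h f) x + B h (B f g) x = 0

/-- A finite family of compatible Poisson brackets on `U`: each of them, and every linear
combination of them with constant coefficients, is a Poisson bracket. -/
def CompatiblePoissonOn {E : Type*} [NormedAddCommGroup E] [NormedSpace ℝ E] {N : ℕ}
    (U : Set E) (B : Fin N → (E → ℝ) → (E → ℝ) → E → ℝ) : Prop :=
  (∀ k, IsPoissonBracketOn U (B k)) ∧
    ∀ c : Fin N → ℝ, IsPoissonBracketOn U (fun f g x => ∑ k, c k * B k f g x)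

/-! ### The Kostant–Toda hierarchy -/

/-- Real `(n+1) × (n+1)` matrices, rows and columns numbered `0, …, n`. -/
abbrev TodaMat (n : ℕ) : Type := Matrix (Fin (n + 1)) (Fin (n + 1)) ℝ

/-- `A_{≤ 0}`: the lower triangular part, diagonal included. -/
def lowerPart {n : ℕ} (A : TodaMat n) : TodaMat n :=
  Matrix.of fun a b => if b ≤ a then A a b else 0

/-- `A_{≥ 0}`: the upper triangular part, diagonal included. -/
def upperPart {n : ℕ} (A : TodaMat n) : TodaMat n :=
  Matrix.of fun a b => if a ≤ b then A a b else 0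

/-- `J`: ones on the first sub-diagonal, zeros elsewhere. -/
def subdiagJ (n : ℕ) : TodaMat n :=
  Matrix.of fun a b => if (a : ℕ) = (b : ℕ) + 1 then 1 else 0

/-- The right-hand side `[X, (X^m)_{≤ 0}]` of the `m`-th Lax equation. -/
def laxField {n : ℕ} (m : ℕ) (X : TodaMat n) : TodaMat n :=
  X * lowerPart (X ^ m) - lowerPart (X ^ m) * X

/-- `γ` solves the `m`-th Lax equation on the set of times `T`. -/
def IsLaxSolutionOn {n : ℕ} (m : ℕ) (T : Set ℝ) (γ : ℝ → TodaMat n) : Prop :=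
  ∀ t ∈ T, HasDerivAt γ (laxField m (γ t)) t

/-- The Hamiltonians `H_j = Tr(X^j) / j` for `j ≠ 0`, and `H_0 = ln det X`
(`Real.log` is `ln |·|`). -/
noncomputable def todaHam {n : ℕ} (j : ℤ) (X : TodaMat n) : ℝ :=
  if j = 0 then Real.log X.det else (X ^ j).trace / (j : ℝ)

/-- The coadjoint orbit of the group of invertible lower triangular matrices:
`{ J + (b X b⁻¹)_{≥ 0} }`. -/
def coadOrbit {n : ℕ} (X : TodaMat n) : Set (TodaMat n) :=
  {Y | ∃ b : TodaMat n, (∀ p q, p < q → b p q = 0) ∧ IsUnit b.det ∧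
    Y = subdiagJ n + upperPart (b * X * b⁻¹)}

/-- `X_I = e_{0 i_1} + ∑_{j=1}^{r-1} e_{i_j i_{j+1}}`, where the index set
`I = {i_1 < ⋯ < i_r}` is given as a sequence with the convention `i_0 = 0`. -/
def indexMat {n r : ℕ} (i : Fin (r + 1) → Fin (n + 1)) : TodaMat n :=
  ∑ j : Fin r, Matrix.single (i j.castSucc) (i j.succ) 1

/-- `M_I`: the union over `ν` of the one-parameter family of coadjoint orbits of `X_I + ν 1`. -/
def todaOrbit {n r : ℕ} (i : Fin (r + 1) → Fin (n + 1)) : Set (TodaMat n) :=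
  ⋃ ν : ℝ, coadOrbit (indexMat i + ν • (1 : TodaMat n))

/-! ### The rational functions `q / p` with `p`, `q` monic of degrees `n + 1` and `n` -/

/-- The space of the functions `q / p`, coordinatized by the non-leading coefficients of
`p` and of `q`. -/
abbrev RatCoeff (n : ℕ) : Type := (Fin (n + 1) → ℝ) × (Fin n → ℝ)

/-- The denominator `p`, monic of degree `n + 1`. -/
noncomputable def ratDen {n : ℕ} (a : RatCoeff n) : Polynomial ℝ :=
  Polynomial.X ^ (n + 1) +
    ∑ j : Fin (n + 1), Polynomial.C (a.1 j) * Polynomial.X ^ (j : ℕ)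

/-- The numerator `q`, monic of degree `n`. -/
noncomputable def ratNum {n : ℕ} (a : RatCoeff n) : Polynomial ℝ :=
  Polynomial.X ^ n + ∑ j : Fin n, Polynomial.C (a.2 j) * Polynomial.X ^ (j : ℕ)

/-- The value `M(z) = q(z) / p(z)`. -/
noncomputable def ratEval {n : ℕ} (z : ℝ) (a : RatCoeff n) : ℝ :=
  (ratNum a).eval z / (ratDen a).eval z

/-- The value at `z` of `(z^k M(z))_-`, the rational function `z^k q / p` minus its polynomial
part; that is, `(z^k q mod p) / p`. -/
noncomputable def ratNegPart {n : ℕ} (k : ℕ) (z : ℝ) (a : RatCoeff n) : ℝ :=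
  ((Polynomial.X ^ k * ratNum a) %ₘ ratDen a).eval z / (ratDen a).eval z

/-- `R` satisfies
`{M(z), M(w)} = ((z^k M(z))_- - (w^k M(w))_-) ((M(z) - M(w)) / (z - w) + M(z) M(w))`
at every rational function and for all `z ≠ w` that are not roots of its denominator. -/
def SatisfiesRatBracket {n : ℕ} (k : ℕ)
    (R : (RatCoeff n → ℝ) → (RatCoeff n → ℝ) → RatCoeff n → ℝ) : Prop :=
  ∀ (a : RatCoeff n) (z w : ℝ), z ≠ w → (ratDen a).eval z ≠ 0 → (ratDen a).eval w ≠ 0 →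
    R (ratEval z) (ratEval w) a =
      (ratNegPart k z a - ratNegPart k w a) *
        ((ratEval z a - ratEval w a) / (z - w) + ratEval z a * ratEval w a)

/-! ### The Moser map -/

/-- The Weyl function `M(z, X) = ((z 1 - X)⁻¹ e_0, e_0)`. -/
noncomputable def weylFun {n : ℕ} (z : ℝ) (X : TodaMat n) : ℝ :=
  ((z • (1 : TodaMat n) - X)⁻¹) 0 0

/-- The Moser map `X ↦ M(·, X)` in coordinates: the denominator is the characteristic polynomial
of `X`, the numerator that of `X` with the row and the column number `0` deleted. -/
noncomputable def weylMap {n : ℕ} (X : TodaMat n) : RatCoeff n :=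
  (fun j => X.charpoly.coeff j, fun j => (X.submatrix Fin.succ Fin.succ).charpoly.coeff j)

theorem charpoly_eq_sum_coeff {N : ℕ} (A : Matrix (Fin N) (Fin N) ℝ) :
    Polynomial.X ^ N + ∑ j : Fin N, Polynomial.C (A.charpoly.coeff j) * Polynomial.X ^ (j : ℕ)
      = A.charpoly := by
  have hd : A.charpoly.natDegree = N := by simp [Matrix.charpoly_natDegree_eq_dim]
  have hm : A.charpoly.Monic := Matrix.charpoly_monic A
  conv_rhs => rw [hm.as_sum, hd]
  rw [Fin.sum_univ_eq_sum_range
    (fun j => Polynomial.C (A.charpoly.coeff j) * Polynomial.X ^ j) N]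

theorem ratDen_weylMap {n : ℕ} (X : TodaMat n) : ratDen (weylMap X) = X.charpoly :=
  charpoly_eq_sum_coeff X

theorem ratNum_weylMap {n : ℕ} (X : TodaMat n) :
    ratNum (weylMap X) = (X.submatrix Fin.succ Fin.succ).charpoly :=
  charpoly_eq_sum_coeff (X.submatrix Fin.succ Fin.succ)

/-- `weylMap X` is the rational function `M(·, X)`. -/
theorem ratEval_weylMap {n : ℕ} (z : ℝ) (X : TodaMat n) :
    ratEval z (weylMap X) = weylFun z X := by
  unfold ratEval weylFun
  rw [ratDen_weylMap, ratNum_weylMap, Matrix.eval_charpoly, Matrix.eval_charpoly,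
    Matrix.inv_def, Matrix.smul_apply, Matrix.adjugate_fin_succ_eq_det_submatrix]
  have h1 : Matrix.scalar (Fin (n + 1)) z = z • (1 : TodaMat n) := by
    ext a b; simp [Matrix.scalar_apply, Matrix.diagonal_apply, Matrix.one_apply]
  have h2 : (z • (1 : TodaMat n) - X).submatrix (Fin.succAbove 0) (Fin.succAbove 0)
      = Matrix.scalar (Fin n) z - X.submatrix Fin.succ Fin.succ := by
    ext a b; simp [Matrix.scalar_apply, Matrix.diagonal_apply, Matrix.one_apply]
  rw [h1, h2]
  simp [div_eq_inv_mul]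

/-- The coordinates of a rational function as a valuation of the variables of a polynomial. -/
def ratCoords {n : ℕ} (a : RatCoeff n) : Fin (n + 1) ⊕ Fin n → ℝ := Sum.elim a.1 a.2

/-- `U` is a relatively open dense subset of `M` on which the Moser map is invertible: its image
is open, and there every matrix entry is a rational function, with a denominator that has no zero
on the image, of the coefficients of the Weyl function. -/
def IsMoserDomain {n : ℕ} (M U : Set (TodaMat n)) : Prop :=
  (∃ V : Set (TodaMat n), IsOpen V ∧ U = V ∩ M) ∧ M ⊆ closure U ∧
    IsOpen (weylMap '' U) ∧
    ∃ (P : Fin (n + 1) → Fin (n + 1) → MvPolynomial (Fin (n + 1) ⊕ Fin n) ℝ)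
      (Q : MvPolynomial (Fin (n + 1) ⊕ Fin n) ℝ),
      ∀ X ∈ U, MvPolynomial.eval (ratCoords (weylMap X)) Q ≠ 0 ∧
        ∀ a b, X a b = MvPolynomial.eval (ratCoords (weylMap X)) (P a b) /
          MvPolynomial.eval (ratCoords (weylMap X)) Q

/-- The bracket `B` on `U` is the pull-back of the bracket `R` via the Moser map:
`{F ∘ W, G ∘ W} = {F, G} ∘ W` for smooth functions `F`, `G` of the Weyl function. -/
def IsMoserPullback {n : ℕ} (U : Set (TodaMat n))
    (R : (RatCoeff n → ℝ) → (RatCoeff n → ℝ) → RatCoeff n → ℝ)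
    (B : (TodaMat n → ℝ) → (TodaMat n → ℝ) → TodaMat n → ℝ) : Prop :=
  ∀ X ∈ U, ∀ F G : RatCoeff n → ℝ,
    SmoothNear univ F (weylMap X) → SmoothNear univ G (weylMap X) →
      B (F ∘ weylMap) (G ∘ weylMap) X = R F G (weylMap X)

/-- The `m`-th Lax equation restricts to `M`: through every point of `M` there is a solution, and
a solution on an interval that meets `M` stays in `M`. -/
def LaxRestrictsTo {n : ℕ} (m : ℕ) (M : Set (TodaMat n)) : Prop :=
  (∀ X ∈ M, ∃ ε > 0, ∃ γ : ℝ → TodaMat n, γ 0 = X ∧ IsLaxSolutionOn m (Ioo (-ε) ε) γ) ∧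
    ∀ (T : Set ℝ) (γ : ℝ → TodaMat n), IsOpen T → IsPreconnected T → IsLaxSolutionOn m T γ →
      (∃ t ∈ T, γ t ∈ M) → ∀ t ∈ T, γ t ∈ M

/-- On `U`, the `m`-th Lax equation is the Hamilton equation `df/dt = {f, H_j}` of the bracket
`B`. For `j ≤ 0` the Hamiltonian is defined at invertible matrices only. -/
def LaxGeneratedBy {n : ℕ} (m : ℕ) (U : Set (TodaMat n))
    (B : (TodaMat n → ℝ) → (TodaMat n → ℝ) → TodaMat n → ℝ) (j : ℤ) : Prop :=
  ∀ (T : Set ℝ) (γ : ℝ → TodaMat n), IsOpen T → IsLaxSolutionOn m T γ →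
    ∀ t ∈ T, γ t ∈ U → (j ≤ 0 → (γ t).det ≠ 0) →
      ∀ f : TodaMat n → ℝ, SmoothNear U f (γ t) →
        HasDerivAt (fun s => f (γ s)) (B f (todaHam j) (γ t)) t

/-! Vectors of length n+1 are read as polynomials of degree at most n. The companion matrix C of p
is then multiplication by z modulo p, and the Weyl function is encoded in moments: (X^k)_{00} is the
coefficient of z^n in z^k q mod p (`pow_apply_zero_zero`).

Brackets. For a multiplier f of degree at most n let g = f q mod p. The coefficients of p commute
among themselves, so do those of q, and {p(z), q(w)} = (p(z) g(w) - g(z) p(w)) / (z - w) - g(z)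
q(w). This is linear in f, so the Jacobi identity for every f contains compatibility. Since {p,p} =
{q,q} = 0, Jacobi amounts to two symmetries, `bracketDeriv_row_comm` and `bracketDeriv_col_comm`.
The variation of g is f(C) δq - S δp with S commuting with C, and such matrices pass through the
Bezoutian (`mulVec_bezVec`); both symmetries thereby become identities between rational functions of
three variables.

Flows. Solutions are locally lower triangular conjugates of the initial matrix and keep the
Hessenberg form, hence stay in the coadjoint orbit. In the coordinates (p, q) the m-th flow fixes p
and moves q by z^m q mod p, minus the multiple of q that keeps q monic. The Hamiltonian H_j depends
on p alone, and its gradient is minus the last row of C^(j-1). Pairing the last row of C^(m-k) with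
the Horner polynomials gives C^(m-k) back (`sum_lastRow_smul_horner`). Applied to g = z^k q mod p
this yields z^m q mod p, whatever k is: this is the multi-Hamiltonian property.

Inverse. A Hessenberg X equals K C K⁻¹, where the Krylov matrix K with columns X^b e_0 is unit upper
triangular. Let Y be X minus its normalized trace, which removes ν. The shape of the orbit makes the
rows e_0^T Y^k, taken with positive or negative k according to membership in I, extend the standard
flag one step at a time (`IsStaircase.single_mem`). Put in this order they form an invertible lower
triangular matrix G. The entries of G K are values e_0^T Y^k X^b e_0, rational in (p, q), and
triangular factorization recovers K rationally. The only condition is det Y ≠ 0, which defines U.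

Density and openness. Along a segment of lower triangular b the condition is polynomial after
denominators are cleared, so one good b suffices (`exists_orbit_det_ne_zero`). An explicit immersed
chart with 2n+1 parameters, composed with the Moser map, has injective derivative because of the
rational left inverse; equality of dimensions makes the image open. The brackets are then
transported along U ≅ W(U). -/

/-! ### Companion matrices and Horner polynomials -/

section Companion

open Finset Matrix

variable {n : ℕ}

/-- The coefficients of the monic polynomial of degree `n + 1` with non-leading coefficients `p`. -/
def monicCoeff (p : Fin (n + 1) → ℝ) (l : ℕ) : ℝ :=
  if h : l < n + 1 then p ⟨l, h⟩ else if l = n + 1 then 1 else 0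

/-- Multiplication by the variable modulo the monic polynomial with coefficients `p`. -/
def companion (p : Fin (n + 1) → ℝ) : TodaMat n :=
  Matrix.of fun i j => (if (i : ℕ) = j + 1 then 1 else 0) - if j = Fin.last n then p i else 0

/-- The Horner polynomials `∑ l, p_{i + l} A ^ l`. -/
def horner (p : Fin (n + 1) → ℝ) (A : TodaMat n) (i : ℕ) : TodaMat n :=
  ∑ l ∈ range (n + 2), monicCoeff p (i + l) • A ^ l

/-- The value of the polynomial with coefficients `r`. -/
def evalVec {N : ℕ} (r : Fin N → ℝ) (z : ℝ) : ℝ := ∑ i, r i * z ^ (i : ℕ)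

/-- The value of the monic polynomial with non-leading coefficients `p`. -/
def evalMonic {N : ℕ} (p : Fin N → ℝ) (z : ℝ) : ℝ := z ^ N + evalVec p z

theorem evalVec_sub {N : ℕ} (r s : Fin N → ℝ) (z : ℝ) :
    evalVec (r - s) z = evalVec r z - evalVec s z := by
  simp [evalVec, sub_mul, sum_sub_distrib]

theorem evalVec_smul {N : ℕ} (c : ℝ) (r : Fin N → ℝ) (z : ℝ) :
    evalVec (c • r) z = c * evalVec r z := by
  simp [evalVec, mul_sum, mul_assoc]

theorem evalVec_neg {N : ℕ} (r : Fin N → ℝ) (z : ℝ) :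
    evalVec (-r) z = -evalVec r z := by
  simp [evalVec]

theorem evalVec_sum {N : ℕ} {ι : Type*} (s : Finset ι) (r : ι → Fin N → ℝ) (z : ℝ) :
    evalVec (∑ i ∈ s, r i) z = ∑ i ∈ s, evalVec (r i) z := by
  simp only [evalVec, Finset.sum_apply, sum_mul]
  exact sum_comm

theorem evalVec_snoc (q : Fin n → ℝ) (c z : ℝ) :
    evalVec (Fin.snoc q c : Fin (n + 1) → ℝ) z = c * z ^ n + evalVec q z := by
  simp [evalVec, Fin.sum_univ_castSucc, add_comm]

/-- A vector is determined by the values of its polynomial off a finite set. -/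
theorem eq_zero_of_evalVec {N : ℕ} {r : Fin N → ℝ} {S : Set ℝ} (hS : S.Finite)
    (h : ∀ z ∉ S, evalVec r z = 0) : r = 0 := by
  set P : Polynomial ℝ := ∑ i : Fin N, Polynomial.C (r i) * Polynomial.X ^ (i : ℕ) with hP
  have hev : ∀ z, P.eval z = evalVec r z := fun z => by
    simp [hP, evalVec, Polynomial.eval_finsetSum]
  have h0 : P = 0 := by
    apply Polynomial.eq_zero_of_infinite_isRoot
    apply hS.infinite_compl.mono
    intro z hz
    simp only [mem_ofPred_eq, Polynomial.IsRoot, hev]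
    exact h z hz
  ext j
  have := congrArg (fun P => Polynomial.coeff P j) h0
  simp only [hP, Polynomial.finsetSum_coeff, Polynomial.coeff_C_mul_X_pow,
    Polynomial.coeff_zero] at this
  rw [Finset.sum_eq_single j] at this
  · simpa using this
  · intro b _ hb
    rw [if_neg]
    exact fun h => hb (Fin.ext h.symm)
  · simp

theorem evalVec_injective {N : ℕ} {r s : Fin N → ℝ} {S : Set ℝ} (hS : S.Finite)
    (h : ∀ z ∉ S, evalVec r z = evalVec s z) : r = s :=
  sub_eq_zero.mp (eq_zero_of_evalVec hS fun z hz => by rw [evalVec_sub, h z hz, sub_self])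

theorem monicCoeff_fin (p : Fin (n + 1) → ℝ) (i : Fin (n + 1)) : monicCoeff p i = p i := by
  simp only [monicCoeff, i.isLt, dif_pos]

theorem monicCoeff_top (p : Fin (n + 1) → ℝ) : monicCoeff p (n + 1) = 1 := by
  simp [monicCoeff]

theorem monicCoeff_of_gt (p : Fin (n + 1) → ℝ) {l : ℕ} (h : n + 1 < l) : monicCoeff p l = 0 := by
  unfold monicCoeff
  rw [dif_neg (by omega), if_neg (by omega)]

theorem horner_rec (p : Fin (n + 1) → ℝ) (A : TodaMat n) (i : ℕ) :
    horner p A i = monicCoeff p i • (1 : TodaMat n) + A * horner p A (i + 1) := by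
  unfold horner
  rw [sum_range_succ', sum_range_succ (n := n + 1) (f := fun l => monicCoeff p (i + 1 + l) • A ^ l),
    monicCoeff_of_gt p (by omega : n + 1 < i + 1 + (n + 1)), zero_smul]
  simp only [add_zero, pow_zero, mul_sum]
  rw [add_comm]
  congr 1
  apply sum_congr rfl
  intro l _
  rw [mul_smul_comm, pow_succ', show i + (l + 1) = i + 1 + l by ring]

theorem horner_top (p : Fin (n + 1) → ℝ) (A : TodaMat n) : horner p A (n + 1) = 1 := by
  unfold horner
  rw [sum_eq_single 0]
  · simp [monicCoeff_top]
  · intro l _ hl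
    rw [monicCoeff_of_gt p (by omega), zero_smul]
  · simp

theorem commute_horner (p : Fin (n + 1) → ℝ) {A B : TodaMat n} (h : Commute B A) (i : ℕ) :
    Commute B (horner p A i) := by
  unfold horner
  exact Commute.sum_right _ _ _ fun l _ => (h.pow_right l).smul_right _

/-- The adjugate of `z - A` in terms of the Horner polynomials. -/
theorem sub_mul_sum_horner (p : Fin (n + 1) → ℝ) (A : TodaMat n) (z : ℝ) :
    (z • (1 : TodaMat n) - A) * ∑ i : Fin (n + 1), z ^ (i : ℕ) • horner p A (i + 1) =
      evalMonic p z • (1 : TodaMat n) - horner p A 0 := by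
  have key : ∀ i : Fin (n + 1), (z • (1 : TodaMat n) - A) * (z ^ (i : ℕ) • horner p A (i + 1)) =
      (z ^ ((i : ℕ) + 1) • horner p A (i + 1) - z ^ (i : ℕ) • horner p A i) +
        (p i * z ^ (i : ℕ)) • (1 : TodaMat n) := by
    intro i
    have h := horner_rec p A i
    rw [monicCoeff_fin] at h
    rw [h, sub_mul, smul_mul_smul_comm, one_mul, mul_smul_comm, smul_add, smul_smul, pow_succ',
      mul_comm (p i)]
    abel
  rw [mul_sum, sum_congr rfl fun i _ => key i, sum_add_distrib,
    Fin.sum_univ_eq_sum_range (fun i => z ^ (i + 1) • horner p A (i + 1) - z ^ i • horner p A i),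
    sum_range_sub (f := fun i => z ^ i • horner p A i), horner_top, ← sum_smul, evalMonic,
    add_smul]
  simp only [pow_zero, one_smul, evalVec]
  abel

theorem companion_apply_castSucc (p : Fin (n + 1) → ℝ) (i : Fin (n + 1)) (j : Fin n) :
    companion p i j.castSucc = if i = j.succ then 1 else 0 := by
  have h : j.castSucc ≠ Fin.last n := (Fin.castSucc_lt_last j).ne
  rw [companion, Matrix.of_apply, if_neg h]
  simp [Fin.ext_iff]

theorem companion_apply_last (p : Fin (n + 1) → ℝ) (i : Fin (n + 1)) :
    companion p i (Fin.last n) = -p i := by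
  have h : (i : ℕ) ≠ n + 1 := i.isLt.ne
  simp [companion, h]

theorem companion_mulVec (p r : Fin (n + 1) → ℝ) (i : Fin (n + 1)) :
    (companion p *ᵥ r) i =
      (∑ j : Fin n, if i = j.succ then r j.castSucc else 0) - r (Fin.last n) * p i := by
  simp only [mulVec, dotProduct, Fin.sum_univ_castSucc, companion_apply_castSucc,
    companion_apply_last]
  simp [mul_comm, sub_eq_add_neg]

/-- The shift multiplies by w; only the leading coefficient overflows the degree bound, and it is
removed by subtracting that multiple of p. -/
theorem evalVec_companion_mulVec (p r : Fin (n + 1) → ℝ) (w : ℝ) :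
    evalVec (companion p *ᵥ r) w = w * evalVec r w - r (Fin.last n) * evalMonic p w := by
  have h1 : evalVec (companion p *ᵥ r) w =
      (∑ i : Fin (n + 1), ∑ j : Fin n, (if i = j.succ then r j.castSucc else 0) * w ^ (i : ℕ))
        - r (Fin.last n) * evalVec p w := by
    simp only [evalVec, companion_mulVec, sub_mul, sum_sub_distrib, sum_mul, mul_sum, mul_assoc]
  rw [h1, sum_comm]
  have h2 : ∀ j : Fin n,
      (∑ i : Fin (n + 1), (if i = j.succ then r j.castSucc else 0) * w ^ (i : ℕ)) =
        w * (r j.castSucc * w ^ (j : ℕ)) := by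
    intro j
    rw [sum_eq_single j.succ] <;> simp +contextual [pow_succ]
    ring
  rw [sum_congr rfl fun j _ => h2 j, ← mul_sum, evalMonic]
  have h3 : evalVec r w = (∑ j : Fin n, r j.castSucc * w ^ (j : ℕ)) + r (Fin.last n) * w ^ n := by
    simp [evalVec, Fin.sum_univ_castSucc]
  rw [h3]
  ring

theorem lastRow_mul (A B : TodaMat n) (j : Fin (n + 1)) :
    (A * B) (Fin.last n) j = (A (Fin.last n) ᵥ* B) j := rfl

/-- Written as e_{i-1} - p_i e_n, the row of number i is in the form that lets Horner's recursion
cancel its last entry. -/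
theorem vecMul_single_companion (p : Fin (n + 1) → ℝ) (i j : Fin (n + 1)) :
    companion p i j = (if h : (i : ℕ) = 0 then 0 else
      (1 : TodaMat n) ⟨i - 1, by omega⟩ j) - p i * (1 : TodaMat n) (Fin.last n) j := by
  have e : (if j = Fin.last n then p i else 0) = p i * (1 : TodaMat n) (Fin.last n) j := by
    rw [Matrix.one_apply]
    simp [eq_comm]
  simp only [companion, Matrix.of_apply, e]
  congr 1
  split_ifs with h1 h2 h2
  · omega
  · rw [Matrix.one_apply, if_pos]
    ext; simp; omega
  · rfl
  · rw [Matrix.one_apply, if_neg]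
    intro h; apply h1; rw [← h]; simp; omega

/-- The last row of the Horner polynomial of the companion matrix of number `i + 1` is the
unit vector of number `i`. -/
theorem horner_companion_last (p : Fin (n + 1) → ℝ) (i j : Fin (n + 1)) :
    horner p (companion p) (i + 1) (Fin.last n) j = (1 : TodaMat n) i j := by
  -- The induction descends from the top Horner polynomial, which is the identity, so the index is
  -- written as n - k. Multiplication of e_{m+1} by C produces e_m - p_{m+1} e_n, and the constant
  -- term of the recursion cancels the second part.
  suffices H : ∀ k (hk : k ≤ n) (j : Fin (n + 1)),
      horner p (companion p) (n - k + 1) (Fin.last n) j = (1 : TodaMat n) ⟨n - k, by omega⟩ j by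
    have := H (n - i) (by omega) j
    have e : n - (n - (i : ℕ)) = i := by omega
    simp only [e] at this
    exact this.trans (congrArg (fun t => (1 : TodaMat n) t j) (Fin.ext e))
  intro k
  induction k with
  | zero => intro _ j; simp only [Nat.sub_zero, horner_top]; rfl
  | succ k ih =>
    intro hk j
    obtain ⟨m, hm⟩ : ∃ m, n - k = m + 1 := ⟨n - k - 1, by omega⟩
    have hmm : n - (k + 1) = m := by omega
    have ih' := ih (by omega)
    simp only [hm] at ih'
    simp only [hmm]
    have hc : Commute (companion p) (horner p (companion p) (m + 1 + 1)) :=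
      commute_horner p (Commute.refl _) _
    have h1 : monicCoeff p (m + 1) = p ⟨m + 1, by omega⟩ := monicCoeff_fin p ⟨m + 1, by omega⟩
    have h2 : horner p (companion p) (m + 1 + 1) (Fin.last n) =
        (Pi.single ⟨m + 1, by omega⟩ 1 : Fin (n + 1) → ℝ) := by
      ext l; rw [ih', Matrix.one_eq_pi_single]
      simp only [hm]
    rw [horner_rec, hc.eq, Matrix.add_apply, Matrix.smul_apply, lastRow_mul, h2,
      single_one_vecMul, h1, Matrix.row_apply, vecMul_single_companion]
    simp only [Nat.add_eq_zero_iff, one_ne_zero, and_false, dite_false, smul_eq_mul,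
      add_sub_cancel]
    exact congrArg (fun t => (1 : TodaMat n) t j) (Fin.ext hmm.symm)

/-- A matrix that commutes with a companion matrix is determined by its last row. -/
theorem eq_zero_of_commute_companion {p : Fin (n + 1) → ℝ} {Z : TodaMat n}
    (hZ : Commute Z (companion p)) (h : ∀ j, Z (Fin.last n) j = 0) : Z = 0 := by
  ext i j
  have hc := (commute_horner p hZ (i + 1)).eq
  have h1 : (horner p (companion p) (i + 1) * Z) (Fin.last n) j = Z i j := by
    -- Left multiplication by this Horner polynomial copies row i of Z into the last row;
    -- commutation then expresses row i through the last row of Z.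
    have h2 : horner p (companion p) (i + 1) (Fin.last n) = (Pi.single i 1 : Fin (n + 1) → ℝ) := by
      ext l; rw [horner_companion_last, Matrix.one_eq_pi_single]
    rw [lastRow_mul, h2, single_one_vecMul, Matrix.row_apply]
  rw [← h1, ← hc, lastRow_mul]
  have h0 : Z (Fin.last n) = 0 := funext h
  rw [h0, zero_vecMul]; rfl

theorem eq_of_commute_companion {p : Fin (n + 1) → ℝ} {Y Z : TodaMat n}
    (hY : Commute Y (companion p)) (hZ : Commute Z (companion p))
    (h : ∀ j, Y (Fin.last n) j = Z (Fin.last n) j) : Y = Z :=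
  sub_eq_zero.mp (eq_zero_of_commute_companion (hY.sub_left hZ) fun j => by
    rw [Matrix.sub_apply, h j, sub_self])

/-- The Cayley–Hamilton theorem for companion matrices. -/
theorem horner_companion_zero (p : Fin (n + 1) → ℝ) : horner p (companion p) 0 = 0 := by
  apply eq_zero_of_commute_companion (p := p)
  · exact (commute_horner p (Commute.refl _) _).symm
  · intro j
    have hc : Commute (companion p) (horner p (companion p) (0 + 1)) :=
      commute_horner p (Commute.refl _) _
    have h2 : horner p (companion p) (0 + 1) (Fin.last n) = (Pi.single 0 1 : Fin (n + 1) → ℝ) := by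
      ext l
      have := horner_companion_last p 0 l
      rw [Matrix.one_eq_pi_single] at this
      simpa using this
    have h1 : monicCoeff p 0 = p 0 := monicCoeff_fin p 0
    rw [horner_rec, hc.eq, Matrix.add_apply, Matrix.smul_apply, lastRow_mul, h2,
      single_one_vecMul, h1, Matrix.row_apply, vecMul_single_companion]
    simp

/-- The last row is dual to the Horner polynomials. -/
theorem sum_lastRow_smul_horner {p : Fin (n + 1) → ℝ} {Y : TodaMat n}
    (hY : Commute Y (companion p)) :
    ∑ i, Y (Fin.last n) i • horner p (companion p) (i + 1) = Y := by
  refine eq_of_commute_companion ?_ hY fun j => ?_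
  · exact Commute.sum_left _ _ _ fun i _ =>
      ((commute_horner p (Commute.refl _) _).symm).smul_left _
  · rw [Matrix.sum_apply]
    simp only [Matrix.smul_apply, horner_companion_last, Matrix.one_apply, smul_eq_mul]
    simp

end Companion

/-! ### The coefficients of the brackets on rational functions -/

section BracketCoeff

open Finset Matrix

variable {n : ℕ}

/-- The Bezoutian of the monic polynomial `p` and `r`, as a polynomial in the second variable. -/
def bezVec (p r : Fin (n + 1) → ℝ) (z : ℝ) : Fin (n + 1) → ℝ :=
  (∑ i : Fin (n + 1), z ^ (i : ℕ) • horner p (companion p) (i + 1)) *ᵥ r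

theorem horner_mulVec_last (p r : Fin (n + 1) → ℝ) (i : Fin (n + 1)) :
    (horner p (companion p) (i + 1) *ᵥ r) (Fin.last n) = r i := by
  simp [mulVec, dotProduct, horner_companion_last, Matrix.one_apply]

theorem bezVec_apply (p r : Fin (n + 1) → ℝ) (z : ℝ) (j : Fin (n + 1)) :
    bezVec p r z j = ∑ i : Fin (n + 1), z ^ (i : ℕ) * (horner p (companion p) (i + 1) *ᵥ r) j := by
  simp [bezVec, sum_mulVec, smul_mulVec, Finset.sum_apply]

theorem bezVec_last (p r : Fin (n + 1) → ℝ) (z : ℝ) :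
    bezVec p r z (Fin.last n) = evalVec r z := by
  simp [bezVec_apply, horner_mulVec_last, evalVec, mul_comm]

/-- This is the Horner form of the adjugate applied to r: p(C) = 0 by Cayley–Hamilton, and the
reduction term of multiplication by C carries the leading coefficient r(z). -/
theorem evalVec_bezVec (p r : Fin (n + 1) → ℝ) (z w : ℝ) :
    (z - w) * evalVec (bezVec p r z) w =
      evalMonic p z * evalVec r w - evalVec r z * evalMonic p w := by
  have h := congrArg (fun M => evalVec (M *ᵥ r) w) (sub_mul_sum_horner p (companion p) z)
  simp only [horner_companion_zero, sub_zero, ← mulVec_mulVec, smul_mulVec, one_mulVec] at h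
  rw [← bezVec, sub_mulVec, smul_mulVec, one_mulVec, evalVec_sub, evalVec_smul, evalVec_smul,
    evalVec_companion_mulVec, bezVec_last] at h
  linarith

/-- The Bezoutian is built from polynomials in C, so it commutes with everything in the commutant of
C. This turns derivatives of the bracket coefficients into Bezoutians again. -/
theorem mulVec_bezVec {p : Fin (n + 1) → ℝ} {S : TodaMat n} (hS : Commute S (companion p))
    (r : Fin (n + 1) → ℝ) (z : ℝ) : S *ᵥ bezVec p r z = bezVec p (S *ᵥ r) z := by
  have hc : Commute S (∑ i : Fin (n + 1), z ^ (i : ℕ) • horner p (companion p) (i + 1)) :=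
    Commute.sum_right _ _ _ fun i _ => (commute_horner p hS _).smul_right _
  rw [bezVec, bezVec, mulVec_mulVec, mulVec_mulVec, hc.eq]

/-- Symmetry of the Bezoutian in its two variables, visible after multiplication by z - w. It gives
columns of the bracket the same description as rows. -/
theorem evalVec_horner_mulVec (p r : Fin (n + 1) → ℝ) (w : ℝ) :
    (fun i : Fin (n + 1) => evalVec (horner p (companion p) (i + 1) *ᵥ r) w) = bezVec p r w := by
  refine evalVec_injective (finite_singleton w) fun z hz => ?_
  have hzw : z - w ≠ 0 := sub_ne_zero.mpr hz
  have h1 : evalVec (fun i : Fin (n + 1) => evalVec (horner p (companion p) (i + 1) *ᵥ r) w) z =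
      evalVec (bezVec p r z) w := by
    simp only [evalVec, bezVec_apply, sum_mul]
    rw [sum_comm]
    refine sum_congr rfl fun i _ => sum_congr rfl fun j _ => by ring
  have h2 := evalVec_bezVec p r z w
  have h3 := evalVec_bezVec p r w z
  rw [h1]
  apply mul_left_cancel₀ hzw
  linarith

/-- The coefficients of a monic polynomial, with the leading one. -/
def monicVec (q : Fin n → ℝ) : Fin (n + 1) → ℝ := Fin.snoc q 1

theorem evalVec_monicVec (q : Fin n → ℝ) (z : ℝ) : evalVec (monicVec q) z = evalMonic q z := by
  rw [monicVec, evalVec_snoc, one_mul, evalMonic]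

/-- The value of the polynomial with coefficients `c` at the companion matrix. -/
def companionPoly (c p : Fin (n + 1) → ℝ) : TodaMat n :=
  ∑ k : Fin (n + 1), c k • companion p ^ (k : ℕ)

theorem commute_companionPoly (c p : Fin (n + 1) → ℝ) :
    Commute (companionPoly c p) (companion p) :=
  Commute.sum_left _ _ _ fun _ _ => ((Commute.refl _).pow_left _).smul_left _

/-- The remainder of `f q` modulo `p`, where `f` has the coefficients `c`. -/
def ratRem (c : Fin (n + 1) → ℝ) (a : RatCoeff n) : Fin (n + 1) → ℝ :=
  companionPoly c a.1 *ᵥ monicVec a.2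

/-- The bracket of the coefficients of number `i` of `p` and of number `j` of `q`. -/
def bracketCoeff (c : Fin (n + 1) → ℝ) (a : RatCoeff n) (i : Fin (n + 1)) (j : Fin n) : ℝ :=
  (horner a.1 (companion a.1) (i + 1) *ᵥ ratRem c a) j.castSucc - ratRem c a i * a.2 j

/-- The generating function of a matrix. -/
def evalMat (P : Fin (n + 1) → Fin n → ℝ) (z w : ℝ) : ℝ :=
  ∑ i : Fin (n + 1), z ^ (i : ℕ) * evalVec (P i) w

/-- The two terms have the same coefficient of w^n, namely that of g at z^i, because q is monic.
Dropping the top coefficient in the definition therefore loses nothing. -/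
theorem evalVec_bracketCoeff (c : Fin (n + 1) → ℝ) (a : RatCoeff n) (i : Fin (n + 1)) (w : ℝ) :
    evalVec (bracketCoeff c a i) w =
      evalVec (horner a.1 (companion a.1) (i + 1) *ᵥ ratRem c a) w
        - ratRem c a i * evalMonic a.2 w := by
  have h : (horner a.1 (companion a.1) (i + 1) *ᵥ ratRem c a) =
      Fin.snoc (fun j : Fin n => (horner a.1 (companion a.1) (i + 1) *ᵥ ratRem c a) j.castSucc)
        (ratRem c a i) := by
    ext j
    refine Fin.lastCases ?_ (fun j => ?_) j
    · simp [horner_mulVec_last]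
    · simp
  have h2 : bracketCoeff c a i =
      (fun j : Fin n => (horner a.1 (companion a.1) (i + 1) *ᵥ ratRem c a) j.castSucc) -
        ratRem c a i • a.2 := rfl
  rw [h, evalVec_snoc, h2, evalVec_sub, evalVec_smul, evalMonic]
  ring

theorem evalMat_bracketCoeff (c : Fin (n + 1) → ℝ) (a : RatCoeff n) (z w : ℝ) :
    evalMat (bracketCoeff c a) z w = evalVec (bezVec a.1 (ratRem c a) z) w
      - evalVec (ratRem c a) z * evalMonic a.2 w := by
  have h : evalVec (bezVec a.1 (ratRem c a) z) w = ∑ i : Fin (n + 1),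
      z ^ (i : ℕ) * evalVec (horner a.1 (companion a.1) (i + 1) *ᵥ ratRem c a) w := by
    simp only [evalVec, bezVec_apply, sum_mul, mul_sum]
    rw [sum_comm]
    refine sum_congr rfl fun i _ => sum_congr rfl fun j _ => by ring
  simp only [evalMat, evalVec_bracketCoeff, mul_sub, sum_sub_distrib, h]
  congr 1
  rw [evalVec, sum_mul]
  exact sum_congr rfl fun i _ => by ring

/-- The closed form of {p(z), q(w)}, multiplied by z - w so that it stays polynomial and can be
differentiated everywhere. -/
theorem sub_mul_evalMat_bracketCoeff (c : Fin (n + 1) → ℝ) (a : RatCoeff n) (z w : ℝ) :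
    (z - w) * evalMat (bracketCoeff c a) z w =
      evalMonic a.1 z * evalVec (ratRem c a) w - evalVec (ratRem c a) z * evalMonic a.1 w
        - (z - w) * (evalVec (ratRem c a) z * evalMonic a.2 w) := by
  rw [evalMat_bracketCoeff, mul_sub, evalVec_bezVec]

/-! ### Derivatives of the coefficients -/

theorem hasDerivAt_matrix {ι κ : Type*} [Fintype ι] [Fintype κ] {A : ℝ → Matrix ι κ ℝ}
    {A' : Matrix ι κ ℝ} {t : ℝ} :
    HasDerivAt A A' t ↔ ∀ i j, HasDerivAt (fun s => A s i j) (A' i j) t :=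
  hasDerivAt_pi.trans (forall_congr' fun _ => hasDerivAt_pi)

theorem HasDerivAt.matrix_mulVec {ι κ : Type*} [Fintype ι] [Fintype κ] {A : ℝ → Matrix ι κ ℝ}
    {A' : Matrix ι κ ℝ} {r : ℝ → κ → ℝ} {r' : κ → ℝ} {t : ℝ} (hA : HasDerivAt A A' t)
    (hr : HasDerivAt r r' t) :
    HasDerivAt (fun s => A s *ᵥ r s) (A' *ᵥ r t + A t *ᵥ r') t := by
  rw [hasDerivAt_pi]
  intro i
  have h := HasDerivAt.fun_sum (u := univ) fun j _ =>
    (hasDerivAt_matrix.mp hA i j).mul (hasDerivAt_pi.mp hr j)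
  simpa [mulVec, dotProduct, sum_add_distrib] using h

theorem HasDerivAt.matrix_mul {ι κ μ : Type*} [Fintype ι] [Fintype κ] [Fintype μ]
    {A : ℝ → Matrix ι κ ℝ} {A' : Matrix ι κ ℝ} {B : ℝ → Matrix κ μ ℝ} {B' : Matrix κ μ ℝ} {t : ℝ}
    (hA : HasDerivAt A A' t) (hB : HasDerivAt B B' t) :
    HasDerivAt (fun s => A s * B s) (A' * B t + A t * B') t := by
  rw [hasDerivAt_matrix]
  intro i k
  have h := HasDerivAt.fun_sum (u := univ) fun j _ =>
    (hasDerivAt_matrix.mp hA i j).mul (hasDerivAt_matrix.mp hB j k)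
  simpa [Matrix.mul_apply, sum_add_distrib] using h

/-- The derivative of the companion matrix in the direction `δp`. -/
def companionDeriv (δp : Fin (n + 1) → ℝ) : TodaMat n :=
  Matrix.of fun i j => if j = Fin.last n then -δp i else 0

theorem companionDeriv_mulVec (δp r : Fin (n + 1) → ℝ) :
    companionDeriv δp *ᵥ r = -(r (Fin.last n) • δp) := by
  ext i
  simp [mulVec, dotProduct, companionDeriv, mul_comm]

theorem companion_add (p δp : Fin (n + 1) → ℝ) (t : ℝ) :
    companion (p + t • δp) = companion p + t • companionDeriv δp := by
  ext i j
  simp only [companion, companionDeriv, Matrix.of_apply, Matrix.add_apply, Matrix.smul_apply,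
    Pi.add_apply, Pi.smul_apply, smul_eq_mul]
  split_ifs <;> ring

theorem hasDerivAt_companion (p δp : Fin (n + 1) → ℝ) (t : ℝ) :
    HasDerivAt (fun s : ℝ => companion (p + s • δp)) (companionDeriv δp) t := by
  rw [hasDerivAt_matrix]
  intro i j
  simp only [companion_add, Matrix.add_apply, Matrix.smul_apply, smul_eq_mul]
  simpa using ((hasDerivAt_id t).mul_const (companionDeriv δp i j)).const_add (companion p i j)

theorem monicVec_add (q δq : Fin n → ℝ) (t : ℝ) :
    monicVec (q + t • δq) = monicVec q + t • (Fin.snoc δq 0 : Fin (n + 1) → ℝ) := by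
  ext j
  refine Fin.lastCases ?_ (fun j => ?_) j <;> simp [monicVec]

theorem hasDerivAt_add_smul {E : Type*} [NormedAddCommGroup E] [NormedSpace ℝ E] (x v : E) (t : ℝ) :
    HasDerivAt (fun s : ℝ => x + s • v) v t := by
  simpa using ((hasDerivAt_id t).smul_const v).const_add x

/-- Varying one factor C of C^k q by δp replaces everything to its right by its leading coefficient
times -δp. What remains on the left is a power of C, so the total factor S in front of δp commutes
with C. -/
theorem exists_hasDerivAt_companion_pow (a : RatCoeff n) (k : ℕ) :
    ∃ S : TodaMat n, Commute S (companion a.1) ∧ ∀ v : RatCoeff n,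
      HasDerivAt (fun t : ℝ => companion (a.1 + t • v.1) ^ k *ᵥ monicVec (a.2 + t • v.2))
        (companion a.1 ^ k *ᵥ (Fin.snoc v.2 0 : Fin (n + 1) → ℝ) - S *ᵥ v.1) 0 := by
  induction k with
  | zero =>
    refine ⟨0, Commute.zero_left _, fun v => ?_⟩
    simp only [pow_zero, one_mulVec, zero_mulVec, sub_zero, monicVec_add]
    exact hasDerivAt_add_smul _ _ _
  | succ k ih =>
    obtain ⟨S, hS, h⟩ := ih
    refine ⟨companion a.1 * S + (companion a.1 ^ k *ᵥ monicVec a.2) (Fin.last n) • 1,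
      ((Commute.refl _).mul_left hS).add_left ((Commute.one_left _).smul_left _), fun v => ?_⟩
    have h1 := (hasDerivAt_companion a.1 v.1 0).matrix_mulVec (h v)
    simp only [mulVec_mulVec, ← pow_succ'] at h1
    refine h1.congr_deriv ?_
    rw [zero_smul, zero_smul, add_zero, add_zero, ← mulVec_mulVec, companionDeriv_mulVec]
    simp only [mulVec_sub, mulVec_mulVec, add_mulVec, smul_mulVec, one_mulVec, ← pow_succ']
    abel

theorem exists_hasDerivAt_ratRem (c : Fin (n + 1) → ℝ) (a : RatCoeff n) :
    ∃ S : TodaMat n, Commute S (companion a.1) ∧ ∀ v : RatCoeff n,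
      HasDerivAt (fun t : ℝ => ratRem c (a + t • v))
        (companionPoly c a.1 *ᵥ (Fin.snoc v.2 0 : Fin (n + 1) → ℝ) - S *ᵥ v.1) 0 := by
  choose S hS h using exists_hasDerivAt_companion_pow a
  refine ⟨∑ k : Fin (n + 1), c k • S k,
    Commute.sum_left _ _ _ fun _ _ => (hS _).smul_left _, fun v => ?_⟩
  have h1 := HasDerivAt.fun_sum (u := univ) fun (k : Fin (n + 1)) _ =>
    (h k v).fun_const_smul (c k)
  have e : (fun t : ℝ => ratRem c (a + t • v)) = fun t => ∑ k : Fin (n + 1),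
      c k • (companion (a.1 + t • v.1) ^ (k : ℕ) *ᵥ monicVec (a.2 + t • v.2)) := by
    funext t
    simp [ratRem, companionPoly, sum_mulVec, smul_mulVec]
  rw [e]
  refine h1.congr_deriv ?_
  simp [companionPoly, sum_mulVec, smul_mulVec, smul_sub, sum_sub_distrib]

end BracketCoeff

/-! ### The Jacobi identity for the coefficients -/

section BracketJacobi

open Finset Matrix

variable {n : ℕ}

/-- The generating functions are computed by division by differences of the variables, so equality
is available only for distinct arguments. Each variable is eliminated in turn, a polynomial that
vanishes off a finite set being zero. -/
theorem eq_zero_of_evalVec_evalVec_evalVec {A B C : ℕ} {T : Fin A → Fin B → Fin C → ℝ}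
    (h : ∀ x y z : ℝ, x ≠ y → x ≠ z → y ≠ z →
      evalVec (fun i => evalVec (fun j => evalVec (T i j) z) y) x = 0)
    (i : Fin A) (j : Fin B) (l : Fin C) : T i j l = 0 := by
  have h1 : ∀ x y : ℝ, x ≠ y → ∀ l,
      evalVec (fun i => evalVec (fun j => T i j l) y) x = 0 := by
    intro x y hxy
    have : (fun l => evalVec (fun i => evalVec (fun j => T i j l) y) x) = 0 := by
      refine eq_zero_of_evalVec ((finite_singleton x).insert y) fun z hz => ?_
      simp only [mem_insert_iff, mem_singleton_iff, not_or] at hz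
      rw [← h x y z hxy (Ne.symm hz.2) (Ne.symm hz.1)]
      simp only [evalVec, sum_mul]
      rw [sum_comm]
      refine sum_congr rfl fun i _ => ?_
      rw [sum_comm]
      exact sum_congr rfl fun j _ => sum_congr rfl fun l _ => by ring
    exact fun l => congrFun this l
  have h2 : ∀ x : ℝ, ∀ l j, evalVec (fun i => T i j l) x = 0 := by
    intro x l
    have : (fun j => evalVec (fun i => T i j l) x) = 0 := by
      refine eq_zero_of_evalVec (finite_singleton x) fun y hy => ?_
      rw [← h1 x y (Ne.symm hy) l]
      simp only [evalVec, sum_mul]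
      rw [sum_comm]
      exact sum_congr rfl fun i _ => sum_congr rfl fun j _ => by ring
    exact fun j => congrFun this j
  have h3 : (fun i => T i j l) = 0 :=
    eq_zero_of_evalVec finite_empty fun x _ => h2 x l j
  exact congrFun h3 i

/-! ### Smoothness of matrix expressions and of the bracket coefficients. -/

section Smooth

variable {E : Type*} [NormedAddCommGroup E] [NormedSpace ℝ E]

theorem contDiff_matrix_mul {ι κ μ : Type*} [Fintype κ] {A : E → Matrix ι κ ℝ}
    {B : E → Matrix κ μ ℝ} (hA : ∀ i j, ContDiff ℝ ∞ fun x => A x i j)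
    (hB : ∀ i j, ContDiff ℝ ∞ fun x => B x i j) (i : ι) (j : μ) :
    ContDiff ℝ ∞ fun x => (A x * B x) i j := by
  simp only [Matrix.mul_apply]
  exact ContDiff.sum fun k _ => (hA i k).mul (hB k j)

theorem contDiff_matrix_mulVec {ι κ : Type*} [Fintype κ] {A : E → Matrix ι κ ℝ}
    {r : E → κ → ℝ} (hA : ∀ i j, ContDiff ℝ ∞ fun x => A x i j)
    (hr : ∀ j, ContDiff ℝ ∞ fun x => r x j) (i : ι) :
    ContDiff ℝ ∞ fun x => (A x *ᵥ r x) i := by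
  simp only [mulVec, dotProduct]
  exact ContDiff.sum fun k _ => (hA i k).mul (hr k)

theorem contDiff_matrix_pow {ι : Type*} [Fintype ι] [DecidableEq ι] {A : E → Matrix ι ι ℝ}
    (hA : ∀ i j, ContDiff ℝ ∞ fun x => A x i j) (k : ℕ) :
    ∀ i j, ContDiff ℝ ∞ fun x => (A x ^ k) i j := by
  induction k with
  | zero => intro i j; simp only [pow_zero]; exact contDiff_const
  | succ k ih => simp only [pow_succ]; exact contDiff_matrix_mul ih hA

end Smooth

theorem contDiff_fst_apply (i : Fin (n + 1)) : ContDiff ℝ ∞ fun a : RatCoeff n => a.1 i :=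
  (contDiff_apply ℝ ℝ i).comp contDiff_fst

theorem contDiff_snd_apply (i : Fin n) : ContDiff ℝ ∞ fun a : RatCoeff n => a.2 i :=
  (contDiff_apply ℝ ℝ i).comp contDiff_snd

theorem contDiff_companion (i j : Fin (n + 1)) :
    ContDiff ℝ ∞ fun a : RatCoeff n => companion a.1 i j := by
  simp only [companion, Matrix.of_apply]
  split_ifs
  all_goals first | exact contDiff_const.sub (contDiff_fst_apply i) | exact contDiff_const

theorem contDiff_monicCoeff (l : ℕ) : ContDiff ℝ ∞ fun a : RatCoeff n => monicCoeff a.1 l := by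
  simp only [monicCoeff]
  split_ifs
  · exact contDiff_fst_apply _
  · exact contDiff_const
  · exact contDiff_const

theorem contDiff_horner (k : ℕ) (i j : Fin (n + 1)) :
    ContDiff ℝ ∞ fun a : RatCoeff n => horner a.1 (companion a.1) k i j := by
  simp only [horner, Matrix.sum_apply, Matrix.smul_apply, smul_eq_mul]
  exact ContDiff.sum fun l _ => (contDiff_monicCoeff _).mul
    (contDiff_matrix_pow contDiff_companion l i j)

theorem contDiff_monicVec (j : Fin (n + 1)) :
    ContDiff ℝ ∞ fun a : RatCoeff n => monicVec a.2 j := by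
  refine Fin.lastCases ?_ (fun j => ?_) j
  · simp only [monicVec, Fin.snoc_last]; exact contDiff_const
  · simp only [monicVec, Fin.snoc_castSucc]; exact contDiff_snd_apply j

theorem contDiff_ratRem (c : Fin (n + 1) → ℝ) (j : Fin (n + 1)) :
    ContDiff ℝ ∞ fun a : RatCoeff n => ratRem c a j := by
  refine contDiff_matrix_mulVec (fun i j => ?_) contDiff_monicVec j
  simp only [companionPoly, Matrix.sum_apply, Matrix.smul_apply, smul_eq_mul]
  exact ContDiff.sum fun l _ => contDiff_const.mul (contDiff_matrix_pow contDiff_companion l i j)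

theorem contDiff_bracketCoeff (c : Fin (n + 1) → ℝ) (i : Fin (n + 1)) (j : Fin n) :
    ContDiff ℝ ∞ fun a : RatCoeff n => bracketCoeff c a i j :=
  (contDiff_matrix_mulVec (contDiff_horner _) (contDiff_ratRem c) _).sub
    ((contDiff_ratRem c i).mul (contDiff_snd_apply j))

/-- The derivative of the coefficients of the bracket. -/
noncomputable def bracketDeriv (c : Fin (n + 1) → ℝ) (a v : RatCoeff n) (i : Fin (n + 1))
    (j : Fin n) : ℝ :=
  fderiv ℝ (fun b => bracketCoeff c b i j) a v

theorem hasDerivAt_comp_add_smul {E : Type*} [NormedAddCommGroup E] [NormedSpace ℝ E] {f : E → ℝ}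
    {x : E} (hf : DifferentiableAt ℝ f x) (v : E) :
    HasDerivAt (fun t : ℝ => f (x + t • v)) (fderiv ℝ f x v) 0 := by
  have h1 : HasFDerivAt f (fderiv ℝ f x) (x + (0 : ℝ) • v) := by simpa using hf.hasFDerivAt
  exact h1.comp_hasDerivAt 0 (hasDerivAt_add_smul x v 0)

theorem hasDerivAt_evalVec {N : ℕ} {r : ℝ → Fin N → ℝ} {r' : Fin N → ℝ} {t : ℝ}
    (hr : HasDerivAt r r' t) (z : ℝ) :
    HasDerivAt (fun s => evalVec (r s) z) (evalVec r' z) t :=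
  HasDerivAt.fun_sum (u := univ) fun i _ => (hasDerivAt_pi.mp hr i).mul_const _

/-- The product rule applied to the closed form of the bracket. The variation of g enters as a free
`r`, so that its Bezoutian form can be substituted later; S does not depend on the direction. -/
theorem exists_sub_mul_evalMat_bracketDeriv (c : Fin (n + 1) → ℝ) (a : RatCoeff n) :
    ∃ S : TodaMat n, Commute S (companion a.1) ∧ ∀ (v : RatCoeff n) (r : Fin (n + 1) → ℝ),
      r = companionPoly c a.1 *ᵥ (Fin.snoc v.2 0 : Fin (n + 1) → ℝ) - S *ᵥ v.1 →
      ∀ z w : ℝ, (z - w) * evalMat (bracketDeriv c a v) z w =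
        evalVec v.1 z * evalVec (ratRem c a) w + evalMonic a.1 z * evalVec r w
          - (evalVec r z * evalMonic a.1 w + evalVec (ratRem c a) z * evalVec v.1 w)
          - (z - w) * (evalVec r z * evalMonic a.2 w + evalVec (ratRem c a) z * evalVec v.2 w) := by
  obtain ⟨S, hS, h⟩ := exists_hasDerivAt_ratRem c a
  refine ⟨S, hS, fun v r hr z w => ?_⟩
  have hQ := h v
  rw [← hr] at hQ
  have hp : ∀ x, HasDerivAt (fun t : ℝ => evalMonic (a + t • v).1 x) (evalVec v.1 x) 0 := fun x =>
    (hasDerivAt_evalVec (hasDerivAt_add_smul a.1 v.1 0) x).const_add _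
  have hq : ∀ x, HasDerivAt (fun t : ℝ => evalMonic (a + t • v).2 x) (evalVec v.2 x) 0 := fun x =>
    (hasDerivAt_evalVec (hasDerivAt_add_smul a.2 v.2 0) x).const_add _
  have hQ' := fun x => hasDerivAt_evalVec hQ x
  have hL : HasDerivAt (fun t : ℝ => (z - w) * evalMat (bracketCoeff c (a + t • v)) z w)
      ((z - w) * evalMat (bracketDeriv c a v) z w) 0 := by
    refine HasDerivAt.const_mul _ (HasDerivAt.fun_sum fun i _ => HasDerivAt.const_mul _
      (HasDerivAt.fun_sum fun j _ => HasDerivAt.mul_const ?_ _))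
    exact hasDerivAt_comp_add_smul
      ((contDiff_bracketCoeff c i j).differentiable (by simp)).differentiableAt v
  have hR := (((hp z).mul (hQ' w)).sub ((hQ' z).mul (hp w))).sub
    (((hQ' z).mul (hq w)).const_mul (z - w))
  simp only [sub_mul_evalMat_bracketCoeff] at hL
  have := hL.unique hR
  simpa using this

/-- The row `∑ i, z ^ i P_i` of the bracket. -/
theorem snoc_sum_bracketCoeff (c : Fin (n + 1) → ℝ) (a : RatCoeff n) (z : ℝ) :
    (Fin.snoc (∑ i : Fin (n + 1), z ^ (i : ℕ) • bracketCoeff c a i) 0 : Fin (n + 1) → ℝ) =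
      bezVec a.1 (ratRem c a) z - evalVec (ratRem c a) z • monicVec a.2 := by
  ext j
  refine Fin.lastCases ?_ (fun j => ?_) j
  · simp [bezVec_last, monicVec]
  · simp only [Fin.snoc_castSucc, Finset.sum_apply, Pi.smul_apply, smul_eq_mul, Pi.sub_apply,
      bezVec_apply, monicVec, evalVec, bracketCoeff, mul_sub, sum_sub_distrib, sum_mul]
    congr 1
    exact sum_congr rfl fun i _ => by ring

theorem evalVec_sum_bracketCoeff (c : Fin (n + 1) → ℝ) (a : RatCoeff n) (z w : ℝ) :
    evalVec (∑ i : Fin (n + 1), z ^ (i : ℕ) • bracketCoeff c a i) w =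
      evalMat (bracketCoeff c a) z w := by
  simp [evalVec_sum, evalVec_smul, evalMat]

/-- The column `∑ j, w ^ j P^j` of the bracket, completed by `w ^ n` times the vector of `f q`. -/
theorem evalVec_bracketCoeff_col (c : Fin (n + 1) → ℝ) (a : RatCoeff n) (w : ℝ) :
    (fun i => evalVec (bracketCoeff c a i) w) =
      bezVec a.1 (ratRem c a) w - evalMonic a.2 w • ratRem c a := by
  rw [← evalVec_horner_mulVec]
  ext i
  simp only [evalVec_bracketCoeff, Pi.sub_apply, Pi.smul_apply, smul_eq_mul]
  ring

theorem bracketDeriv_sum {ι : Type*} (s : Finset ι) (c : Fin (n + 1) → ℝ) (a : RatCoeff n)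
    (x : ι → ℝ) (v : ι → RatCoeff n) (i : Fin (n + 1)) (j : Fin n) :
    bracketDeriv c a (∑ k ∈ s, x k • v k) i j = ∑ k ∈ s, x k * bracketDeriv c a (v k) i j := by
  simp [bracketDeriv]

theorem evalMat_eq_evalVec (P : Fin (n + 1) → Fin n → ℝ) (z w : ℝ) :
    evalMat P z w = evalVec (fun i => evalVec (P i) w) z := by
  simp only [evalMat, evalVec]
  exact sum_congr rfl fun i _ => mul_comm _ _

theorem evalVec_bracketDeriv {N : ℕ} (c : Fin (n + 1) → ℝ) (a : RatCoeff n)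
    (v : Fin N → RatCoeff n) (x y z : ℝ) :
    evalVec (fun i => evalMat (bracketDeriv c a (v i)) y z) x =
      evalMat (bracketDeriv c a (∑ i : Fin N, x ^ (i : ℕ) • v i)) y z := by
  simp only [evalMat, evalVec, bracketDeriv_sum, mul_sum, sum_mul]
  rw [sum_comm]
  refine sum_congr rfl fun i _ => ?_
  rw [sum_comm]
  exact sum_congr rfl fun j _ => sum_congr rfl fun l _ => by ring

/-- The Jacobi identity for p(x), p(y), q(z). A row, viewed as a variation of q, is a Bezoutian
minus a multiple of q, so f(C) sends it to the Bezoutian of f(C) g minus the same multiple of g. -/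
theorem evalMat_bracketDeriv_row (c : Fin (n + 1) → ℝ) (a : RatCoeff n) {x y z : ℝ}
    (hxy : x ≠ y) (hxz : x ≠ z) (hyz : y ≠ z) :
    evalMat (bracketDeriv c a (0, ∑ i : Fin (n + 1), x ^ (i : ℕ) • bracketCoeff c a i)) y z =
      evalMat (bracketDeriv c a (0, ∑ i : Fin (n + 1), y ^ (i : ℕ) • bracketCoeff c a i)) x z := by
  obtain ⟨S, hS, h⟩ := exists_sub_mul_evalMat_bracketDeriv c a
  have hr : ∀ x : ℝ, companionPoly c a.1 *ᵥ (Fin.snoc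
      (∑ i : Fin (n + 1), x ^ (i : ℕ) • bracketCoeff c a i) 0 : Fin (n + 1) → ℝ) =
      bezVec a.1 (companionPoly c a.1 *ᵥ ratRem c a) x - evalVec (ratRem c a) x • ratRem c a := by
    intro x
    rw [snoc_sum_bracketCoeff, mulVec_sub, mulVec_smul,
      mulVec_bezVec (commute_companionPoly c a.1)]
    rfl
  set g := companionPoly c a.1 *ᵥ ratRem c a with hg
  have h1 := h (0, ∑ i : Fin (n + 1), x ^ (i : ℕ) • bracketCoeff c a i) _
    (by rw [hr, mulVec_zero, sub_zero]) y z
  have h2 := h (0, ∑ i : Fin (n + 1), y ^ (i : ℕ) • bracketCoeff c a i) _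
    (by rw [hr, mulVec_zero, sub_zero]) x z
  have h0 : ∀ w, evalVec (0 : Fin (n + 1) → ℝ) w = 0 := fun w => by simp [evalVec]
  simp only [h0, evalVec_sum_bracketCoeff, evalVec_sub, evalVec_smul, evalMat_bracketCoeff]
    at h1 h2
  have b1 := evalVec_bezVec a.1 g x y
  have b2 := evalVec_bezVec a.1 g x z
  have b3 := evalVec_bezVec a.1 g y x
  have b4 := evalVec_bezVec a.1 g y z
  have b5 := evalVec_bezVec a.1 (ratRem c a) x z
  have b6 := evalVec_bezVec a.1 (ratRem c a) y z
  have exy := sub_ne_zero.mpr hxy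
  have eyx := sub_ne_zero.mpr hxy.symm
  have exz := sub_ne_zero.mpr hxz
  have eyz := sub_ne_zero.mpr hyz
  -- All Bezoutians are now replaced by their quotients; what remains is an identity of rational
  -- functions in which the values of p, q, g and f(C) g are independent symbols.
  rw [mul_comm] at b1 b2 b3 b4 b5 b6
  rw [← eq_div_iff exy] at b1
  rw [← eq_div_iff exz] at b2 b5
  rw [← eq_div_iff eyx] at b3
  rw [← eq_div_iff eyz] at b4 b6
  rw [b1, b2, b5] at h1
  rw [b3, b4, b6] at h2
  rw [mul_comm, ← eq_div_iff eyz] at h1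
  rw [mul_comm, ← eq_div_iff exz] at h2
  rw [h1, h2]
  field_simp
  ring

/-- The Jacobi identity for p(z), q(x), q(y). A column is a variation of p; only the commutation of
S with C is needed, not its value. -/
theorem evalMat_bracketDeriv_col (c : Fin (n + 1) → ℝ) (a : RatCoeff n) {x y z : ℝ}
    (hxy : x ≠ y) (hxz : x ≠ z) (hyz : y ≠ z) :
    evalMat (bracketDeriv c a (fun i => evalVec (bracketCoeff c a i) x, 0)) z y =
      evalMat (bracketDeriv c a (fun i => evalVec (bracketCoeff c a i) y, 0)) z x := by
  obtain ⟨S, hS, h⟩ := exists_sub_mul_evalMat_bracketDeriv c a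
  have hr : ∀ x : ℝ, S *ᵥ (fun i => evalVec (bracketCoeff c a i) x) =
      bezVec a.1 (S *ᵥ ratRem c a) x - evalMonic a.2 x • (S *ᵥ ratRem c a) := by
    intro x
    rw [evalVec_bracketCoeff_col, mulVec_sub, mulVec_smul, mulVec_bezVec hS]
  have h00 : (Fin.snoc (0 : Fin n → ℝ) 0 : Fin (n + 1) → ℝ) = 0 := by
    ext j
    refine Fin.lastCases ?_ (fun j => ?_) j <;> simp
  set g := S *ᵥ ratRem c a with hg
  have h1 := h (fun i => evalVec (bracketCoeff c a i) x, 0) _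
    (by rw [hr, h00, mulVec_zero, zero_sub]) z y
  have h2 := h (fun i => evalVec (bracketCoeff c a i) y, 0) _
    (by rw [hr, h00, mulVec_zero, zero_sub]) z x
  have h0 : ∀ w, evalVec (0 : Fin n → ℝ) w = 0 := fun w => by simp [evalVec]
  simp only [h0, evalVec_bracketCoeff_col, evalVec_neg, evalVec_sub, evalVec_smul]
    at h1 h2
  have b1 := evalVec_bezVec a.1 g x y
  have b2 := evalVec_bezVec a.1 g x z
  have b3 := evalVec_bezVec a.1 g y x
  have b4 := evalVec_bezVec a.1 g y z
  have b5 := evalVec_bezVec a.1 (ratRem c a) x z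
  have b6 := evalVec_bezVec a.1 (ratRem c a) y z
  have b7 := evalVec_bezVec a.1 (ratRem c a) x y
  have b8 := evalVec_bezVec a.1 (ratRem c a) y x
  have exy := sub_ne_zero.mpr hxy
  have eyx := sub_ne_zero.mpr hxy.symm
  have exz := sub_ne_zero.mpr hxz
  have eyz := sub_ne_zero.mpr hyz
  have ezx := sub_ne_zero.mpr hxz.symm
  have ezy := sub_ne_zero.mpr hyz.symm
  rw [mul_comm] at b1 b2 b3 b4 b5 b6 b7 b8
  rw [← eq_div_iff exy] at b1 b7
  rw [← eq_div_iff exz] at b2 b5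
  rw [← eq_div_iff eyx] at b3 b8
  rw [← eq_div_iff eyz] at b4 b6
  rw [b1, b2, b5, b7] at h1
  rw [b3, b4, b6, b8] at h2
  rw [mul_comm, ← eq_div_iff ezy] at h1
  rw [mul_comm, ← eq_div_iff ezx] at h2
  rw [evalVec_bracketCoeff_col, evalVec_bracketCoeff_col, h1, h2]
  field_simp
  ring

theorem bracketDeriv_row_comm (c : Fin (n + 1) → ℝ) (a : RatCoeff n) (i j : Fin (n + 1))
    (l : Fin n) :
    bracketDeriv c a (0, bracketCoeff c a i) j l = bracketDeriv c a (0, bracketCoeff c a j) i l := by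
  refine sub_eq_zero.mp (eq_zero_of_evalVec_evalVec_evalVec
    (T := fun i j => bracketDeriv c a (0, bracketCoeff c a i) j -
      (fun l => bracketDeriv c a (0, bracketCoeff c a j) i l)) (fun x y z hxy hxz hyz => ?_) i j l)
  have e : ∀ x : ℝ, ∑ i : Fin (n + 1), x ^ (i : ℕ) • ((0, bracketCoeff c a i) : RatCoeff n) =
      (0, ∑ i : Fin (n + 1), x ^ (i : ℕ) • bracketCoeff c a i) := by
    intro x; ext <;> simp [Prod.fst_sum, Prod.snd_sum]
  have h1 := evalVec_bracketDeriv c a (fun i => ((0, bracketCoeff c a i) : RatCoeff n)) x y z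
  have h2 := evalVec_bracketDeriv c a (fun i => ((0, bracketCoeff c a i) : RatCoeff n)) y x z
  rw [e] at h1 h2
  rw [evalMat_bracketDeriv_row c a hxy hxz hyz, ← h2] at h1
  simp only [evalMat_eq_evalVec] at h1
  simp only [evalVec_sub]
  have h3 : evalVec (fun i => evalVec (fun j => evalVec (bracketDeriv c a (0, bracketCoeff c a i) j) z) y) x
      = evalVec (fun i => evalVec (fun j => evalVec (bracketDeriv c a (0, bracketCoeff c a j) i) z) y) x := by
    rw [h1]
    simp only [evalVec, sum_mul]
    rw [sum_comm]
    exact sum_congr rfl fun i _ => sum_congr rfl fun j _ => sum_congr rfl fun l _ => by ring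
  rw [← sub_eq_zero, ← evalVec_sub] at h3
  rw [← h3]
  congr 1
  ext i
  rw [Pi.sub_apply, ← evalVec_sub]
  rfl

theorem bracketDeriv_col_comm (c : Fin (n + 1) → ℝ) (a : RatCoeff n) (i : Fin (n + 1))
    (j l : Fin n) :
    bracketDeriv c a (fun i => bracketCoeff c a i j, 0) i l =
      bracketDeriv c a (fun i => bracketCoeff c a i l, 0) i j := by
  refine sub_eq_zero.mp (eq_zero_of_evalVec_evalVec_evalVec
    (T := fun j i => bracketDeriv c a (fun i => bracketCoeff c a i j, 0) i -
      (fun l => bracketDeriv c a (fun i => bracketCoeff c a i l, 0) i j))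
      (fun x y z hxy hxz hyz => ?_) j i l)
  have e : ∀ x : ℝ, ∑ j : Fin n, x ^ (j : ℕ) • ((fun i => bracketCoeff c a i j, 0) : RatCoeff n) =
      (fun i => evalVec (bracketCoeff c a i) x, 0) := by
    intro x; ext <;> simp [Prod.fst_sum, Prod.snd_sum, evalVec, mul_comm]
  have h1 := evalVec_bracketDeriv c a
    (fun j => ((fun i => bracketCoeff c a i j, 0) : RatCoeff n)) x y z
  have h2 := evalVec_bracketDeriv c a
    (fun j => ((fun i => bracketCoeff c a i j, 0) : RatCoeff n)) z y x
  rw [e] at h1 h2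
  rw [evalMat_bracketDeriv_col c a hxz hxy hyz.symm, ← h2] at h1
  simp only [evalMat_eq_evalVec] at h1
  have h3 : evalVec (fun j => evalVec (fun i => evalVec
      (bracketDeriv c a (fun i => bracketCoeff c a i j, 0) i) z) y) x
      = evalVec (fun j => evalVec (fun i => evalVec
        (fun l => bracketDeriv c a (fun i => bracketCoeff c a i l, 0) i j) z) y) x := by
    rw [h1]
    simp only [evalVec, sum_mul]
    rw [sum_comm]
    rw [sum_congr rfl fun i _ => sum_comm]
    rw [sum_comm]
    exact sum_congr rfl fun i _ => sum_congr rfl fun j _ => sum_congr rfl fun l _ => by ring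
  rw [← sub_eq_zero, ← evalVec_sub] at h3
  rw [← h3]
  congr 1
  ext i
  rw [Pi.sub_apply, ← evalVec_sub]
  congr 1
  ext j
  rw [Pi.sub_apply, ← evalVec_sub]

end BracketJacobi

/-! ### Poisson brackets from bivector fields -/

section Bivector

variable {E : Type*} [NormedAddCommGroup E] [NormedSpace ℝ E]

theorem smoothNear_univ {f : E → ℝ} {x : E} :
    SmoothNear univ f x ↔ ∀ᶠ y in 𝓝 x, ContDiffAt ℝ ∞ f y := by
  simp [SmoothNear, nhdsWithin_univ, contDiffWithinAt_univ]

theorem contDiffAt_fderiv {f : E → ℝ} {x : E} (hf : ContDiffAt ℝ ∞ f x) :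
    ContDiffAt ℝ ∞ (fderiv ℝ f) x :=
  hf.fderiv_right (by simp)

theorem fderiv_fderiv_comm {f : E → ℝ} {x : E} (hf : ContDiffAt ℝ ∞ f x) (v w : E) :
    fderiv ℝ (fderiv ℝ f) x v w = fderiv ℝ (fderiv ℝ f) x w v :=
  (hf.isSymmSndFDerivAt (by simpa using (WithTop.coe_le_coe.mpr le_top : ((2 : ℕ∞) : WithTop ℕ∞) ≤ ∞))) v w

/-- The bracket of a bivector field. -/
noncomputable def bivectorBracket (Φ : E → (E →L[ℝ] ℝ) →L[ℝ] E) (f g : E → ℝ) (x : E) : ℝ :=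
  fderiv ℝ f x (Φ x (fderiv ℝ g x))

theorem fderiv_bivectorBracket {Φ : E → (E →L[ℝ] ℝ) →L[ℝ] E} {x : E} (hΦ : ContDiffAt ℝ ∞ Φ x)
    {g h : E → ℝ} (hg : ContDiffAt ℝ ∞ g x) (hh : ContDiffAt ℝ ∞ h x) (v : E) :
    fderiv ℝ (bivectorBracket Φ g h) x v =
      fderiv ℝ (fderiv ℝ g) x v (Φ x (fderiv ℝ h x)) +
        fderiv ℝ g x (fderiv ℝ Φ x v (fderiv ℝ h x) + Φ x (fderiv ℝ (fderiv ℝ h) x v)) := by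
  have dg := ((contDiffAt_fderiv hg).differentiableAt (by simp)).hasFDerivAt
  have dh := ((contDiffAt_fderiv hh).differentiableAt (by simp)).hasFDerivAt
  have dΦ := (hΦ.differentiableAt (by simp)).hasFDerivAt
  have := (dg.clm_apply (dΦ.clm_apply dh)).fderiv
  unfold bivectorBracket
  rw [this]
  simp [add_comm]

theorem contDiffAt_bivectorBracket {Φ : E → (E →L[ℝ] ℝ) →L[ℝ] E} {x : E}
    (hΦ : ContDiffAt ℝ ∞ Φ x) {g h : E → ℝ} (hg : ContDiffAt ℝ ∞ g x)
    (hh : ContDiffAt ℝ ∞ h x) : ContDiffAt ℝ ∞ (bivectorBracket Φ g h) x :=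
  (contDiffAt_fderiv hg).clm_apply (hΦ.clm_apply (contDiffAt_fderiv hh))

/-- A smooth skew bivector field whose Schouten square vanishes defines a Poisson bracket. -/
theorem isPoissonBracketOn_bivectorBracket {Φ : E → (E →L[ℝ] ℝ) →L[ℝ] E} (hΦ : ContDiff ℝ ∞ Φ)
    (hskew : ∀ (x : E) (α β : E →L[ℝ] ℝ), α (Φ x β) = -β (Φ x α))
    (hJ : ∀ (x : E) (α β γ : E →L[ℝ] ℝ), β (fderiv ℝ Φ x (Φ x α) γ) + γ (fderiv ℝ Φ x (Φ x β) α) +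
      α (fderiv ℝ Φ x (Φ x γ) β) = 0) :
    IsPoissonBracketOn univ (bivectorBracket Φ) where
  congr x _ f f' g _ _ h := by
    rw [nhdsWithin_univ] at h
    simp only [bivectorBracket, h.fderiv_eq]
  smooth x _ f g hf hg := by
    rw [smoothNear_univ] at *
    filter_upwards [hf, hg] with y hf hg
    exact contDiffAt_bivectorBracket hΦ.contDiffAt hf hg
  add x _ f g h hf hg _ := by
    rw [smoothNear_univ] at *
    simp only [bivectorBracket]
    rw [fderiv_add (hf.self_of_nhds.differentiableAt (by simp))
      (hg.self_of_nhds.differentiableAt (by simp))]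
    rfl
  smul x _ c f g hf _ := by
    rw [smoothNear_univ] at *
    simp only [bivectorBracket]
    rw [fderiv_const_smul (hf.self_of_nhds.differentiableAt (by simp))]
    rfl
  skew x _ f g _ _ := hskew x _ _
  leibniz x _ f g h hf hg _ := by
    rw [smoothNear_univ] at *
    simp only [bivectorBracket]
    rw [fderiv_mul (hf.self_of_nhds.differentiableAt (by simp))
      (hg.self_of_nhds.differentiableAt (by simp))]
    rfl
  jacobi x _ f g h hf hg hh := by
    rw [smoothNear_univ] at *
    replace hf := hf.self_of_nhds
    replace hg := hg.self_of_nhds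
    replace hh := hh.self_of_nhds
    -- In the cyclic sum each Hessian appears twice with opposite signs and exchanged arguments, so
    -- only the derivatives of the bivector survive.
    have key : ∀ f g h : E → ℝ, ContDiffAt ℝ ∞ g x → ContDiffAt ℝ ∞ h x →
        bivectorBracket Φ f (bivectorBracket Φ g h) x =
          -(fderiv ℝ (fderiv ℝ g) x (Φ x (fderiv ℝ f x)) (Φ x (fderiv ℝ h x)) +
            fderiv ℝ g x (fderiv ℝ Φ x (Φ x (fderiv ℝ f x)) (fderiv ℝ h x)) -
            fderiv ℝ (fderiv ℝ h) x (Φ x (fderiv ℝ f x)) (Φ x (fderiv ℝ g x))) := by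
      intro f g h hg hh
      conv_lhs => rw [bivectorBracket, hskew, fderiv_bivectorBracket hΦ.contDiffAt hg hh, map_add,
        hskew x (fderiv ℝ g x) (fderiv ℝ (fderiv ℝ h) x _)]
      ring
    rw [key f g h hg hh, key g h f hh hf, key h f g hf hg,
      fderiv_fderiv_comm hf (Φ x (fderiv ℝ h x)), fderiv_fderiv_comm hg (Φ x (fderiv ℝ h x)),
      fderiv_fderiv_comm hh (Φ x (fderiv ℝ g x))]
    linarith [hJ x (fderiv ℝ f x) (fderiv ℝ g x) (fderiv ℝ h x)]

end Bivector

/-! ### The brackets on rational functions -/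

section RatBracket

open Finset Matrix

variable {n : ℕ}

/-- The direction of the coefficient of number `i` of the denominator. -/
def denDir (i : Fin (n + 1)) : RatCoeff n := (Pi.single i 1, 0)

/-- The direction of the coefficient of number `j` of the numerator. -/
def numDir (j : Fin n) : RatCoeff n := (0, Pi.single j 1)

/-- The elementary bivector `∂ / ∂ p_i ∧ ∂ / ∂ q_j`. -/
noncomputable def elemBivector (i : Fin (n + 1)) (j : Fin n) :
    (RatCoeff n →L[ℝ] ℝ) →L[ℝ] RatCoeff n :=
  (ContinuousLinearMap.apply ℝ ℝ (numDir j)).smulRight (denDir i) -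
    (ContinuousLinearMap.apply ℝ ℝ (denDir i)).smulRight (numDir j)

theorem elemBivector_apply (i : Fin (n + 1)) (j : Fin n) (β : RatCoeff n →L[ℝ] ℝ) :
    elemBivector i j β = β (numDir j) • denDir i - β (denDir i) • numDir j := by
  simp [elemBivector]

/-- The bivector field of the bracket with multiplier `∑ k, c_k z ^ k`. -/
noncomputable def ratBivector (c : Fin (n + 1) → ℝ) (a : RatCoeff n) :
    (RatCoeff n →L[ℝ] ℝ) →L[ℝ] RatCoeff n :=
  ∑ i, ∑ j, bracketCoeff c a i j • elemBivector i j

theorem ratBivector_apply (c : Fin (n + 1) → ℝ) (a : RatCoeff n) (α β : RatCoeff n →L[ℝ] ℝ) :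
    α (ratBivector c a β) = ∑ i, ∑ j, bracketCoeff c a i j *
      (α (denDir i) * β (numDir j) - α (numDir j) * β (denDir i)) := by
  simp only [ratBivector, _root_.sum_apply, _root_.smul_apply,
    elemBivector_apply, map_sum, map_smul, map_sub, smul_eq_mul]
  exact sum_congr rfl fun i _ => sum_congr rfl fun j _ => by ring

set_option maxSynthPendingDepth 3 in
theorem contDiff_ratBivector (c : Fin (n + 1) → ℝ) : ContDiff ℝ ∞ (ratBivector c) := by
  unfold ratBivector
  exact ContDiff.sum fun i _ => ContDiff.sum fun j _ =>
    (contDiff_bracketCoeff c i j).smul contDiff_const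

set_option maxSynthPendingDepth 3 in
theorem fderiv_ratBivector_apply (c : Fin (n + 1) → ℝ) (a v : RatCoeff n)
    (α β : RatCoeff n →L[ℝ] ℝ) :
    α (fderiv ℝ (ratBivector c) a v β) = ∑ i, ∑ j, bracketDeriv c a v i j *
      (α (denDir i) * β (numDir j) - α (numDir j) * β (denDir i)) := by
  have h : HasFDerivAt (ratBivector c) (∑ i, ∑ j,
      (fderiv ℝ (fun b => bracketCoeff c b i j) a).smulRight (elemBivector i j)) a := by
    unfold ratBivector
    refine HasFDerivAt.fun_sum fun i _ => HasFDerivAt.fun_sum fun j _ => ?_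
    exact ((contDiff_bracketCoeff c i j).differentiable (by simp)).differentiableAt.hasFDerivAt.smul_const _
  rw [h.fderiv]
  simp only [_root_.sum_apply, ContinuousLinearMap.smulRight_apply,
    _root_.smul_apply, elemBivector_apply, map_sum, map_smul, map_sub, smul_eq_mul,
    bracketDeriv]
  exact sum_congr rfl fun i _ => sum_congr rfl fun j _ => by ring

/-- A Hamiltonian direction is a combination of columns, which vary p, and rows, which vary q; these
are the directions for which the two symmetries are known. -/
theorem bracketDeriv_ratBivector (c : Fin (n + 1) → ℝ) (a : RatCoeff n) (α : RatCoeff n →L[ℝ] ℝ)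
    (i : Fin (n + 1)) (j : Fin n) :
    bracketDeriv c a (ratBivector c a α) i j =
      (∑ l, α (numDir l) * bracketDeriv c a (fun i => bracketCoeff c a i l, 0) i j) -
        ∑ k, α (denDir k) * bracketDeriv c a (0, bracketCoeff c a k) i j := by
  have h : ratBivector c a α =
      (∑ l, α (numDir l) • ((fun i => bracketCoeff c a i l, 0) : RatCoeff n)) -
        ∑ k, α (denDir k) • ((0, bracketCoeff c a k) : RatCoeff n) := by
    have e1 : ∀ l, ((fun i => bracketCoeff c a i l, 0) : RatCoeff n) =
        ∑ i, bracketCoeff c a i l • denDir i := by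
      intro l
      ext j <;> simp [denDir, Prod.fst_sum, Prod.snd_sum, Finset.sum_apply, Pi.single_apply]
    have e2 : ∀ k, ((0, bracketCoeff c a k) : RatCoeff n) =
        ∑ l, bracketCoeff c a k l • numDir l := by
      intro l
      ext j <;> simp [numDir, Prod.fst_sum, Prod.snd_sum, Finset.sum_apply, Pi.single_apply]
    simp only [e1, e2, ratBivector, _root_.sum_apply, _root_.smul_apply,
      elemBivector_apply, smul_sub, sum_sub_distrib, smul_sum, smul_smul]
    congr 1
    · rw [sum_comm]
      exact sum_congr rfl fun i _ => sum_congr rfl fun j _ => by rw [mul_comm]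
    · exact sum_congr rfl fun i _ => sum_congr rfl fun j _ => by rw [mul_comm]
  rw [h]
  simp only [bracketDeriv, map_sub, map_sum, map_smul, smul_eq_mul]

/-- Each cyclic term splits into two sums of type (p, q, q) and two of type (p, p, q). The column
and row symmetries identify the twelve sums in pairs of opposite sign. -/
theorem ratBivector_jacobi (c : Fin (n + 1) → ℝ) (a : RatCoeff n) (α β γ : RatCoeff n →L[ℝ] ℝ) :
    β (fderiv ℝ (ratBivector c) a (ratBivector c a α) γ) +
      γ (fderiv ℝ (ratBivector c) a (ratBivector c a β) α) +
      α (fderiv ℝ (ratBivector c) a (ratBivector c a γ) β) = 0 := by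
  set X : Fin (n + 1) → Fin n → Fin n → ℝ := fun i j l =>
    bracketDeriv c a (fun i => bracketCoeff c a i l, 0) i j with hX
  set Y : Fin (n + 1) → Fin (n + 1) → Fin n → ℝ := fun k i j =>
    bracketDeriv c a (0, bracketCoeff c a k) i j with hY
  set SX : (Fin (n + 1) → ℝ) → (Fin n → ℝ) → (Fin n → ℝ) → ℝ := fun b u w =>
    ∑ i, ∑ j, ∑ l, b i * u j * w l * X i j l with hSX
  set SY : (Fin (n + 1) → ℝ) → (Fin (n + 1) → ℝ) → (Fin n → ℝ) → ℝ := fun b u w =>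
    ∑ i, ∑ j, ∑ k, b k * u i * w j * Y k i j with hSY
  have sX : ∀ b u w, SX b u w = SX b w u := by
    intro b u w
    simp only [hSX]
    refine sum_congr rfl fun i _ => ?_
    rw [sum_comm]
    refine sum_congr rfl fun j _ => sum_congr rfl fun l _ => ?_
    rw [show X i l j = X i j l from bracketDeriv_col_comm c a i j l]
    ring
  have sY : ∀ b u w, SY b u w = SY u b w := by
    intro b u w
    simp only [hSY]
    rw [sum_congr rfl fun i _ => sum_comm, sum_comm, sum_congr rfl fun i _ => sum_comm]
    conv_rhs => rw [sum_congr rfl fun i _ => sum_comm]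
    rw [sum_congr rfl fun i _ => sum_comm]
    refine sum_congr rfl fun i _ => sum_congr rfl fun j _ => sum_congr rfl fun l _ => ?_
    rw [show Y i j l = Y j i l from bracketDeriv_row_comm c a i j l]
    ring
  have key : ∀ α β γ : RatCoeff n →L[ℝ] ℝ,
      β (fderiv ℝ (ratBivector c) a (ratBivector c a α) γ) =
        SX (fun i => β (denDir i)) (fun j => γ (numDir j)) (fun l => α (numDir l)) -
        SX (fun i => γ (denDir i)) (fun j => β (numDir j)) (fun l => α (numDir l)) -
        SY (fun i => α (denDir i)) (fun j => β (denDir j)) (fun l => γ (numDir l)) +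
        SY (fun i => α (denDir i)) (fun j => γ (denDir j)) (fun l => β (numDir l)) := by
    intro α β γ
    rw [fderiv_ratBivector_apply]
    simp only [bracketDeriv_ratBivector, hSX, hSY]
    simp only [← sum_sub_distrib, ← sum_add_distrib]
    refine sum_congr rfl fun i _ => sum_congr rfl fun j _ => ?_
    rw [sub_add, ← sum_sub_distrib, sub_mul, sum_mul, sum_mul]
    congr 1
    · refine sum_congr rfl fun l _ => ?_
      simp only [hX]
      ring
    · refine sum_congr rfl fun l _ => ?_
      simp only [hY]
      ring
  rw [key α β γ, key β γ α, key γ α β,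
    sX (fun i => β (denDir i)) (fun j => γ (numDir j)),
    sX (fun i => γ (denDir i)) (fun j => β (numDir j)),
    sX (fun i => α (denDir i)) (fun j => γ (numDir j)),
    sY (fun i => α (denDir i)) (fun j => β (denDir j)),
    sY (fun i => α (denDir i)) (fun j => γ (denDir j)),
    sY (fun i => β (denDir i)) (fun j => γ (denDir j))]
  ring

/-- The bracket with multiplier `∑ k, c_k z ^ k` on rational functions. -/
noncomputable def ratBracket (c : Fin (n + 1) → ℝ) :
    (RatCoeff n → ℝ) → (RatCoeff n → ℝ) → RatCoeff n → ℝ :=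
  bivectorBracket (ratBivector c)

theorem isPoissonBracketOn_ratBracket (c : Fin (n + 1) → ℝ) :
    IsPoissonBracketOn univ (ratBracket c) := by
  refine isPoissonBracketOn_bivectorBracket (contDiff_ratBivector c) (fun a α β => ?_)
    (ratBivector_jacobi c)
  rw [ratBivector_apply, ratBivector_apply, ← sum_neg_distrib]
  refine sum_congr rfl fun i _ => ?_
  rw [← sum_neg_distrib]
  exact sum_congr rfl fun j _ => by ring

theorem ratRem_eq_sum (c : Fin (n + 1) → ℝ) (a : RatCoeff n) :
    ratRem c a = ∑ k, c k • ratRem (Pi.single k 1) a := by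
  simp only [ratRem, companionPoly, Pi.single_apply, ite_smul, one_smul, zero_smul,
    Finset.sum_ite_eq', Finset.mem_univ, if_true, sum_mulVec, smul_mulVec]

/-- The remainder of f q is linear in f, hence so is the bracket: a linear combination of the
brackets is the bracket of another multiplier, and compatibility needs no further computation. -/
theorem ratBracket_eq_sum (c : Fin (n + 1) → ℝ) :
    ratBracket c = fun f g a => ∑ k, c k * ratBracket (Pi.single k 1) f g a := by
  have h : ∀ a i j, bracketCoeff c a i j = ∑ k, c k * bracketCoeff (Pi.single k 1) a i j := by
    intro a i j
    simp only [bracketCoeff]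
    rw [ratRem_eq_sum]
    simp only [mulVec_sum, mulVec_smul, Finset.sum_apply, Pi.smul_apply, smul_eq_mul, mul_sub,
      sum_sub_distrib, sum_mul, mul_assoc]
  funext f g a
  simp only [ratBracket, bivectorBracket, ratBivector_apply, h, sum_mul, mul_sum]
  rw [sum_congr rfl fun i _ => sum_comm, sum_comm]
  exact sum_congr rfl fun i _ => sum_congr rfl fun j _ => sum_congr rfl fun l _ => by ring

theorem compatiblePoissonOn_ratBracket :
    CompatiblePoissonOn univ fun k : Fin (n + 1) => ratBracket (n := n) (Pi.single k 1) :=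
  ⟨fun _ => isPoissonBracketOn_ratBracket _, fun c => by
    rw [← ratBracket_eq_sum c]
    exact isPoissonBracketOn_ratBracket c⟩

end RatBracket

/-! ### The bracket of Weyl functions -/

section RatBracketFormula

open Finset Matrix

variable {n : ℕ}

theorem eval_ratDen (a : RatCoeff n) (z : ℝ) : (ratDen a).eval z = evalMonic a.1 z := by
  simp [ratDen, evalMonic, evalVec, Polynomial.eval_finsetSum]

theorem eval_ratNum (a : RatCoeff n) (z : ℝ) : (ratNum a).eval z = evalMonic a.2 z := by
  simp [ratNum, evalMonic, evalVec, Polynomial.eval_finsetSum]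

theorem degree_sum_C_mul_X_pow_lt {N : ℕ} (r : Fin N → ℝ) :
    (∑ j : Fin N, Polynomial.C (r j) * Polynomial.X ^ (j : ℕ)).degree < (N : WithBot ℕ) := by
  rw [Polynomial.degree_lt_iff_coeff_zero]
  intro m hm
  rw [Polynomial.finsetSum_coeff]
  refine sum_eq_zero fun i _ => ?_
  rw [Polynomial.coeff_C_mul_X_pow, if_neg (by omega)]

theorem monic_ratDen (a : RatCoeff n) : (ratDen a).Monic := by
  refine Polynomial.monic_X_pow_add ?_
  exact_mod_cast degree_sum_C_mul_X_pow_lt a.1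

theorem degree_ratDen (a : RatCoeff n) : (ratDen a).degree = ((n + 1 : ℕ) : WithBot ℕ) := by
  rw [ratDen, Polynomial.degree_add_eq_left_of_degree_lt, Polynomial.degree_X_pow]
  rw [Polynomial.degree_X_pow]
  exact degree_sum_C_mul_X_pow_lt a.1

/-- Applying C performs one division step; the quotient `s` collects the leading coefficients
removed on the way. -/
theorem exists_X_pow_mul_ratNum (a : RatCoeff n) (k : ℕ) : ∃ s : Polynomial ℝ,
    (∑ j : Fin (n + 1), Polynomial.C ((companion a.1 ^ k *ᵥ monicVec a.2) j) *
      Polynomial.X ^ (j : ℕ)) + ratDen a * s = Polynomial.X ^ k * ratNum a := by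
  have ev : ∀ (r : Fin (n + 1) → ℝ) z, (∑ j : Fin (n + 1), Polynomial.C (r j) *
      Polynomial.X ^ (j : ℕ)).eval z = evalVec r z := fun r z => by
    simp [evalVec, Polynomial.eval_finsetSum]
  induction k with
  | zero =>
    refine ⟨0, Polynomial.funext fun z => ?_⟩
    simp only [Polynomial.eval_add, ev, Polynomial.eval_mul, eval_ratNum]
    simp [evalVec_monicVec]
  | succ k ih =>
    obtain ⟨s, hs⟩ := ih
    refine ⟨Polynomial.X * s +
      Polynomial.C ((companion a.1 ^ k *ᵥ monicVec a.2) (Fin.last n)), Polynomial.funext fun z => ?_⟩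
    have h := congrArg (Polynomial.eval z) hs
    simp only [Polynomial.eval_add, ev, Polynomial.eval_mul, eval_ratNum, Polynomial.eval_pow,
      Polynomial.eval_X, Polynomial.eval_C] at h ⊢
    rw [pow_succ', ← mulVec_mulVec, evalVec_companion_mulVec, eval_ratDen]
    rw [eval_ratDen] at h
    rw [pow_succ', mul_assoc, ← h]
    ring

theorem ratRem_single (k : Fin (n + 1)) (a : RatCoeff n) :
    ratRem (Pi.single k 1) a = companion a.1 ^ (k : ℕ) *ᵥ monicVec a.2 := by
  simp [ratRem, companionPoly, Pi.single_apply]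

theorem ratNegPart_eq (k : Fin (n + 1)) (z : ℝ) (a : RatCoeff n) :
    ratNegPart k z a = evalVec (ratRem (Pi.single k 1) a) z / evalMonic a.1 z := by
  obtain ⟨s, hs⟩ := exists_X_pow_mul_ratNum a k
  have h := (Polynomial.div_modByMonic_unique s _ (monic_ratDen a)
    ⟨hs, by rw [degree_ratDen]; exact degree_sum_C_mul_X_pow_lt _⟩).2
  rw [ratNegPart, h, eval_ratDen, ratRem_single]
  simp [evalVec, Polynomial.eval_finsetSum]

theorem ratEval_eq (z : ℝ) (a : RatCoeff n) :
    ratEval z a = evalMonic a.2 z / evalMonic a.1 z := by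
  rw [ratEval, eval_ratDen, eval_ratNum]

theorem contDiff_evalMonic_fst (z : ℝ) : ContDiff ℝ ∞ fun a : RatCoeff n => evalMonic a.1 z :=
  contDiff_const.add (ContDiff.sum fun i _ => (contDiff_fst_apply i).mul contDiff_const)

theorem contDiff_evalMonic_snd (z : ℝ) : ContDiff ℝ ∞ fun a : RatCoeff n => evalMonic a.2 z :=
  contDiff_const.add (ContDiff.sum fun i _ => (contDiff_snd_apply i).mul contDiff_const)

theorem fderiv_ratEval {z : ℝ} {a : RatCoeff n} (hz : evalMonic a.1 z ≠ 0) (v : RatCoeff n) :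
    fderiv ℝ (ratEval z) a v =
      (evalVec v.2 z * evalMonic a.1 z - evalMonic a.2 z * evalVec v.1 z) / evalMonic a.1 z ^ 2 := by
  have e : (ratEval z : RatCoeff n → ℝ) = fun a => evalMonic a.2 z / evalMonic a.1 z :=
    funext (ratEval_eq z)
  have hd : DifferentiableAt ℝ (ratEval z) a := by
    rw [e]
    exact ((contDiff_evalMonic_snd z).contDiffAt.div (contDiff_evalMonic_fst z).contDiffAt
      hz).differentiableAt (by simp)
  have h1 := hasDerivAt_comp_add_smul hd v
  have hp : HasDerivAt (fun t : ℝ => evalMonic (a + t • v).1 z) (evalVec v.1 z) 0 :=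
    (hasDerivAt_evalVec (hasDerivAt_add_smul a.1 v.1 0) z).const_add _
  have hq : HasDerivAt (fun t : ℝ => evalMonic (a + t • v).2 z) (evalVec v.2 z) 0 :=
    (hasDerivAt_evalVec (hasDerivAt_add_smul a.2 v.2 0) z).const_add _
  have h2 := hq.div hp (by simpa using hz)
  rw [e] at h1 ⊢
  have := h1.unique h2
  simpa using this

theorem evalVec_single {N : ℕ} (i : Fin N) (z : ℝ) : evalVec (Pi.single i 1) z = z ^ (i : ℕ) := by
  simp [evalVec, Pi.single_apply]

/-- Only the mixed terms {p, q} contribute. They are the generating function at (z, w) and at (w,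
z), and the closed form of each reduces the claim to algebra. -/
theorem ratBracket_ratEval (c : Fin (n + 1) → ℝ) {a : RatCoeff n} {z w : ℝ} (hzw : z ≠ w)
    (hz : evalMonic a.1 z ≠ 0) (hw : evalMonic a.1 w ≠ 0) :
    ratBracket c (ratEval z) (ratEval w) a =
      (evalVec (ratRem c a) z / evalMonic a.1 z - evalVec (ratRem c a) w / evalMonic a.1 w) *
        ((ratEval z a - ratEval w a) / (z - w) + ratEval z a * ratEval w a) := by
  have h0 : ∀ {N : ℕ} (w : ℝ), evalVec (0 : Fin N → ℝ) w = 0 := fun w => by simp [evalVec]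
  have e : ratBracket c (ratEval z) (ratEval w) a =
      -(evalMonic a.2 z / (evalMonic a.1 z ^ 2 * evalMonic a.1 w)) *
        evalMat (bracketCoeff c a) z w +
      (evalMonic a.2 w / (evalMonic a.1 w ^ 2 * evalMonic a.1 z)) *
        evalMat (bracketCoeff c a) w z := by
    rw [ratBracket, bivectorBracket, ratBivector_apply]
    simp only [fderiv_ratEval hz, fderiv_ratEval hw, denDir, numDir, h0, evalVec_single]
    simp only [evalMat, evalVec, mul_sum, ← sum_add_distrib]
    refine sum_congr rfl fun i _ => sum_congr rfl fun j _ => ?_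
    field_simp
    ring
  have h1 := sub_mul_evalMat_bracketCoeff c a z w
  have h2 := sub_mul_evalMat_bracketCoeff c a w z
  have ezw := sub_ne_zero.mpr hzw
  have ewz := sub_ne_zero.mpr hzw.symm
  rw [mul_comm, ← eq_div_iff ezw] at h1
  rw [mul_comm, ← eq_div_iff ewz] at h2
  rw [e, h1, h2, ratEval_eq, ratEval_eq]
  field_simp
  ring

theorem satisfiesRatBracket_ratBracket (k : Fin (n + 1)) :
    SatisfiesRatBracket (k : ℕ) (ratBracket (n := n) (Pi.single k 1)) := by
  intro a z w hzw hz hw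
  rw [eval_ratDen] at hz hw
  rw [ratBracket_ratEval _ hzw hz hw, ratNegPart_eq, ratNegPart_eq]

end RatBracketFormula

/-! ### Lower triangular conjugation and the Lax flows -/

section LaxFlow

open Matrix

variable {n : ℕ}

/-- Lower triangular matrices. -/
def IsLower (b : TodaMat n) : Prop := ∀ p q, p < q → b p q = 0

/-- Upper Hessenberg matrices with ones on the subdiagonal. -/
def IsHessenberg (X : TodaMat n) : Prop := X = subdiagJ n + upperPart X

theorem IsLower.mul {b c : TodaMat n} (hb : IsLower b) (hc : IsLower c) : IsLower (b * c) := by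
  intro p q hpq
  rw [Matrix.mul_apply]
  refine Finset.sum_eq_zero fun r _ => ?_
  rcases lt_or_ge p r with h | h
  · rw [hb p r h, zero_mul]
  · rw [hc r q (h.trans_lt hpq), mul_zero]

theorem IsLower.one : IsLower (1 : TodaMat n) := fun _ _ h => Matrix.one_apply_ne h.ne

theorem IsLower.lowerPart (A : TodaMat n) : IsLower (lowerPart A) := fun p q h => by
  simp [_root_.lowerPart, not_le.mpr h]

theorem isLower_iff (b : TodaMat n) : IsLower b ↔ b.BlockTriangular OrderDual.toDual :=
  ⟨fun h _ _ hij => h _ _ hij, fun h _ _ hij => h hij⟩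

theorem IsLower.inv {b : TodaMat n} (hb : IsLower b) (hu : IsUnit b.det) : IsLower b⁻¹ := by
  rw [isLower_iff] at *
  have := b.invertibleOfIsUnitDet hu
  exact blockTriangular_inv_of_blockTriangular hb

theorem IsLower.det {b : TodaMat n} (hb : IsLower b) : b.det = ∏ i, b i i :=
  Matrix.det_of_isLowerTriangular b ((isLower_iff b).mp hb)

theorem IsLower.diag_ne_zero {b : TodaMat n} (hb : IsLower b) (hu : IsUnit b.det)
    (i : Fin (n + 1)) : b i i ≠ 0 := by
  rw [hb.det, isUnit_iff_ne_zero, Finset.prod_ne_zero_iff] at hu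
  exact hu i (Finset.mem_univ i)

theorem upperPart_add (A B : TodaMat n) : upperPart (A + B) = upperPart A + upperPart B := by
  ext i j
  simp only [upperPart, Matrix.of_apply, Matrix.add_apply]
  split_ifs <;> simp

/-- Strictly lower triangular matrices are stable under multiplication by lower triangular ones on
either side, so the strictly lower part of A has no influence. -/
theorem upperPart_conj {b c : TodaMat n} (hb : IsLower b) (hc : IsLower c) (A : TodaMat n) :
    upperPart (b * A * c) = upperPart (b * upperPart A * c) := by
  ext p q
  simp only [upperPart, Matrix.of_apply]
  split_ifs with hpq
  · simp only [Matrix.mul_apply, Finset.sum_mul, Matrix.of_apply]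
    refine Finset.sum_congr rfl fun s _ => Finset.sum_congr rfl fun r _ => ?_
    split_ifs with hrs
    · rfl
    · rcases lt_or_ge p r with h | h
      · simp [hb p r h]
      · rw [hc s q ((not_le.mp hrs).trans_le (h.trans hpq))]
        simp
  · rfl

theorem upperPart_subdiagJ : upperPart (subdiagJ n) = 0 := by
  ext p q
  simp only [upperPart, subdiagJ, Matrix.of_apply, Matrix.zero_apply]
  split_ifs with h h' <;> first | rfl | (exfalso; rw [Fin.le_def] at h; omega)

theorem IsHessenberg.of_mem_coadOrbit {A X : TodaMat n} (h : X ∈ coadOrbit A) :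
    IsHessenberg X := by
  obtain ⟨b, _, _, rfl⟩ := h
  rw [IsHessenberg, upperPart_add, upperPart_subdiagJ, zero_add]
  congr 1
  ext p q
  simp only [upperPart, Matrix.of_apply]
  split_ifs <;> rfl

theorem IsHessenberg.apply_of_gt {X : TodaMat n} (h : IsHessenberg X) {p q : Fin (n + 1)}
    (hpq : (q : ℕ) + 1 < p) : X p q = 0 := by
  rw [h]
  simp only [subdiagJ, upperPart, Matrix.add_apply, Matrix.of_apply, Fin.le_def]
  rw [if_neg (by omega), if_neg (by omega), add_zero]

theorem IsHessenberg.apply_succ {X : TodaMat n} (h : IsHessenberg X) {p q : Fin (n + 1)}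
    (hpq : (p : ℕ) = q + 1) : X p q = 1 := by
  rw [h]
  simp only [subdiagJ, upperPart, Matrix.add_apply, Matrix.of_apply, Fin.le_def]
  rw [if_pos hpq, if_neg (by omega), add_zero]

/-- Conjugation by lower triangular matrices moves within the coadjoint orbit as long as the
result is of Hessenberg form. -/
theorem mem_coadOrbit_conj {A X b c : TodaMat n} (h : X ∈ coadOrbit A) (hb : IsLower b)
    (hc : IsLower c) (hcb : c * b = 1) (hY : IsHessenberg (b * X * c)) :
    b * X * c ∈ coadOrbit A := by
  obtain ⟨d, hd, hdu, rfl⟩ := h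
  have hbc : b * c = 1 := mul_eq_one_comm.mp hcb
  have hub : IsUnit b.det := (Matrix.isUnit_iff_isUnit_det b).mp (IsUnit.of_mul_eq_one c hbc)
  have hci : c = b⁻¹ := (Matrix.inv_eq_right_inv hbc).symm
  refine ⟨b * d, hb.mul hd, by rw [Matrix.det_mul]; exact hub.mul hdu, ?_⟩
  rw [hY]
  congr 1
  -- J is strictly lower triangular and contributes nothing; the old conjugating matrix is simply
  -- multiplied by b.
  have h1 : upperPart (b * subdiagJ n * c) = 0 := by
    rw [upperPart_conj hb hc, upperPart_subdiagJ, mul_zero, zero_mul]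
    ext; simp [upperPart]
  rw [mul_add, add_mul, upperPart_add, h1, zero_add, ← upperPart_conj hb hc, Matrix.mul_inv_rev,
    hci]
  congr 1
  simp only [mul_assoc]

/-- Since X commutes with X^m, the lower part may be traded for the strictly upper part of X^m with
the opposite sign. A strictly upper triangular matrix times a Hessenberg one is upper triangular. -/
theorem laxField_apply_of_gt (m : ℕ) {X : TodaMat n} (hX : IsHessenberg X) {p q : Fin (n + 1)}
    (hpq : q < p) : laxField m X p q = 0 := by
  have e : laxField m X = (X ^ m - lowerPart (X ^ m)) * X - X * (X ^ m - lowerPart (X ^ m)) := by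
    rw [laxField, sub_mul, mul_sub, ← pow_succ, ← pow_succ']
    abel
  have hU : ∀ r s, s ≤ r → (X ^ m - lowerPart (X ^ m)) r s = 0 := by
    intro r s hrs
    simp [lowerPart, hrs]
  rw [e, Matrix.sub_apply, Matrix.mul_apply, Matrix.mul_apply, Finset.sum_eq_zero,
    Finset.sum_eq_zero, sub_zero]
  · intro r _
    rcases le_or_gt q r with h | h
    · rw [hU r q h, mul_zero]
    · rw [hX.apply_of_gt (by rw [Fin.lt_def] at *; omega), zero_mul]
  · intro r _
    rcases le_or_gt r p with h | h
    · rw [hU p r h, zero_mul]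
    · rw [hX.apply_of_gt (by rw [Fin.lt_def] at *; omega), mul_zero]

/-! ### Smoothness of the triangular parts and of the Lax vector fields. -/

section Smooth

variable {E : Type*} [NormedAddCommGroup E] [NormedSpace ℝ E]

theorem contDiff_matrix {F : E → TodaMat n} :
    ContDiff ℝ ∞ F ↔ ∀ i j, ContDiff ℝ ∞ fun x => F x i j :=
  contDiff_pi.trans (forall_congr' fun _ => contDiff_pi)

theorem ContDiff.todaMat_mul {F G : E → TodaMat n} (hF : ContDiff ℝ ∞ F) (hG : ContDiff ℝ ∞ G) :
    ContDiff ℝ ∞ fun x => F x * G x :=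
  contDiff_matrix.mpr (contDiff_matrix_mul (contDiff_matrix.mp hF) (contDiff_matrix.mp hG))

theorem ContDiff.todaMat_pow {F : E → TodaMat n} (hF : ContDiff ℝ ∞ F) (k : ℕ) :
    ContDiff ℝ ∞ fun x => F x ^ k :=
  contDiff_matrix.mpr (contDiff_matrix_pow (contDiff_matrix.mp hF) k)

theorem ContDiff.lowerPart {F : E → TodaMat n} (hF : ContDiff ℝ ∞ F) :
    ContDiff ℝ ∞ fun x => lowerPart (F x) := by
  refine contDiff_matrix.mpr fun i j => ?_
  simp only [_root_.lowerPart, Matrix.of_apply]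
  split_ifs
  · exact contDiff_matrix.mp hF i j
  · exact contDiff_const

theorem ContDiff.upperPart {F : E → TodaMat n} (hF : ContDiff ℝ ∞ F) :
    ContDiff ℝ ∞ fun x => upperPart (F x) := by
  refine contDiff_matrix.mpr fun i j => ?_
  simp only [_root_.upperPart, Matrix.of_apply]
  split_ifs
  · exact contDiff_matrix.mp hF i j
  · exact contDiff_const

theorem ContDiff.laxField {F : E → TodaMat n} (hF : ContDiff ℝ ∞ F) (m : ℕ) :
    ContDiff ℝ ∞ fun x => laxField m (F x) :=
  (hF.todaMat_mul (hF.todaMat_pow m).lowerPart).sub ((hF.todaMat_pow m).lowerPart.todaMat_mul hF)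

end Smooth

theorem hasDerivAt_const_on_Ioo {f : ℝ → ℝ} {x y : ℝ} (h : ∀ s ∈ Ioo x y, HasDerivAt f 0 s)
    {s t : ℝ} (hs : s ∈ Ioo x y) (ht : t ∈ Ioo x y) : f s = f t :=
  isOpen_Ioo.is_const_of_deriv_eq_zero isPreconnected_Ioo
    (fun u hu => (h u hu).differentiableAt.differentiableWithinAt) (fun u hu => (h u hu).deriv)
    hs ht

/-- Local uniqueness for autonomous smooth equations. -/
theorem eventuallyEq_of_hasDerivAt {E : Type*} [NormedAddCommGroup E] [NormedSpace ℝ E]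
    {v : E → E} (hv : ContDiff ℝ ∞ v) {f g : ℝ → E} {t : ℝ}
    (hf : ∀ᶠ s in 𝓝 t, HasDerivAt f (v (f s)) s) (hg : ∀ᶠ s in 𝓝 t, HasDerivAt g (v (g s)) s)
    (h : f t = g t) : f =ᶠ[𝓝 t] g := by
  obtain ⟨K, s, hs, hK⟩ := (hv.contDiffAt (x := f t)).of_le
    (show (1 : WithTop ℕ∞) ≤ ∞ from WithTop.coe_le_coe.mpr le_top) |>.exists_lipschitzOnWith
  refine ODE_solution_unique_of_eventually (v := fun _ => v) (s := fun _ => s) (K := K)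
    (Eventually.of_forall fun _ => hK) (hf.and ?_) (hg.and ?_) h
  · exact hf.self_of_nhds.continuousAt.eventually_mem hs
  · exact hg.self_of_nhds.continuousAt.eventually_mem (h ▸ hs)

theorem exists_hasDerivAt_of_contDiff {E : Type*} [NormedAddCommGroup E] [NormedSpace ℝ E]
    [CompleteSpace E] {v : E → E} (hv : ContDiff ℝ ∞ v) (x : E) (t : ℝ) :
    ∃ α : ℝ → E, α t = x ∧ ∃ ε > (0 : ℝ), ∀ s ∈ Ioo (t - ε) (t + ε), HasDerivAt α (v (α s)) s :=
  ContDiffAt.exists_forall_mem_closedBall_exists_eq_forall_mem_Ioo_hasDerivAt₀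
    (hv.contDiffAt.of_le (show (1 : WithTop ℕ∞) ≤ ∞ from WithTop.coe_le_coe.mpr le_top)) t

/-- A solution of a Lax equation is obtained locally by lower triangular conjugation. -/
theorem exists_lax_conj (m : ℕ) (X : TodaMat n) (t : ℝ) :
    ∃ b c : ℝ → TodaMat n, b t = 1 ∧ c t = 1 ∧ ∃ ε > (0 : ℝ), ∀ s ∈ Ioo (t - ε) (t + ε),
      IsLower (b s) ∧ IsLower (c s) ∧ c s * b s = 1 ∧
      HasDerivAt (fun s => b s * X * c s) (laxField m (b s * X * c s)) s := by
  set L : TodaMat n × TodaMat n → TodaMat n := fun y => lowerPart ((y.1 * X * y.2) ^ m) with hL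
  have hLs : ContDiff ℝ ∞ L :=
    (((contDiff_fst.todaMat_mul contDiff_const).todaMat_mul contDiff_snd).todaMat_pow m).lowerPart
  -- The equations b' = -L b and c' = c L are integrated together, with c in place of b⁻¹. The
  -- projections `lowerPart` make the entries above the diagonal constant; once the factors are
  -- known to be lower triangular, the projections disappear.
  set v : TodaMat n × TodaMat n → TodaMat n × TodaMat n := fun y =>
    (-(L y * lowerPart y.1), lowerPart y.2 * L y) with hv
  have hvs : ContDiff ℝ ∞ v := by
    refine ContDiff.prodMk (hLs.todaMat_mul contDiff_fst.lowerPart).neg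
      (contDiff_snd.lowerPart.todaMat_mul hLs)
  have : CompleteSpace (TodaMat n) := FiniteDimensional.complete ℝ (TodaMat n)
  obtain ⟨α, h0, ε, hε, hα⟩ := exists_hasDerivAt_of_contDiff hvs (1, 1) t
  have ht : t ∈ Ioo (t - ε) (t + ε) := ⟨by linarith, by linarith⟩
  have hb : ∀ s ∈ Ioo (t - ε) (t + ε), HasDerivAt (fun s => (α s).1)
      (-(L (α s) * lowerPart (α s).1)) s := fun s hs => (hα s hs).fst
  have hc : ∀ s ∈ Ioo (t - ε) (t + ε), HasDerivAt (fun s => (α s).2)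
      (lowerPart (α s).2 * L (α s)) s := fun s hs => (hα s hs).snd
  have hbl : ∀ s ∈ Ioo (t - ε) (t + ε), IsLower (α s).1 := by
    intro s hs p q hpq
    have : ∀ s ∈ Ioo (t - ε) (t + ε), HasDerivAt (fun s => (α s).1 p q) 0 s := by
      intro s hs
      refine (hasDerivAt_matrix.mp (hb s hs) p q).congr_deriv ?_
      rw [Matrix.neg_apply, (IsLower.lowerPart _).mul (IsLower.lowerPart _) p q hpq, neg_zero]
    rw [hasDerivAt_const_on_Ioo this hs ht, h0]
    exact IsLower.one p q hpq
  have hcl : ∀ s ∈ Ioo (t - ε) (t + ε), IsLower (α s).2 := by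
    intro s hs p q hpq
    have : ∀ s ∈ Ioo (t - ε) (t + ε), HasDerivAt (fun s => (α s).2 p q) 0 s := by
      intro s hs
      refine (hasDerivAt_matrix.mp (hc s hs) p q).congr_deriv ?_
      rw [(IsLower.lowerPart _).mul (IsLower.lowerPart _) p q hpq]
    rw [hasDerivAt_const_on_Ioo this hs ht, h0]
    exact IsLower.one p q hpq
  have hlow : ∀ A : TodaMat n, IsLower A → lowerPart A = A := by
    intro A hA
    ext p q
    simp only [lowerPart, Matrix.of_apply]
    split_ifs with h
    · rfl
    · rw [hA p q (not_le.mp h)]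
  have hb' : ∀ s ∈ Ioo (t - ε) (t + ε), HasDerivAt (fun s => (α s).1)
      (-(L (α s) * (α s).1)) s := fun s hs => by
    have := hb s hs
    rwa [hlow _ (hbl s hs)] at this
  have hc' : ∀ s ∈ Ioo (t - ε) (t + ε), HasDerivAt (fun s => (α s).2)
      ((α s).2 * L (α s)) s := fun s hs => by
    have := hc s hs
    rwa [hlow _ (hcl s hs)] at this
  refine ⟨fun s => (α s).1, fun s => (α s).2, by simp only [h0], by simp only [h0], ε, hε,
    fun s hs => ⟨hbl s hs, hcl s hs, ?_, ?_⟩⟩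
  · ext p q
    have : ∀ s ∈ Ioo (t - ε) (t + ε), HasDerivAt (fun s => ((α s).2 * (α s).1) p q) 0 s := by
      intro s hs
      refine (hasDerivAt_matrix.mp ((hc' s hs).matrix_mul (hb' s hs)) p q).congr_deriv ?_
      rw [mul_neg, ← mul_assoc, add_neg_cancel, Matrix.zero_apply]
    rw [hasDerivAt_const_on_Ioo this hs ht, h0, one_mul]
  · have h1 := ((hb' s hs).matrix_mul (hasDerivAt_const s X)).matrix_mul (hc' s hs)
    refine h1.congr_deriv ?_
    simp only [laxField]
    rw [show lowerPart (((α s).1 * X * (α s).2) ^ m) = L (α s) from rfl]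
    noncomm_ring

/-- The Hessenberg form is locally preserved by the Lax flows. -/
theorem eventually_isHessenberg (m : ℕ) {γ : ℝ → TodaMat n} {t : ℝ}
    (hγ : ∀ᶠ s in 𝓝 t, HasDerivAt γ (laxField m (γ s)) s) (h : IsHessenberg (γ t)) :
    ∀ᶠ s in 𝓝 t, IsHessenberg (γ s) := by
  -- The field is first composed with the projection onto Hessenberg matrices. Its solution has
  -- constant subdiagonal part, so it also solves the Lax equation and coincides with γ by
  -- uniqueness.
  set v : TodaMat n → TodaMat n := fun X => laxField m (subdiagJ n + upperPart X) with hv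
  have hvs : ContDiff ℝ ∞ v := (contDiff_const.add contDiff_id.upperPart).laxField m
  have : CompleteSpace (TodaMat n) := FiniteDimensional.complete ℝ (TodaMat n)
  obtain ⟨α, h0, ε, hε, hα⟩ := exists_hasDerivAt_of_contDiff hvs (γ t) t
  have ht : t ∈ Ioo (t - ε) (t + ε) := ⟨by linarith, by linarith⟩
  have hH : ∀ X : TodaMat n, IsHessenberg (subdiagJ n + upperPart X) := by
    intro X
    rw [IsHessenberg, upperPart_add, upperPart_subdiagJ, zero_add]
    congr 1
    ext p q
    simp only [upperPart, Matrix.of_apply]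
    split_ifs <;> rfl
  have hαH : ∀ s ∈ Ioo (t - ε) (t + ε), IsHessenberg (α s) := by
    intro s hs
    have hlow : ∀ p q, q < p → α s p q = γ t p q := by
      intro p q hpq
      have : ∀ s ∈ Ioo (t - ε) (t + ε), HasDerivAt (fun s => α s p q) 0 s := by
        intro s hs
        refine (hasDerivAt_matrix.mp (hα s hs) p q).congr_deriv ?_
        exact laxField_apply_of_gt m (hH _) hpq
      rw [hasDerivAt_const_on_Ioo this hs ht, h0]
    ext p q
    rw [Matrix.add_apply]
    rcases le_or_gt p q with hpq | hpq
    · simp only [subdiagJ, upperPart, Matrix.of_apply, if_pos hpq]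
      rw [if_neg (by rw [Fin.le_def] at hpq; omega), zero_add]
    · rw [hlow p q hpq, h]
      simp only [upperPart, Matrix.add_apply, Matrix.of_apply, if_neg (not_le.mpr hpq)]
  have hα' : ∀ᶠ s in 𝓝 t, HasDerivAt α (laxField m (α s)) s := by
    filter_upwards [Ioo_mem_nhds ht.1 ht.2] with s hs
    have := hα s hs
    have e : subdiagJ n + upperPart (α s) = α s := (hαH s hs).symm
    simp only [hv, e] at this
    exact this
  have := eventuallyEq_of_hasDerivAt (contDiff_id.laxField m) hα' hγ h0
  filter_upwards [this, Ioo_mem_nhds ht.1 ht.2] with s h1 h2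
  rw [← h1]
  exact hαH s h2

/-- Near every time, a solution of a Lax equation is a lower triangular conjugate. -/
theorem eventually_lax_conj (m : ℕ) {γ : ℝ → TodaMat n} {t : ℝ}
    (hγ : ∀ᶠ s in 𝓝 t, HasDerivAt γ (laxField m (γ s)) s) :
    ∀ᶠ s in 𝓝 t, ∃ b c : TodaMat n, IsLower b ∧ IsLower c ∧ c * b = 1 ∧ γ s = b * γ t * c := by
  obtain ⟨b, c, hb, hc, ε, hε, h⟩ := exists_lax_conj m (γ t) t
  have ht : t ∈ Ioo (t - ε) (t + ε) := ⟨by linarith, by linarith⟩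
  have h1 : ∀ᶠ s in 𝓝 t, HasDerivAt (fun s => b s * γ t * c s)
      (laxField m (b s * γ t * c s)) s := by
    filter_upwards [Ioo_mem_nhds ht.1 ht.2] with s hs
    exact (h s hs).2.2.2
  have := eventuallyEq_of_hasDerivAt (contDiff_id.laxField m) hγ h1 (by rw [hb, hc, one_mul, mul_one])
  filter_upwards [this, Ioo_mem_nhds ht.1 ht.2] with s h2 hs
  exact ⟨b s, c s, (h s hs).1, (h s hs).2.1, (h s hs).2.2.1, h2⟩

theorem eventually_mem_coadOrbit_iff (m : ℕ) {γ : ℝ → TodaMat n} {t : ℝ} {T : Set ℝ}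
    (hT : IsOpen T) (hγ : IsLaxSolutionOn m T γ) (ht : t ∈ T) :
    ∀ᶠ s in 𝓝 t, s ∈ T → ∀ A : TodaMat n, γ t ∈ coadOrbit A → γ s ∈ coadOrbit A := by
  have hγ' : ∀ᶠ s in 𝓝 t, HasDerivAt γ (laxField m (γ s)) s := by
    filter_upwards [hT.mem_nhds ht] with s hs using hγ s hs
  by_cases hH : IsHessenberg (γ t)
  · filter_upwards [eventually_lax_conj m hγ', eventually_isHessenberg m hγ' hH] with s h1 h2 _ A hA
    obtain ⟨b, c, hb, hc, hcb, e⟩ := h1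
    rw [e] at h2 ⊢
    exact mem_coadOrbit_conj hA hb hc hcb h2
  · exact Eventually.of_forall fun s _ A hA => absurd (IsHessenberg.of_mem_coadOrbit hA) hH

theorem isHessenberg_closed {γ : ℝ → TodaMat n} {t : ℝ} (hc : ContinuousAt γ t)
    (h : ∃ᶠ s in 𝓝 t, IsHessenberg (γ s)) : IsHessenberg (γ t) := by
  have hcl : IsClosed {X : TodaMat n | IsHessenberg X} :=
    isClosed_eq continuous_id (contDiff_const.add contDiff_id.upperPart :
      ContDiff ℝ ∞ fun X : TodaMat n => subdiagJ n + upperPart X).continuous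
  exact hcl.mem_of_frequently_of_tendsto h hc

/-- An orbit need not be closed, so a limit argument alone does not suffice. Only the Hessenberg
form passes to the limit; membership is carried back from a nearby time by inverting the
conjugation. -/
theorem mem_coadOrbit_of_frequently (m : ℕ) {γ : ℝ → TodaMat n} {t : ℝ} {T : Set ℝ}
    (hT : IsOpen T) (hγ : IsLaxSolutionOn m T γ) (ht : t ∈ T) {M : Set (TodaMat n)}
    (hM : ∀ X ∈ M, ∃ A, X ∈ coadOrbit A ∧ coadOrbit A ⊆ M)
    (h : ∃ᶠ s in 𝓝 t, γ s ∈ M) : γ t ∈ M := by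
  have hγ' : ∀ᶠ s in 𝓝 t, HasDerivAt γ (laxField m (γ s)) s := by
    filter_upwards [hT.mem_nhds ht] with s hs using hγ s hs
  have hH : IsHessenberg (γ t) := by
    refine isHessenberg_closed (hγ t ht).continuousAt (h.mono fun s hs => ?_)
    obtain ⟨A, hA, _⟩ := hM _ hs
    exact IsHessenberg.of_mem_coadOrbit hA
  obtain ⟨s, hs, b, c, hb, hc, hcb, e⟩ := (h.and_eventually (eventually_lax_conj m hγ')).exists
  obtain ⟨A, hA, hAM⟩ := hM _ hs
  have hbc : b * c = 1 := mul_eq_one_comm.mp hcb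
  have e2 : γ t = c * γ s * b := by
    rw [e]
    calc γ t = (c * b) * γ t * (c * b) := by rw [hcb, one_mul, mul_one]
      _ = _ := by simp only [mul_assoc]
  rw [e2] at hH ⊢
  exact hAM (mem_coadOrbit_conj hA hc hb hbc hH)

theorem mem_todaOrbit_coadOrbit {r : ℕ} (i : Fin (r + 1) → Fin (n + 1)) (X : TodaMat n)
    (hX : X ∈ todaOrbit i) : ∃ A, X ∈ coadOrbit A ∧ coadOrbit A ⊆ todaOrbit i := by
  obtain ⟨ν, hν⟩ := mem_iUnion.mp hX
  exact ⟨_, hν, subset_iUnion (fun ν : ℝ => coadOrbit (indexMat i + ν • (1 : TodaMat n))) ν⟩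

theorem eventually_mem_todaOrbit (m : ℕ) {γ : ℝ → TodaMat n} {t : ℝ} {T : Set ℝ}
    (hT : IsOpen T) (hγ : IsLaxSolutionOn m T γ) (ht : t ∈ T) {r : ℕ}
    {i : Fin (r + 1) → Fin (n + 1)} (h : γ t ∈ todaOrbit i) :
    ∀ᶠ s in 𝓝 t, γ s ∈ todaOrbit i := by
  obtain ⟨A, hA, hAM⟩ := mem_todaOrbit_coadOrbit i _ h
  filter_upwards [eventually_mem_coadOrbit_iff m hT hγ ht, hT.mem_nhds ht] with s h1 h2
  exact hAM (h1 h2 A hA)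

/-- The times spent in the orbit and those spent outside are both open in T, so connectedness leaves
only one of them. -/
theorem laxRestrictsTo_todaOrbit (m : ℕ) {r : ℕ} (i : Fin (r + 1) → Fin (n + 1)) :
    LaxRestrictsTo m (todaOrbit i) := by
  refine ⟨fun X hX => ?_, fun T γ hT hTc hγ hex => ?_⟩
  · obtain ⟨b, c, hb, hc, ε, hε, h⟩ := exists_lax_conj m X 0
    refine ⟨ε, hε, fun s => b s * X * c s, by simp [hb, hc], fun s hs => (h s ?_).2.2.2⟩
    simpa using hs
  · obtain ⟨t₀, ht₀, hM⟩ := hex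
    by_contra! hcon
    obtain ⟨t₁, ht₁, hnM⟩ := hcon
    have hopen1 : IsOpen (T ∩ γ ⁻¹' todaOrbit i) := by
      rw [isOpen_iff_mem_nhds]
      rintro t ⟨ht, htM⟩
      filter_upwards [hT.mem_nhds ht, eventually_mem_todaOrbit m hT hγ ht htM] with s h1 h2
      exact ⟨h1, h2⟩
    have hopen2 : IsOpen (T ∩ (γ ⁻¹' todaOrbit i)ᶜ) := by
      rw [isOpen_iff_mem_nhds]
      rintro t ⟨ht, htM⟩
      have : ∀ᶠ s in 𝓝 t, γ s ∉ todaOrbit i := by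
        by_contra hfr
        exact htM (mem_coadOrbit_of_frequently m hT hγ ht (mem_todaOrbit_coadOrbit i)
          (not_eventually.mp hfr |>.mono fun s hs => not_not.mp hs))
      filter_upwards [hT.mem_nhds ht, this] with s h1 h2
      exact ⟨h1, h2⟩
    obtain ⟨s, hs, hs1, hs2⟩ := hTc _ _ hopen1 hopen2
      (fun s hs => by
        by_cases h : γ s ∈ todaOrbit i
        · exact Or.inl ⟨hs, h⟩
        · exact Or.inr ⟨hs, h⟩)
      ⟨t₀, ht₀, ht₀, hM⟩ ⟨t₁, ht₁, ht₁, hnM⟩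
    exact hs2.2 hs1.2

end LaxFlow

/-! ### Moments -/

section Moments

open Finset Matrix

variable {n : ℕ}

theorem monicCoeff_weylMap (X : TodaMat n) (l : ℕ) :
    monicCoeff (weylMap X).1 l = X.charpoly.coeff l := by
  have hd : X.charpoly.natDegree = n + 1 := by simp [Matrix.charpoly_natDegree_eq_dim]
  unfold monicCoeff
  split_ifs with h1 h2
  · rfl
  · have := (Matrix.charpoly_monic X).coeff_natDegree
    rw [hd] at this
    rw [h2, this]
  · rw [Polynomial.coeff_eq_zero_of_natDegree_lt]
    omega

/-- The Cayley–Hamilton theorem. -/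
theorem horner_weylMap_zero (X : TodaMat n) : horner (weylMap X).1 X 0 = 0 := by
  have h := Matrix.aeval_self_charpoly X
  rw [Polynomial.aeval_eq_sum_range, Matrix.charpoly_natDegree_eq_dim, Fintype.card_fin] at h
  simpa only [horner, monicCoeff_weylMap, zero_add] using h

theorem finite_evalMonic_eq_zero (a : RatCoeff n) : {z | evalMonic a.1 z = 0}.Finite := by
  have := Polynomial.finite_setOfPred_isRoot (monic_ratDen a).ne_zero
  simpa only [Polynomial.IsRoot, eval_ratDen] using this

/-- The resolvent in terms of the Horner polynomials. -/
theorem sum_horner_weylMap_zero_zero (X : TodaMat n) {z : ℝ} (hz : evalMonic (weylMap X).1 z ≠ 0) :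
    ∑ i : Fin (n + 1), z ^ (i : ℕ) * horner (weylMap X).1 X (i + 1) 0 0 =
      evalMonic (weylMap X).2 z := by
  have h := sub_mul_sum_horner (weylMap X).1 X z
  rw [horner_weylMap_zero, sub_zero] at h
  have h2 : (z • (1 : TodaMat n) - X) * ((evalMonic (weylMap X).1 z)⁻¹ •
      ∑ i : Fin (n + 1), z ^ (i : ℕ) • horner (weylMap X).1 X (i + 1)) = 1 := by
    rw [mul_smul_comm, h, smul_smul, inv_mul_cancel₀ hz, one_smul]
  have h3 := ratEval_weylMap z X
  rw [weylFun, Matrix.inv_eq_right_inv h2, ratEval_eq, Matrix.smul_apply, Matrix.sum_apply,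
    smul_eq_mul, div_eq_iff hz, mul_comm, ← mul_assoc, mul_inv_cancel₀ hz, one_mul] at h3
  rw [h3]
  simp

theorem monicVec_weylMap (X : TodaMat n) (j : Fin (n + 1)) :
    monicVec (weylMap X).2 j = horner (weylMap X).1 X (j + 1) 0 0 := by
  have : monicVec (weylMap X).2 = fun j : Fin (n + 1) => horner (weylMap X).1 X (j + 1) 0 0 := by
    refine evalVec_injective (finite_evalMonic_eq_zero (weylMap X)) fun z hz => ?_
    rw [evalVec_monicVec, ← sum_horner_weylMap_zero_zero X hz]
    exact sum_congr rfl fun i _ => mul_comm _ _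
  exact congrFun this j

/-- A linear recursion with leading coefficient 1 isolates the next term once all earlier ones
vanish; `d` will be the difference of two moment sequences. -/
theorem sum_monicCoeff_of_zero {p : Fin (n + 1) → ℝ} {d : ℕ → ℝ} {m k : ℕ} (hm : m ≤ n + 1)
    (hd : ∀ l < n + 1 - m + k, d l = 0) :
    ∑ l ∈ range (n + 2), monicCoeff p (m + l) * d (l + k) = d (n + 1 - m + k) := by
  rw [sum_eq_single (n + 1 - m)]
  · rw [show m + (n + 1 - m) = n + 1 by omega, monicCoeff_top, one_mul]
  · intro l _ hl
    rcases lt_or_gt_of_ne hl with h | h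
    · rw [hd _ (by omega), mul_zero]
    · rw [monicCoeff_of_gt p (by omega), zero_mul]
  · intro h
    exact absurd (Finset.mem_range.mpr (by omega)) h

/-- The moments of a matrix are those of its Weyl function. -/
theorem pow_apply_zero_zero (X : TodaMat n) (k : ℕ) :
    (X ^ k) 0 0 = (companion (weylMap X).1 ^ k *ᵥ monicVec (weylMap X).2) (Fin.last n) := by
  set p := (weylMap X).1 with hp
  set C := companion p with hC
  set d : ℕ → ℝ := fun k => (X ^ k) 0 0 - (C ^ k *ᵥ monicVec (weylMap X).2) (Fin.last n) with hd
  suffices H : ∀ k, d k = 0 from sub_eq_zero.mp (H k)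
  intro k
  induction k using Nat.strong_induction_on with
  | _ k ih =>
    -- The moments up to order n are fixed by the coefficients of q through the Horner polynomials,
    -- the later ones by the recursion of Cayley–Hamilton.
    rcases lt_or_ge k (n + 1) with hk | hk
    · have h1 := monicVec_weylMap X ⟨n - k, by omega⟩
      have h2 := horner_mulVec_last p (monicVec (weylMap X).2) ⟨n - k, by omega⟩
      have h3 := sum_monicCoeff_of_zero (p := p) (d := d) (m := n - k + 1) (k := 0) (by omega)
        (fun l hl => ih l (by omega))
      rw [show n + 1 - (n - k + 1) + 0 = k by omega] at h3
      rw [← h3]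
      rw [← h2, ← hp] at h1
      simp only [horner, Matrix.sum_apply, Matrix.smul_apply, smul_eq_mul, sum_mulVec, smul_mulVec,
        Finset.sum_apply, Pi.smul_apply] at h1
      simp only [hd, mul_sub, sum_sub_distrib, add_zero]
      rw [sub_eq_zero]
      exact h1.symm
    · have h3 := sum_monicCoeff_of_zero (p := p) (d := d) (m := 0) (k := k - (n + 1)) (by omega)
        (fun l hl => ih l (by omega))
      rw [show n + 1 - 0 + (k - (n + 1)) = k by omega] at h3
      rw [← h3]
      have h1 : (horner p X 0 * X ^ (k - (n + 1))) 0 0 = 0 := by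
        rw [hp, horner_weylMap_zero, zero_mul]; rfl
      have h2 : ((horner p C 0 * C ^ (k - (n + 1))) *ᵥ monicVec (weylMap X).2) (Fin.last n) = 0 := by
        rw [hC, horner_companion_zero, zero_mul, zero_mulVec]; rfl
      simp only [horner, sum_mul, smul_mul_assoc, ← pow_add, Matrix.sum_apply, Matrix.smul_apply,
        smul_eq_mul, sum_mulVec, smul_mulVec, Finset.sum_apply, Pi.smul_apply] at h1 h2
      simp only [hd, mul_sub, sum_sub_distrib, h1, h2, sub_zero]

/-! ### The Moser map along the Lax flows -/

/-- The coefficients are values of universal polynomials in the matrix entries. -/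
theorem contDiff_charpoly_coeff {N : ℕ} (j : ℕ) {E : Type*} [NormedAddCommGroup E]
    [NormedSpace ℝ E] {F : E → Matrix (Fin N) (Fin N) ℝ}
    (hF : ∀ a b, ContDiff ℝ ∞ fun x => F x a b) :
    ContDiff ℝ ∞ fun x => (F x).charpoly.coeff j := by
  have e : ∀ x, (F x).charpoly.coeff j = MvPolynomial.eval (fun ab : Fin N × Fin N => F x ab.1 ab.2)
      ((Matrix.charpoly.univ ℝ (Fin N)).coeff j) := by
    intro x
    exact (Matrix.charpoly.univ_coeff_eval₂Hom (Fin N) (RingHom.id ℝ)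
      (fun ab : Fin N × Fin N => F x ab.1 ab.2) j).symm
  simp only [e]
  generalize (Matrix.charpoly.univ ℝ (Fin N)).coeff j = P
  induction P using MvPolynomial.induction_on with
  | C c => simp only [MvPolynomial.eval_C]; exact contDiff_const
  | add P Q hP hQ => simp only [map_add]; exact hP.add hQ
  | mul_X P ab hP => simp only [map_mul, MvPolynomial.eval_X]; exact hP.mul (hF _ _)

theorem contDiff_todaMat_apply (a b : Fin (n + 1)) : ContDiff ℝ ∞ fun X : TodaMat n => X a b :=
  contDiff_matrix.mp contDiff_id a b

theorem contDiff_weylMap : ContDiff ℝ ∞ (weylMap (n := n)) := by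
  refine ContDiff.prodMk (contDiff_pi.mpr fun j => ?_) (contDiff_pi.mpr fun j => ?_)
  · exact contDiff_charpoly_coeff _ contDiff_todaMat_apply
  · exact contDiff_charpoly_coeff _ fun a b => contDiff_todaMat_apply a.succ b.succ

theorem hasDerivAt_pow_of_commutator {γ : ℝ → TodaMat n} {L : TodaMat n} {t : ℝ}
    (h : HasDerivAt γ (γ t * L - L * γ t) t) (k : ℕ) :
    HasDerivAt (fun s => γ s ^ k) (γ t ^ k * L - L * γ t ^ k) t := by
  induction k with
  | zero =>
    simp only [pow_zero, one_mul, mul_one, sub_self]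
    exact hasDerivAt_const t 1
  | succ k ih =>
    simp only [pow_succ]
    refine (ih.matrix_mul h).congr_deriv ?_
    noncomm_ring

theorem lowerPart_apply_zero (A : TodaMat n) (a : Fin (n + 1)) : lowerPart A a 0 = A a 0 := by
  simp [lowerPart]

theorem lowerPart_zero_apply (A : TodaMat n) (b : Fin (n + 1)) (hb : b ≠ 0) :
    lowerPart A 0 b = 0 := by
  simp [lowerPart, hb]

/-- The first column of (X^m)_{≤ 0} is that of X^m, and its first row is (X^m)_{00} times e_0^T. The
corner entry of the commutator thus involves moments only. -/
theorem hasDerivAt_moment (m : ℕ) {γ : ℝ → TodaMat n} {t : ℝ}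
    (h : HasDerivAt γ (laxField m (γ t)) t) (k : ℕ) :
    HasDerivAt (fun s => (γ s ^ k) 0 0)
      ((γ t ^ (k + m)) 0 0 - (γ t ^ m) 0 0 * (γ t ^ k) 0 0) t := by
  refine (hasDerivAt_matrix.mp (hasDerivAt_pow_of_commutator h k) 0 0).congr_deriv ?_
  have h1 : (γ t ^ k * lowerPart (γ t ^ m)) 0 0 = (γ t ^ (k + m)) 0 0 := by
    rw [pow_add, Matrix.mul_apply, Matrix.mul_apply]
    exact sum_congr rfl fun a _ => by rw [lowerPart_apply_zero]
  have h2 : (lowerPart (γ t ^ m) * γ t ^ k) 0 0 = (γ t ^ m) 0 0 * (γ t ^ k) 0 0 := by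
    rw [Matrix.mul_apply, sum_eq_single 0]
    · rw [lowerPart_apply_zero]
    · intro b _ hb
      rw [lowerPart_zero_apply _ _ hb, zero_mul]
    · simp
  rw [Matrix.sub_apply, h1, h2]

theorem weylMap_fst_conj {X b c : TodaMat n} (hcb : c * b = 1) :
    (weylMap (b * X * c)).1 = (weylMap X).1 := by
  have : (b * X * c).charpoly = X.charpoly := by
    rw [Matrix.charpoly_mul_comm, ← mul_assoc, hcb, one_mul]
  funext j
  simp only [weylMap, this]

/-- Converts a Horner combination of shifted moments back into a coefficient of z^m q mod p. -/
theorem horner_companion_mul_pow (p : Fin (n + 1) → ℝ) (q : Fin (n + 1) → ℝ) (m : ℕ)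
    (j : Fin (n + 1)) : ∑ l ∈ range (n + 2), monicCoeff p (j + 1 + l) *
      (companion p ^ (l + m) *ᵥ q) (Fin.last n) = (companion p ^ m *ᵥ q) j := by
  rw [← horner_mulVec_last p (companion p ^ m *ᵥ q) j]
  simp only [horner, mulVec_mulVec, sum_mul, smul_mul_assoc, ← pow_add, sum_mulVec, smul_mulVec,
    Finset.sum_apply, Pi.smul_apply, smul_eq_mul]

/-- The Moser map linearizes the Lax flows. -/
theorem hasDerivAt_weylMap (m : ℕ) {γ : ℝ → TodaMat n} {t : ℝ}
    (hγ : ∀ᶠ s in 𝓝 t, HasDerivAt γ (laxField m (γ s)) s) :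
    HasDerivAt (fun s => weylMap (γ s))
      ((0, fun j : Fin n =>
        (companion (weylMap (γ t)).1 ^ m *ᵥ monicVec (weylMap (γ t)).2) j.castSucc -
        (companion (weylMap (γ t)).1 ^ m *ᵥ monicVec (weylMap (γ t)).2) (Fin.last n) *
          (weylMap (γ t)).2 j) : RatCoeff n) t := by
  have hp : ∀ᶠ s in 𝓝 t, (weylMap (γ s)).1 = (weylMap (γ t)).1 := by
    filter_upwards [eventually_lax_conj m hγ] with s ⟨b, c, _, _, hcb, e⟩
    rw [e, weylMap_fst_conj hcb]
  have hd := hγ.self_of_nhds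
  refine HasDerivAt.prodMk ?_ (hasDerivAt_pi.mpr fun j => ?_)
  · exact (hasDerivAt_const t (weylMap (γ t)).1).congr_of_eventuallyEq hp
  · have e1 : ∀ s, (weylMap (γ s)).2 j = ∑ l ∈ range (n + 2),
        monicCoeff (weylMap (γ s)).1 (j + 1 + l) * (γ s ^ l) 0 0 := by
      intro s
      have := monicVec_weylMap (γ s) j.castSucc
      rw [monicVec, Fin.snoc_castSucc] at this
      rw [this]
      simp [horner, Matrix.sum_apply]
    have h1 : HasDerivAt (fun s => ∑ l ∈ range (n + 2),
        monicCoeff (weylMap (γ t)).1 (j + 1 + l) * (γ s ^ l) 0 0)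
        (∑ l ∈ range (n + 2), monicCoeff (weylMap (γ t)).1 (j + 1 + l) *
          ((γ t ^ (l + m)) 0 0 - (γ t ^ m) 0 0 * (γ t ^ l) 0 0)) t :=
      HasDerivAt.fun_sum fun l _ => (hasDerivAt_moment m hd l).const_mul _
    have h2 : (fun s => (weylMap (γ s)).2 j) =ᶠ[𝓝 t] fun s => ∑ l ∈ range (n + 2),
        monicCoeff (weylMap (γ t)).1 (j + 1 + l) * (γ s ^ l) 0 0 := by
      filter_upwards [hp] with s hs
      rw [e1, hs]
    refine (h1.congr_of_eventuallyEq h2).congr_deriv ?_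
    have h3 := horner_companion_mul_pow (weylMap (γ t)).1 (monicVec (weylMap (γ t)).2) m j.castSucc
    rw [← h3, e1 t]
    simp only [Fin.val_castSucc, mul_sub, sum_sub_distrib, pow_apply_zero_zero, mul_sum]
    congr 1
    exact sum_congr rfl fun l _ => by ring

/-! ### Krylov matrices -/

/-- The matrix with columns `X ^ b e_0`. -/
def krylov (X : TodaMat n) : TodaMat n := Matrix.of fun a b => (X ^ (b : ℕ)) a 0

theorem IsHessenberg.pow_apply {X : TodaMat n} (h : IsHessenberg X) (k : ℕ) :
    (∀ a : Fin (n + 1), k < a → (X ^ k) a 0 = 0) ∧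
      ∀ a : Fin (n + 1), (a : ℕ) = k → (X ^ k) a 0 = 1 := by
  induction k with
  | zero =>
    refine ⟨fun a ha => ?_, fun a ha => ?_⟩
    · rw [pow_zero, Matrix.one_apply_ne]
      intro h0; simp [h0] at ha
    · have : a = 0 := Fin.ext ha
      rw [this, pow_zero, Matrix.one_apply_eq]
  | succ k ih =>
    refine ⟨fun a ha => ?_, fun a ha => ?_⟩
    · rw [pow_succ', Matrix.mul_apply]
      refine sum_eq_zero fun c _ => ?_
      rcases le_or_gt (c : ℕ) k with hc | hc
      · rw [h.apply_of_gt (by omega), zero_mul]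
      · rw [ih.1 c hc, mul_zero]
    · rw [pow_succ', Matrix.mul_apply, sum_eq_single ⟨k, by omega⟩]
      · rw [h.apply_succ (by simpa using ha), ih.2 _ rfl, one_mul]
      · intro c _ hc
        rcases lt_or_gt_of_ne (fun h => hc (Fin.ext h) : (c : ℕ) ≠ k) with hc | hc
        · rw [h.apply_of_gt (by omega), zero_mul]
        · rw [ih.1 c hc, mul_zero]
      · simp

theorem IsHessenberg.isUnit_det_krylov {X : TodaMat n} (h : IsHessenberg X) :
    IsUnit (krylov X).det := by
  have : (krylov X).det = ∏ i, krylov X i i := by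
    refine Matrix.det_of_isUpperTriangular fun a b hab => ?_
    exact (h.pow_apply b).1 a hab
  rw [this, prod_eq_one]
  · exact isUnit_one
  · intro i _
    exact (h.pow_apply i).2 i rfl

/-- X shifts the Krylov columns; the vector X^(n+1) e_0 that leaves the range is expressed by
Cayley–Hamilton. -/
theorem mul_krylov (X : TodaMat n) : X * krylov X = krylov X * companion (weylMap X).1 := by
  ext a b
  have hL : (X * krylov X) a b = (X ^ ((b : ℕ) + 1)) a 0 := by
    rw [pow_succ', Matrix.mul_apply, Matrix.mul_apply]
    rfl
  rw [hL, Matrix.mul_apply]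
  refine Fin.lastCases ?_ (fun b => ?_) b
  · simp only [companion_apply_last, krylov, Matrix.of_apply, Fin.val_last]
    have h := congrArg (fun M : TodaMat n => M a 0) (horner_weylMap_zero X)
    simp only [horner, Matrix.sum_apply, Matrix.smul_apply, smul_eq_mul, zero_add,
      Matrix.zero_apply, sum_range_succ _ (n + 1), monicCoeff_top, one_mul] at h
    rw [← Fin.sum_univ_eq_sum_range (fun l => monicCoeff (weylMap X).1 l * (X ^ l) a 0)] at h
    simp only [monicCoeff_fin] at h
    simp only [mul_neg, sum_neg_distrib]
    have e : ∑ c : Fin (n + 1), (X ^ (c : ℕ)) a 0 * (weylMap X).1 c =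
        ∑ c : Fin (n + 1), (weylMap X).1 c * (X ^ (c : ℕ)) a 0 :=
      sum_congr rfl fun c _ => mul_comm _ _
    rw [e]
    linarith
  · simp only [companion_apply_castSucc]
    simp [krylov]

theorem eq_krylov_conj {X : TodaMat n} (h : IsHessenberg X) :
    X = krylov X * companion (weylMap X).1 * (krylov X)⁻¹ := by
  rw [← mul_krylov, Matrix.mul_nonsing_inv_cancel_right _ _ h.isUnit_det_krylov]

theorem matrix_conj_pow {K A : TodaMat n} (hK : IsUnit K.det) (k : ℕ) :
    (K * A * K⁻¹) ^ k = K * A ^ k * K⁻¹ := by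
  induction k with
  | zero => rw [pow_zero, pow_zero, mul_one, Matrix.mul_nonsing_inv _ hK]
  | succ k ih =>
    rw [pow_succ, ih, pow_succ]
    simp only [mul_assoc]
    rw [Matrix.nonsing_inv_mul_cancel_left _ _ hK]

theorem matrix_conj_zpow {K A : TodaMat n} (hK : IsUnit K.det) (k : ℤ) :
    (K * A * K⁻¹) ^ k = K * A ^ k * K⁻¹ := by
  cases k with
  | ofNat k => simpa using matrix_conj_pow hK k
  | negSucc k =>
    rw [zpow_negSucc, zpow_negSucc, matrix_conj_pow hK, Matrix.mul_inv_rev,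
      Matrix.mul_inv_rev, Matrix.nonsing_inv_nonsing_inv _ hK, mul_assoc]

theorem IsHessenberg.det_eq {X : TodaMat n} (h : IsHessenberg X) :
    X.det = (companion (weylMap X).1).det := by
  conv_lhs => rw [eq_krylov_conj h]
  rw [Matrix.det_mul, Matrix.det_mul, mul_right_comm, ← Matrix.det_mul,
    Matrix.mul_nonsing_inv _ h.isUnit_det_krylov, Matrix.det_one, one_mul]

/-- Traces of powers and the determinant are invariant under the conjugation by K, so the
Hamiltonians depend on p only. -/
theorem todaHam_eq {X : TodaMat n} (h : IsHessenberg X) (j : ℤ) :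
    todaHam j X = todaHam j (companion (weylMap X).1) := by
  have hK := h.isUnit_det_krylov
  have ht : (X ^ j).trace = (companion (weylMap X).1 ^ j).trace := by
    conv_lhs => rw [eq_krylov_conj h, matrix_conj_zpow hK, Matrix.trace_mul_comm,
      ← mul_assoc, Matrix.nonsing_inv_mul _ hK, one_mul]
  unfold todaHam
  rw [h.det_eq, ht]

end Moments

/-! ### Differentials of the Hamiltonians -/

section Hamiltonian

open Finset Matrix

variable {n : ℕ}

/-- The auxiliary Y, commuting with A(t), is what makes the induction close: one factor A moves
cyclically and is absorbed into Y. -/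
theorem trace_mul_deriv_pow {A : ℝ → TodaMat n} {A' : TodaMat n} {t : ℝ} (hA : HasDerivAt A A' t)
    (l : ℕ) : ∃ D : TodaMat n, HasDerivAt (fun s => A s ^ (l + 1)) D t ∧
      ∀ Y, Commute Y (A t) → (Y * D).trace = (l + 1) * (Y * A t ^ l * A').trace := by
  induction l with
  | zero => exact ⟨A', by simpa using hA, fun Y _ => by simp⟩
  | succ l ih =>
    obtain ⟨D, hD, h⟩ := ih
    refine ⟨D * A t + A t ^ (l + 1) * A', ?_, fun Y hY => ?_⟩
    · simp only [pow_succ _ (l + 1)]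
      exact hD.matrix_mul hA
    · have h1 : (Y * (D * A t)).trace = (A t * Y * D).trace := by
        rw [← mul_assoc, Matrix.trace_mul_comm, mul_assoc]
      have h2 : A t * Y * A t ^ l = Y * A t ^ (l + 1) := by
        rw [← hY.eq, mul_assoc, ← pow_succ']
      rw [mul_add, Matrix.trace_add, h1, h _ ((Commute.refl _).mul_left hY), h2, ← mul_assoc]
      push_cast
      ring

theorem hasDerivAt_trace_pow {A : ℝ → TodaMat n} {A' : TodaMat n} {t : ℝ} (hA : HasDerivAt A A' t)
    (l : ℕ) :
    HasDerivAt (fun s => (A s ^ (l + 1)).trace) ((l + 1) * (A t ^ l * A').trace) t := by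
  obtain ⟨D, hD, h⟩ := trace_mul_deriv_pow hA l
  have h1 := h 1 (Commute.one_left _)
  rw [one_mul, one_mul] at h1
  rw [← h1]
  simp only [Matrix.trace, Matrix.diag]
  exact HasDerivAt.fun_sum fun i _ => hasDerivAt_matrix.mp hD i i

theorem contDiff_det {ι E : Type*} [Fintype ι] [DecidableEq ι] [NormedAddCommGroup E]
    [NormedSpace ℝ E] {F : E → Matrix ι ι ℝ} (hF : ∀ a b, ContDiff ℝ ∞ fun x => F x a b) :
    ContDiff ℝ ∞ fun x => (F x).det := by
  simp only [Matrix.det_apply']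
  exact ContDiff.sum fun σ _ => contDiff_const.mul (contDiff_prod fun i _ => hF _ _)

theorem contDiff_adjugate {ι E : Type*} [Fintype ι] [DecidableEq ι] [NormedAddCommGroup E]
    [NormedSpace ℝ E] {F : E → Matrix ι ι ℝ} (hF : ∀ a b, ContDiff ℝ ∞ fun x => F x a b) (a b : ι) :
    ContDiff ℝ ∞ fun x => (F x).adjugate a b := by
  simp only [Matrix.adjugate_apply]
  refine contDiff_det fun c d => ?_
  simp only [Matrix.updateRow_apply]
  split_ifs
  · exact contDiff_const
  · exact hF _ _

theorem contDiffAt_matrix_inv {ι E : Type*} [Fintype ι] [DecidableEq ι] [NormedAddCommGroup E]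
    [NormedSpace ℝ E] {F : E → Matrix ι ι ℝ} (hF : ∀ a b, ContDiff ℝ ∞ fun x => F x a b) {x : E}
    (hx : (F x).det ≠ 0) (a b : ι) : ContDiffAt ℝ ∞ (fun x => (F x)⁻¹ a b) x := by
  simp only [Matrix.inv_def, Matrix.smul_apply, Ring.inverse_eq_inv', smul_eq_mul]
  exact (contDiff_det hF).contDiffAt.inv hx |>.mul (contDiff_adjugate hF a b).contDiffAt

theorem contDiffAt_trace_inv_pow {ι E : Type*} [Fintype ι] [DecidableEq ι] [NormedAddCommGroup E]
    [NormedSpace ℝ E] {F : E → Matrix ι ι ℝ} (hF : ∀ a b, ContDiff ℝ ∞ fun x => F x a b) {x : E}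
    (hx : (F x).det ≠ 0) (k : ℕ) : ContDiffAt ℝ ∞ (fun x => ((F x)⁻¹ ^ k).trace) x := by
  simp only [Matrix.inv_def, smul_pow, Matrix.trace_smul, Ring.inverse_eq_inv', smul_eq_mul]
  refine (((contDiff_det hF).contDiffAt.inv hx).pow k).mul ?_
  simp only [Matrix.trace, Matrix.diag]
  exact (ContDiff.sum fun i _ => contDiff_matrix_pow (contDiff_adjugate hF) k i i).contDiffAt

theorem contDiffAt_todaHam {E : Type*} [NormedAddCommGroup E] [NormedSpace ℝ E]
    {F : E → TodaMat n} (hF : ∀ a b, ContDiff ℝ ∞ fun x => F x a b) {x : E} {j : ℤ}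
    (hj : j ≤ 0 → (F x).det ≠ 0) : ContDiffAt ℝ ∞ (fun x => todaHam j (F x)) x := by
  unfold todaHam
  by_cases h0 : j = 0
  · simp only [if_pos h0]
    exact (contDiff_det hF).contDiffAt.log (hj h0.le)
  · simp only [if_neg h0]
    refine ContDiffAt.div_const ?_ _
    obtain ⟨k, rfl | rfl⟩ := j.eq_nat_or_neg
    · simp only [zpow_natCast, Matrix.trace, Matrix.diag]
      exact (ContDiff.sum fun i _ => contDiff_matrix_pow hF k i i).contDiffAt
    · simp only [Matrix.zpow_neg_natCast, ← Matrix.inv_pow']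
      exact contDiffAt_trace_inv_pow hF (hj (by omega)) k

theorem hasDerivAt_det_add_smul {A V : TodaMat n} (hA : A.det ≠ 0) :
    HasDerivAt (fun s : ℝ => (A + s • V).det) (A.det * (A⁻¹ * V).trace) 0 := by
  -- After A is factored out, det(1 + s M) is 1 + s tr M plus a polynomial multiple of s².
  have e : (fun s : ℝ => (A + s • V).det) = fun s => A.det * (1 + (A⁻¹ * V).trace * s +
      (det (1 + (Polynomial.X : Polynomial ℝ) •
        (A⁻¹ * V).map Polynomial.C)).divX.divX.eval s * s ^ 2) := by
    funext s
    rw [← Matrix.det_one_add_smul, ← Matrix.det_mul, mul_add, mul_one, mul_smul_comm,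
      Matrix.mul_nonsing_inv_cancel_left _ _ (isUnit_iff_ne_zero.mpr hA)]
  rw [e]
  have h1 := ((hasDerivAt_id (0 : ℝ)).const_mul (A⁻¹ * V).trace).const_add 1
  have h2 := ((det (1 + (Polynomial.X : Polynomial ℝ) •
    (A⁻¹ * V).map Polynomial.C)).divX.divX.hasDerivAt 0).mul (hasDerivAt_pow 2 (0 : ℝ))
  refine ((h1.add h2).const_mul A.det).congr_deriv ?_
  simp

theorem hasDerivAt_matrix_inv {A V : TodaMat n} (hA : A.det ≠ 0) :
    HasDerivAt (fun s : ℝ => (A + s • V)⁻¹) (-(A⁻¹ * V * A⁻¹)) 0 := by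
  have hF : ∀ a b, ContDiff ℝ ∞ fun s : ℝ => (A + s • V) a b := by
    intro a b
    simp only [Matrix.add_apply, Matrix.smul_apply, smul_eq_mul]
    fun_prop
  have h0 : (A + (0 : ℝ) • V) = A := by rw [zero_smul, add_zero]
  have hA' := isUnit_iff_ne_zero.mpr hA
  -- Differentiability comes from Cramer's rule; the value is then forced by differentiating the
  -- product of the matrix with its inverse.
  have hd : ∀ a b, DifferentiableAt ℝ (fun s : ℝ => (A + s • V)⁻¹ a b) 0 := fun a b =>
    (contDiffAt_matrix_inv hF (by rwa [h0]) a b).differentiableAt (by simp)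
  set D : TodaMat n := Matrix.of fun a b => deriv (fun s : ℝ => (A + s • V)⁻¹ a b) 0
  have hD : HasDerivAt (fun s : ℝ => (A + s • V)⁻¹) D 0 :=
    hasDerivAt_matrix.mpr fun a b => (hd a b).hasDerivAt
  have h1 := (hasDerivAt_add_smul A V 0).matrix_mul hD
  have hne : ∀ᶠ s : ℝ in 𝓝 0, (A + s • V).det ≠ 0 :=
    (contDiff_det hF).continuous.continuousAt.eventually_ne (by rwa [h0])
  have h2 : HasDerivAt (fun s : ℝ => (A + s • V) * (A + s • V)⁻¹) 0 0 := by
    refine (hasDerivAt_const (0 : ℝ) (1 : TodaMat n)).congr_of_eventuallyEq ?_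
    filter_upwards [hne] with s hs
    exact Matrix.mul_nonsing_inv _ (isUnit_iff_ne_zero.mpr hs)
  have h3 := h1.unique h2
  rw [h0] at h3
  have h4 : D = -(A⁻¹ * V * A⁻¹) := by
    have := congrArg (A⁻¹ * ·) h3
    simp only [mul_add, mul_zero] at this
    rw [Matrix.nonsing_inv_mul_cancel_left _ _ hA', ← mul_assoc] at this
    exact eq_neg_of_add_eq_zero_right this
  rw [← h4]
  exact hD

theorem hasDerivAt_todaHam {A V : TodaMat n} {j : ℤ} (hj : j ≤ 0 → A.det ≠ 0) :
    HasDerivAt (fun s : ℝ => todaHam j (A + s • V)) (A ^ (j - 1) * V).trace 0 := by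
  have h0 : (A + (0 : ℝ) • V) = A := by rw [zero_smul, add_zero]
  have hl := hasDerivAt_add_smul A V 0
  rcases lt_trichotomy j 0 with h | h | h
  · have hA := hj h.le
    obtain ⟨k, rfl⟩ : ∃ k : ℕ, j = -((k + 1 : ℕ) : ℤ) := ⟨(-j - 1).toNat, by omega⟩
    have h1 := hasDerivAt_trace_pow (hasDerivAt_matrix_inv (V := V) hA) k
    unfold todaHam
    simp only [if_neg h.ne, Matrix.zpow_neg_natCast, ← Matrix.inv_pow']
    refine (h1.div_const _).congr_deriv ?_
    rw [h0, show -((k + 1 : ℕ) : ℤ) - 1 = -((k + 2 : ℕ) : ℤ) by push_cast; ring,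
      Matrix.zpow_neg_natCast, ← Matrix.inv_pow']
    have h2 : (A⁻¹ ^ k * -(A⁻¹ * V * A⁻¹)).trace = -(A⁻¹ ^ (k + 2) * V).trace := by
      rw [mul_neg, Matrix.trace_neg, ← mul_assoc, Matrix.trace_mul_comm, ← mul_assoc, ← mul_assoc,
        ← pow_succ', ← pow_succ]
    rw [h2]
    push_cast
    have : (k : ℝ) + 1 ≠ 0 := by positivity
    field_simp
  · subst h
    have hA := hj le_rfl
    unfold todaHam
    simp only [if_true]
    refine ((hasDerivAt_det_add_smul hA).log (by rwa [h0])).congr_deriv ?_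
    rw [h0, mul_div_cancel_left₀ _ hA, zero_sub, Matrix.zpow_neg_one]
  · obtain ⟨k, rfl⟩ : ∃ k : ℕ, j = ((k + 1 : ℕ) : ℤ) := ⟨(j - 1).toNat, by omega⟩
    have h1 := hasDerivAt_trace_pow hl k
    unfold todaHam
    simp only [if_neg h.ne', zpow_natCast]
    refine (h1.div_const _).congr_deriv ?_
    rw [h0, show ((k + 1 : ℕ) : ℤ) - 1 = (k : ℤ) by push_cast; ring, zpow_natCast]
    push_cast
    have : (k : ℝ) + 1 ≠ 0 := by positivity
    field_simp

/-- The companion matrix varies in its last column alone, so the trace of C^(j-1) against this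
variation reads off the last row of C^(j-1). -/
theorem fderiv_todaHam_companion {a : RatCoeff n} {j : ℤ} (hj : j ≤ 0 → (companion a.1).det ≠ 0)
    (v : RatCoeff n) :
    fderiv ℝ (fun b : RatCoeff n => todaHam j (companion b.1)) a v =
      -∑ i, (companion a.1 ^ (j - 1)) (Fin.last n) i * v.1 i := by
  have hd : DifferentiableAt ℝ (fun b : RatCoeff n => todaHam j (companion b.1)) a :=
    (contDiffAt_todaHam contDiff_companion hj).differentiableAt (by simp)
  have h1 := hasDerivAt_comp_add_smul hd v
  have h2 := hasDerivAt_todaHam (V := companionDeriv v.1) hj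
  simp only [Prod.fst_add, Prod.smul_fst, companion_add] at h1
  rw [h1.unique h2, Matrix.trace_mul_comm]
  simp only [Matrix.trace, Matrix.diag, Matrix.mul_apply, companionDeriv, Matrix.of_apply,
    ite_mul, zero_mul, Finset.sum_ite_eq', Finset.mem_univ, if_true]
  rw [← sum_neg_distrib]
  exact sum_congr rfl fun i _ => by ring

theorem commute_zpow_companion (p : Fin (n + 1) → ℝ) (j : ℤ) :
    Commute (companion p ^ j) (companion p) := Matrix.Commute.zpow_self _ _

/-- The linear flow of the moments is generated by the Hamiltonians. -/
theorem ratBracket_todaHam {a : RatCoeff n} (k : Fin (n + 1)) {m : ℕ} (F : RatCoeff n → ℝ)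
    (hj : (m : ℤ) + 1 - (k : ℤ) ≤ 0 → (companion a.1).det ≠ 0) :
    ratBracket (Pi.single k 1) F
        (fun b => todaHam ((m : ℤ) + 1 - (k : ℤ)) (companion b.1)) a =
      fderiv ℝ F a (0, fun j : Fin n =>
        (companion a.1 ^ m *ᵥ monicVec a.2) j.castSucc -
        (companion a.1 ^ m *ᵥ monicVec a.2) (Fin.last n) * a.2 j) := by
  set C := companion a.1 with hC
  -- This exponent is j - 1 for j = m + 1 - k, so the last row of Y is minus the gradient of the
  -- Hamiltonian.
  set Y := C ^ ((m : ℤ) - k) with hY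
  have hYC : Y * C ^ (k : ℕ) = C ^ m := by
    rw [hY, ← zpow_natCast, ← zpow_natCast]
    -- For k ≤ m both exponents are nonnegative and C may be singular; for k > m the hypothesis on
    -- the determinant applies.
    by_cases h : (k : ℤ) ≤ m
    · rw [← Matrix.zpow_add_of_nonneg (by omega) (by omega), sub_add_cancel]
    · rw [← Matrix.zpow_add (isUnit_iff_ne_zero.mpr (hj (by omega))), sub_add_cancel]
  have hsum := sum_lastRow_smul_horner (p := a.1) (Y := Y) (commute_zpow_companion _ _)
  have e : ((0, fun j : Fin n => (C ^ m *ᵥ monicVec a.2) j.castSucc -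
      (C ^ m *ᵥ monicVec a.2) (Fin.last n) * a.2 j) : RatCoeff n) =
      ∑ i, ∑ j, (bracketCoeff (Pi.single k 1) a i j * Y (Fin.last n) i) • numDir j := by
    have h1 : ∀ j : Fin n, (C ^ m *ᵥ monicVec a.2) j.castSucc -
        (C ^ m *ᵥ monicVec a.2) (Fin.last n) * a.2 j =
        ∑ i, bracketCoeff (Pi.single k 1) a i j * Y (Fin.last n) i := by
      intro j
      simp only [bracketCoeff, ratRem_single, sub_mul, sum_sub_distrib]
      rw [← hYC, ← mulVec_mulVec]
      congr 1
      · conv_lhs => rw [← hsum]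
        simp only [sum_mulVec, smul_mulVec, Finset.sum_apply, Pi.smul_apply, smul_eq_mul]
        exact sum_congr rfl fun i _ => mul_comm _ _
      · rw [mulVec, dotProduct, sum_mul]
        exact sum_congr rfl fun i _ => by ring
    simp only [h1]
    ext j
    · simp [Prod.fst_sum, numDir]
    · simp [Prod.snd_sum, numDir, Finset.sum_apply, Pi.single_apply]
  rw [e]
  simp only [ratBracket, bivectorBracket, ratBivector_apply, map_sum, map_smul, smul_eq_mul]
  refine sum_congr rfl fun i _ => sum_congr rfl fun j _ => ?_
  rw [fderiv_todaHam_companion hj, fderiv_todaHam_companion hj]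
  simp only [numDir, denDir, Pi.zero_apply, mul_zero, sum_const_zero, Pi.single_apply, mul_ite,
    mul_one, Finset.sum_ite_eq', Finset.mem_univ, if_true]
  rw [show (m : ℤ) + 1 - k - 1 = m - k by ring]
  ring

end Hamiltonian

/-! ### The shape of the matrices of an orbit -/

section Staircase

open Finset Matrix

variable {n : ℕ}

/-- The shape of the rows of the traceless parts of the matrices in an orbit with index set `s`. -/
structure IsStaircase (s : ℕ → Prop) (Y : TodaMat n) : Prop where
  of_mem : ∀ c : Fin (n + 1), c ≠ 0 → s c → ∃ a < c, Y a c ≠ 0 ∧ ∀ d, c < d → Y a d = 0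
  of_notMem : ∀ c : Fin (n + 1), c ≠ 0 → ¬ s c → ∃ a < c, ∃ κ, ∀ d, c ≤ d → Y c d = κ * Y a d

open Classical in
/-- The number of elements of `s` in `1, …, a`. -/
noncomputable def memCount (s : ℕ → Prop) (a : ℕ) : ℕ := Nat.count (fun j => s (j + 1)) a

/-- The number of elements of `1, …, a` that are not in `s`. -/
noncomputable def notMemCount (s : ℕ → Prop) (a : ℕ) : ℕ := memCount (fun j => ¬ s j) a

theorem memCount_succ_of_mem {s : ℕ → Prop} {a : ℕ} (h : s (a + 1)) :
    memCount s (a + 1) = memCount s a + 1 := by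
  simp [memCount, Nat.count_succ, h]

theorem memCount_succ_of_notMem {s : ℕ → Prop} {a : ℕ} (h : ¬ s (a + 1)) :
    memCount s (a + 1) = memCount s a := by
  simp [memCount, Nat.count_succ, h]

open Classical in
/-- The power of the matrix whose first row is used at step number `a`. -/
noncomputable def stairExp (s : ℕ → Prop) (a : ℕ) : ℤ :=
  if s a then memCount s a else -(notMemCount s a : ℤ)

/-- Each step extends the interval of exponents by one at one of its ends, and `stairExp` is the new
end. -/
theorem exists_stairExp_eq (s : ℕ → Prop) (a : ℕ) {k : ℤ}
    (hk : k ∈ Set.Icc (-(notMemCount s a : ℤ)) (memCount s a : ℤ)) : ∃ d ≤ a, stairExp s d = k := by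
  induction a with
  | zero =>
    refine ⟨0, le_rfl, ?_⟩
    simp only [notMemCount, memCount, Nat.count_zero, Nat.cast_zero, neg_zero, Set.Icc_self,
      Set.mem_singleton_iff] at hk
    simp [stairExp, notMemCount, memCount, hk]
  | succ a ih =>
    rw [Set.mem_Icc] at hk ih
    by_cases h : s (a + 1)
    · have h1 := memCount_succ_of_mem h
      have h2 : notMemCount s (a + 1) = notMemCount s a :=
        memCount_succ_of_notMem (s := fun j => ¬ s j) (not_not.mpr h)
      by_cases hk' : k = memCount s (a + 1)
      · exact ⟨a + 1, le_rfl, by rw [stairExp, if_pos h, hk']⟩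
      · obtain ⟨d, hd, e⟩ := ih ⟨by omega, by omega⟩
        exact ⟨d, by omega, e⟩
    · have h1 := memCount_succ_of_notMem h
      have h2 : notMemCount s (a + 1) = notMemCount s a + 1 :=
        memCount_succ_of_mem (s := fun j => ¬ s j) h
      by_cases hk' : k = -(notMemCount s (a + 1) : ℤ)
      · exact ⟨a + 1, le_rfl, by rw [stairExp, if_neg h, hk']⟩
      · obtain ⟨d, hd, e⟩ := ih ⟨by omega, by omega⟩
        exact ⟨d, by omega, e⟩

/-- The span of the first rows of the powers of `Y` with exponents in `S`. -/
def rowSpan (Y : TodaMat n) (S : Set ℤ) : Submodule ℝ (Fin (n + 1) → ℝ) :=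
  Submodule.span ℝ ((fun k : ℤ => (Y ^ k) 0) '' S)

theorem rowSpan_mono {Y : TodaMat n} {S T : Set ℤ} (h : S ⊆ T) : rowSpan Y S ≤ rowSpan Y T :=
  Submodule.span_mono (image_mono h)

theorem vecMul_mem_rowSpan {Y : TodaMat n} (hY : IsUnit Y.det) {S T : Set ℤ} {e : ℤ}
    (h : ∀ k ∈ S, k + e ∈ T) {v : Fin (n + 1) → ℝ} (hv : v ∈ rowSpan Y S) :
    v ᵥ* Y ^ e ∈ rowSpan Y T := by
  induction hv using Submodule.span_induction with
  | mem x hx =>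
    obtain ⟨k, hk, rfl⟩ := hx
    refine Submodule.subset_span ⟨k + e, h k hk, ?_⟩
    funext d
    simp only [Matrix.zpow_add hY, Matrix.mul_apply, vecMul, dotProduct]
  | zero => rw [zero_vecMul]; exact zero_mem _
  | add x y _ _ hx hy => rw [add_vecMul]; exact add_mem hx hy
  | smul c x _ hx => rw [smul_vecMul]; exact Submodule.smul_mem _ _ hx

theorem mem_of_single_mem {V : Submodule ℝ (Fin (n + 1) → ℝ)} {c : ℕ}
    (h : ∀ d : Fin (n + 1), (d : ℕ) < c → Pi.single d 1 ∈ V) {w : Fin (n + 1) → ℝ}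
    (hw : ∀ d : Fin (n + 1), c ≤ (d : ℕ) → w d = 0) : w ∈ V := by
  have e : w = ∑ d, w d • (Pi.single d 1 : Fin (n + 1) → ℝ) := by
    funext x
    simp [Finset.sum_apply, Pi.single_apply]
  rw [e]
  refine Submodule.sum_mem _ fun d _ => ?_
  rcases lt_or_ge (d : ℕ) c with hd | hd
  · exact Submodule.smul_mem _ _ (h d hd)
  · rw [hw d hd, zero_smul]; exact zero_mem _

/-- If d = a + 1 is in the index set, some earlier row of Y ends at column d with a nonzero entry;
that row is e_x^T Y and yields e_d modulo earlier unit vectors. If not, row d minus a multiple κ of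
an earlier row x is supported before column d; applying Y⁻¹ to it gives e_d - κ e_x. Thus each step
costs one more positive or one more negative power of Y. -/
theorem IsStaircase.single_mem {s : ℕ → Prop} {Y : TodaMat n} (hs : IsStaircase s Y)
    (hY : IsUnit Y.det) (a : ℕ) : ∀ d : Fin (n + 1), (d : ℕ) ≤ a →
      Pi.single d 1 ∈ rowSpan Y (Set.Icc (-(notMemCount s a : ℤ)) (memCount s a)) := by
  induction a with
  | zero =>
    intro d hd
    refine Submodule.subset_span ⟨0, by simp, ?_⟩
    have : d = 0 := Fin.ext (by simpa using hd)
    subst this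
    funext x
    simp [Matrix.one_apply, Pi.single_apply, eq_comm]
  | succ a ih =>
    set V := rowSpan Y (Set.Icc (-(notMemCount s a : ℤ)) (memCount s a)) with hV
    set V' := rowSpan Y (Set.Icc (-(notMemCount s (a + 1) : ℤ)) (memCount s (a + 1))) with hV'
    have hsub : V ≤ V' ∧ ((s (a + 1) → ∀ v ∈ V, v ᵥ* Y ∈ V') ∧
        (¬ s (a + 1) → ∀ v ∈ V, v ᵥ* Y⁻¹ ∈ V')) := by
      by_cases h : s (a + 1)
      · have h1 := memCount_succ_of_mem h
        have h2 : notMemCount s (a + 1) = notMemCount s a :=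
          memCount_succ_of_notMem (s := fun j => ¬ s j) (not_not.mpr h)
        refine ⟨rowSpan_mono (Set.Icc_subset_Icc (by omega) (by omega)),
          fun _ v hv => ?_, fun h' => absurd h h'⟩
        rw [← zpow_one Y]
        refine vecMul_mem_rowSpan hY (fun k hk => ?_) hv
        rw [Set.mem_Icc] at hk ⊢
        omega
      · have h1 := memCount_succ_of_notMem h
        have h2 : notMemCount s (a + 1) = notMemCount s a + 1 :=
          memCount_succ_of_mem (s := fun j => ¬ s j) h
        refine ⟨rowSpan_mono (Set.Icc_subset_Icc (by omega) (by omega)),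
          fun h' => absurd h' h, fun _ v hv => ?_⟩
        rw [← Matrix.zpow_neg_one Y]
        refine vecMul_mem_rowSpan hY (fun k hk => ?_) hv
        rw [Set.mem_Icc] at hk ⊢
        omega
    intro d hd
    rcases Nat.lt_or_eq_of_le hd with hd | hd
    · exact hsub.1 (ih d (by omega))
    have hlt : ∀ x : Fin (n + 1), (x : ℕ) < a + 1 → (Pi.single x 1 : Fin (n + 1) → ℝ) ∈ V' :=
      fun x hx => hsub.1 (ih x (by omega))
    have hd0 : d ≠ 0 := fun h => by simp [h] at hd
    by_cases h : s (a + 1)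
    · obtain ⟨x, hxd, hne, h0⟩ := hs.of_mem d hd0 (hd ▸ h)
      have h1 := hsub.2.1 h _ (ih x (by omega))
      rw [single_one_vecMul] at h1
      have h2 : Y x - Y x d • Pi.single d 1 ∈ V' := by
        refine mem_of_single_mem hlt fun y hy => ?_
        rcases Nat.lt_or_eq_of_le hy with hy | hy
        · have hdy : d < y := by omega
          simp [h0 y hdy, hdy.ne']
        · have : y = d := Fin.ext (by omega)
          simp [this]
      have h3 := V'.sub_mem h1 h2
      rw [show Y.row x - (Y x - Y x d • Pi.single d 1) = Y x d • (Pi.single d 1 : Fin (n + 1) → ℝ)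
        from sub_sub_cancel _ _] at h3
      exact (Submodule.smul_mem_iff _ hne).mp h3
    · obtain ⟨x, hxd, κ, h0⟩ := hs.of_notMem d hd0 (hd ▸ h)
      have h2 : Y d - κ • Y x ∈ V := by
        refine mem_of_single_mem (c := a + 1) (fun y hy => ih y (by omega)) fun y hy => ?_
        rw [Pi.sub_apply, Pi.smul_apply, smul_eq_mul, h0 y (by omega), sub_self]
      have h1 := hsub.2.2 h _ h2
      have e : (Y d - κ • Y x) ᵥ* Y⁻¹ =
          Pi.single d 1 - κ • (Pi.single x 1 : Fin (n + 1) → ℝ) := by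
        have e1 : (Y d - κ • Y x) = (Pi.single d 1 - κ • (Pi.single x 1 : Fin (n + 1) → ℝ)) ᵥ* Y := by
          rw [sub_vecMul, smul_vecMul, single_one_vecMul, single_one_vecMul]
          rfl
        rw [e1, vecMul_vecMul, Matrix.mul_nonsing_inv _ hY, vecMul_one]
      rw [e] at h1
      have := V'.add_mem h1 (V'.smul_mem κ (hlt x (by omega)))
      rwa [sub_add_cancel] at this

/-- The first rows of powers of `Y`, in the order in which they extend the flag. -/
noncomputable def stairRows (s : ℕ → Prop) (Y : TodaMat n) : TodaMat n :=
  Matrix.of fun a d => (Y ^ stairExp s a) 0 d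

theorem IsStaircase.stairRows_lower {s : ℕ → Prop} {Y : TodaMat n} (hs : IsStaircase s Y)
    (hY : IsUnit Y.det) : IsLower (stairRows s Y) ∧ ∀ a, stairRows s Y a a ≠ 0 := by
  have h : ∀ a : Fin (n + 1), ∃ t : Fin (n + 1) → ℝ, (∀ d, a < d → t d = 0) ∧
      t ᵥ* stairRows s Y = Pi.single a 1 := by
    intro a
    have h1 := hs.single_mem hY a a le_rfl
    suffices H : ∀ v ∈ rowSpan Y (Set.Icc (-(notMemCount s a : ℤ)) (memCount s a)),
        ∃ t : Fin (n + 1) → ℝ, (∀ d, a < d → t d = 0) ∧ t ᵥ* stairRows s Y = v from H _ h1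
    intro v hv
    induction hv using Submodule.span_induction with
    | mem x hx =>
      obtain ⟨k, hk, rfl⟩ := hx
      obtain ⟨d, hd, e⟩ := exists_stairExp_eq s a hk
      refine ⟨Pi.single ⟨d, by omega⟩ 1, fun y hy => ?_, ?_⟩
      · rw [Pi.single_eq_of_ne]
        intro h
        rw [h, Fin.lt_def] at hy
        simp only at hy
        omega
      · rw [single_one_vecMul, ← e]
        rfl
    | zero => exact ⟨0, fun _ _ => rfl, zero_vecMul _⟩
    | add x y _ _ hx hy =>
      obtain ⟨t, ht, rfl⟩ := hx
      obtain ⟨u, hu, rfl⟩ := hy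
      exact ⟨t + u, fun d hd => by simp [ht d hd, hu d hd], add_vecMul _ _ _⟩
    | smul c x _ hx =>
      obtain ⟨t, ht, rfl⟩ := hx
      exact ⟨c • t, fun d hd => by simp [ht d hd], smul_vecMul _ _ _⟩
  choose t ht htG using h
  -- The coefficients that express unit vectors through the rows form a lower triangular left
  -- inverse, so the matrix of rows is itself lower triangular with nonzero diagonal.
  have hT : (Matrix.of t : TodaMat n) * stairRows s Y = 1 := by
    ext a d
    have := congrFun (htG a) d
    rw [Matrix.one_apply, Matrix.mul_apply]
    rw [Pi.single_apply] at this
    simpa [vecMul, dotProduct, eq_comm] using this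
  have hTl : IsLower (Matrix.of t : TodaMat n) := fun a d had => ht a d had
  have hTu : IsUnit (Matrix.of t : TodaMat n).det := by
    have := congrArg Matrix.det hT
    rw [Matrix.det_mul, Matrix.det_one] at this
    exact IsUnit.of_mul_eq_one _ this
  have hG : stairRows s Y = (Matrix.of t : TodaMat n)⁻¹ := (Matrix.inv_eq_right_inv hT).symm
  have hGl : IsLower (stairRows s Y) := hG ▸ hTl.inv hTu
  refine ⟨hGl, fun a => hGl.diag_ne_zero ?_ a⟩
  rw [hG]
  exact Matrix.isUnit_nonsing_inv_det _ hTu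

end Staircase

/-! ### The coadjoint orbits have staircase shape. -/

section OrbitShape

open Finset Matrix

variable {n r : ℕ}

theorem mul_indexMat_mul_apply (i : Fin (r + 1) → Fin (n + 1)) (b c : TodaMat n)
    (a d : Fin (n + 1)) :
    (b * indexMat i * c) a d = ∑ l : Fin r, b a (i l.castSucc) * c (i l.succ) d := by
  rw [indexMat, mul_sum, sum_mul, Matrix.sum_apply]
  refine sum_congr rfl fun l _ => ?_
  rw [Matrix.mul_apply, sum_eq_single (i l.succ)]
  · rw [Matrix.mul_single_apply_same, mul_one]
  · intro x _ hx
    rw [Matrix.mul_single_apply_of_ne _ _ _ _ _ hx, zero_mul]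
  · simp

/-- The matrix `X` with its trace removed. -/
noncomputable def tracelessPart (X : TodaMat n) : TodaMat n :=
  X - (X.trace / (n + 1)) • (1 : TodaMat n)

theorem upperPart_trace (A : TodaMat n) : (upperPart A).trace = A.trace := by
  simp [Matrix.trace, upperPart]

theorem subdiagJ_trace : (subdiagJ n).trace = 0 := by
  simp [Matrix.trace, subdiagJ]

theorem upperPart_smul_one (ν : ℝ) : upperPart (ν • (1 : TodaMat n)) = ν • 1 := by
  ext a b
  simp only [upperPart, Matrix.of_apply, Matrix.smul_apply, Matrix.one_apply]
  split_ifs with h1 h2 h2 <;> simp_all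

theorem indexMat_trace {i : Fin (r + 1) → Fin (n + 1)} (hi : StrictMono i) :
    (indexMat i).trace = 0 := by
  rw [indexMat, Matrix.trace_sum]
  refine sum_eq_zero fun l _ => ?_
  rw [Matrix.trace_single_eq_of_ne]
  exact (hi l.castSucc_lt_succ).ne

theorem conj_add_smul_one {b : TodaMat n} (hu : IsUnit b.det) (A : TodaMat n) (ν : ℝ) :
    b * (A + ν • 1) * b⁻¹ = b * A * b⁻¹ + ν • 1 := by
  rw [mul_add, add_mul, mul_smul_comm, mul_one, smul_mul_assoc, Matrix.mul_nonsing_inv _ hu]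

theorem trace_conj {b : TodaMat n} (hu : IsUnit b.det) (A : TodaMat n) :
    (b * A * b⁻¹).trace = A.trace := by
  rw [Matrix.trace_mul_comm, ← mul_assoc, Matrix.nonsing_inv_mul _ hu, one_mul]

/-- J and the conjugates of X_I have trace zero, so the trace alone detects ν. Subtracting it gives
the corresponding point with ν = 0, and the trace is known from p. -/
theorem tracelessPart_orbit {i : Fin (r + 1) → Fin (n + 1)} (hi : StrictMono i) {b : TodaMat n}
    (hu : IsUnit b.det) (ν : ℝ) :
    tracelessPart (subdiagJ n + upperPart (b * (indexMat i + ν • 1) * b⁻¹)) =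
      subdiagJ n + upperPart (b * indexMat i * b⁻¹) := by
  have ht : (subdiagJ n + upperPart (b * (indexMat i + ν • 1) * b⁻¹)).trace = (n + 1) * ν := by
    rw [Matrix.trace_add, subdiagJ_trace, upperPart_trace, trace_conj hu, Matrix.trace_add,
      indexMat_trace hi, Matrix.trace_smul, Matrix.trace_one]
    simp [mul_comm]
  have hn : (n : ℝ) + 1 ≠ 0 := by positivity
  rw [tracelessPart, ht, mul_div_cancel_left₀ _ hn, conj_add_smul_one hu, upperPart_add,
    upperPart_smul_one]
  abel

/-- The index set, as a predicate on natural numbers. -/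
def IsIndex (i : Fin (r + 1) → Fin (n + 1)) (a : ℕ) : Prop := ∃ j, (i j : ℕ) = a

theorem exists_block {i : Fin (r + 1) → Fin (n + 1)} (h0 : i 0 = 0)
    (hl : i (Fin.last r) = Fin.last n) {a : Fin (n + 1)} (ha : a ≠ 0) :
    ∃ l : Fin r, i l.castSucc < a ∧ a ≤ i l.succ := by
  have h : ∀ k : Fin (r + 1), a ≤ i k → ∃ l : Fin r, i l.castSucc < a ∧ a ≤ i l.succ := by
    intro k
    induction k using Fin.induction with
    | zero =>
      intro h
      rw [h0] at h
      exact absurd (le_antisymm h (Fin.zero_le a)) ha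
    | succ l ih =>
      intro h
      by_cases h' : a ≤ i l.castSucc
      · exact ih h'
      · exact ⟨l, not_le.mp h', h⟩
  exact h (Fin.last r) (hl ▸ Fin.le_last a)

theorem isStaircase_orbit {i : Fin (r + 1) → Fin (n + 1)} (hi : StrictMono i) (h0 : i 0 = 0)
    (hl : i (Fin.last r) = Fin.last n) {b : TodaMat n} (hb : IsLower b) (hu : IsUnit b.det) :
    IsStaircase (IsIndex i) (subdiagJ n + upperPart (b * indexMat i * b⁻¹)) := by
  have hc := hb.inv hu
  have hcu := Matrix.isUnit_nonsing_inv_det _ hu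
  set c := b⁻¹
  have entry : ∀ a d : Fin (n + 1), a ≤ d → (subdiagJ n + upperPart (b * indexMat i * c)) a d =
      ∑ l : Fin r, b a (i l.castSucc) * c (i l.succ) d := by
    intro a d had
    rw [Matrix.add_apply, upperPart, Matrix.of_apply, if_pos had, mul_indexMat_mul_apply]
    rw [subdiagJ, Matrix.of_apply, if_neg, zero_add]
    rw [Fin.le_def] at had
    omega
  -- Within the block between consecutive indices the triangularity of b and of b⁻¹ kills all other
  -- terms. The block is a product of a column and a row, which gives both the nonzero corner and
  -- the proportional rows.
  have one_term : ∀ (l : Fin r) (a d : Fin (n + 1)), a ≤ d → a < i l.succ → i l.castSucc < d →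
      (subdiagJ n + upperPart (b * indexMat i * c)) a d =
        b a (i l.castSucc) * c (i l.succ) d := by
    intro l a d had hal hld
    rw [entry a d had]
    refine sum_eq_single l (fun k _ hk => ?_) (by simp)
    rcases lt_or_gt_of_ne hk with hk | hk
    · rw [hc _ d, mul_zero]
      refine lt_of_le_of_lt (hi.monotone ?_) hld
      rw [Fin.le_def, Fin.val_succ, Fin.val_castSucc]
      exact hk
    · rw [hb a, zero_mul]
      refine lt_of_lt_of_le hal (hi.monotone ?_)
      rw [Fin.le_def, Fin.val_succ, Fin.val_castSucc]
      exact hk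
  refine ⟨fun d hd hs => ?_, fun d hd hs => ?_⟩
  · obtain ⟨l, hld, hdl⟩ := exists_block h0 hl hd
    have hdl : d = i l.succ := by
      obtain ⟨k, hk⟩ := hs
      have hk : i k = d := Fin.ext hk
      rw [← hk] at hld hdl ⊢
      have h1 := hi.lt_iff_lt.mp hld
      have h2 := hi.le_iff_le.mp hdl
      congr 1
      rw [Fin.lt_def, Fin.val_castSucc] at h1
      rw [Fin.le_def, Fin.val_succ] at h2
      exact Fin.ext (by rw [Fin.val_succ]; omega)
    refine ⟨i l.castSucc, hld, ?_, fun e hde => ?_⟩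
    · rw [one_term l _ _ hld.le (hi l.castSucc_lt_succ) hld, hdl]
      exact mul_ne_zero (hb.diag_ne_zero hu _) (hc.diag_ne_zero hcu _)
    · rw [one_term l _ _ (hld.trans hde).le (hi l.castSucc_lt_succ) (hld.trans hde),
        hc _ _ (hdl ▸ hde), mul_zero]
  · obtain ⟨l, hld, hdl⟩ := exists_block h0 hl hd
    have hdl : d < i l.succ := by
      refine lt_of_le_of_ne hdl fun h => hs ⟨l.succ, ?_⟩
      rw [h]
    refine ⟨i l.castSucc, hld, b d (i l.castSucc) / b (i l.castSucc) (i l.castSucc),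
      fun e hde => ?_⟩
    rw [one_term l _ _ hde hdl (hld.trans_le hde),
      one_term l _ _ (hld.le.trans hde) (hi l.castSucc_lt_succ) (hld.trans_le hde)]
    have := hb.diag_ne_zero hu (i l.castSucc)
    field_simp

end OrbitShape

/-! ### Rational functions of the Weyl function -/

section Rational

open Finset Matrix

variable {n : ℕ}

/-- `g` is on `U` a rational function of the coefficients of the Weyl function. -/
def IsRationalOn (U : Set (TodaMat n)) (g : TodaMat n → ℝ) : Prop :=
  ∃ P Q : MvPolynomial (Fin (n + 1) ⊕ Fin n) ℝ, ∀ X ∈ U,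
    MvPolynomial.eval (ratCoords (weylMap X)) Q ≠ 0 ∧
      g X = MvPolynomial.eval (ratCoords (weylMap X)) P /
        MvPolynomial.eval (ratCoords (weylMap X)) Q

variable {U : Set (TodaMat n)} {f g : TodaMat n → ℝ}

theorem IsRationalOn.congr (hf : IsRationalOn U f) (h : ∀ X ∈ U, g X = f X) : IsRationalOn U g := by
  obtain ⟨P, Q, H⟩ := hf
  exact ⟨P, Q, fun X hX => ⟨(H X hX).1, (h X hX).trans (H X hX).2⟩⟩

theorem isRationalOn_eval (P : MvPolynomial (Fin (n + 1) ⊕ Fin n) ℝ) :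
    IsRationalOn U fun X => MvPolynomial.eval (ratCoords (weylMap X)) P :=
  ⟨P, 1, fun X _ => by simp⟩

theorem isRationalOn_const (c : ℝ) : IsRationalOn U fun _ => c :=
  (isRationalOn_eval (MvPolynomial.C c)).congr fun X _ => by simp

theorem isRationalOn_fst (j : Fin (n + 1)) : IsRationalOn U fun X => (weylMap X).1 j :=
  (isRationalOn_eval (MvPolynomial.X (Sum.inl j))).congr fun X _ => by simp [ratCoords]

theorem isRationalOn_snd (j : Fin n) : IsRationalOn U fun X => (weylMap X).2 j :=
  (isRationalOn_eval (MvPolynomial.X (Sum.inr j))).congr fun X _ => by simp [ratCoords]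

theorem IsRationalOn.add (hf : IsRationalOn U f) (hg : IsRationalOn U g) :
    IsRationalOn U fun X => f X + g X := by
  obtain ⟨P, Q, H⟩ := hf
  obtain ⟨P', Q', H'⟩ := hg
  refine ⟨P * Q' + Q * P', Q * Q', fun X hX => ?_⟩
  obtain ⟨h1, h2⟩ := H X hX
  obtain ⟨h3, h4⟩ := H' X hX
  refine ⟨by simp [h1, h3], ?_⟩
  beta_reduce
  rw [h2, h4, div_add_div _ _ h1 h3]
  simp

theorem IsRationalOn.mul (hf : IsRationalOn U f) (hg : IsRationalOn U g) :
    IsRationalOn U fun X => f X * g X := by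
  obtain ⟨P, Q, H⟩ := hf
  obtain ⟨P', Q', H'⟩ := hg
  refine ⟨P * P', Q * Q', fun X hX => ?_⟩
  obtain ⟨h1, h2⟩ := H X hX
  obtain ⟨h3, h4⟩ := H' X hX
  refine ⟨by simp [h1, h3], ?_⟩
  beta_reduce
  rw [h2, h4, div_mul_div_comm]
  simp

theorem IsRationalOn.neg (hf : IsRationalOn U f) : IsRationalOn U fun X => -f X :=
  ((isRationalOn_const (-1)).mul hf).congr fun X _ => by ring

theorem IsRationalOn.sub (hf : IsRationalOn U f) (hg : IsRationalOn U g) :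
    IsRationalOn U fun X => f X - g X :=
  (hf.add hg.neg).congr fun X _ => by ring

theorem IsRationalOn.inv (hf : IsRationalOn U f) (h : ∀ X ∈ U, f X ≠ 0) :
    IsRationalOn U fun X => (f X)⁻¹ := by
  obtain ⟨P, Q, H⟩ := hf
  refine ⟨Q, P, fun X hX => ?_⟩
  obtain ⟨h1, h2⟩ := H X hX
  have h3 := h X hX
  rw [h2] at h3
  exact ⟨fun h4 => h3 (by rw [h4, zero_div]), by beta_reduce; rw [h2, inv_div]⟩

theorem IsRationalOn.sum {ι : Type*} (s : Finset ι) {F : ι → TodaMat n → ℝ}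
    (h : ∀ a ∈ s, IsRationalOn U (F a)) : IsRationalOn U fun X => ∑ a ∈ s, F a X := by
  classical
  induction s using Finset.induction_on with
  | empty => simpa using isRationalOn_const 0
  | insert a s ha ih =>
    simp only [sum_insert ha]
    exact (h a (mem_insert_self a s)).add (ih fun b hb => h b (mem_insert_of_mem hb))

theorem IsRationalOn.prod {ι : Type*} (s : Finset ι) {F : ι → TodaMat n → ℝ}
    (h : ∀ a ∈ s, IsRationalOn U (F a)) : IsRationalOn U fun X => ∏ a ∈ s, F a X := by
  classical
  induction s using Finset.induction_on with
  | empty => simpa using isRationalOn_const 1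
  | insert a s ha ih =>
    simp only [prod_insert ha]
    exact (h a (mem_insert_self a s)).mul (ih fun b hb => h b (mem_insert_of_mem hb))

/-- A finite family of rational functions has a common denominator. -/
theorem exists_common_denominator {ι : Type*} [Fintype ι] {F : ι → TodaMat n → ℝ}
    (h : ∀ a, IsRationalOn U (F a)) :
    ∃ (P : ι → MvPolynomial (Fin (n + 1) ⊕ Fin n) ℝ) (Q : MvPolynomial (Fin (n + 1) ⊕ Fin n) ℝ),
      ∀ X ∈ U, MvPolynomial.eval (ratCoords (weylMap X)) Q ≠ 0 ∧
        ∀ a, F a X = MvPolynomial.eval (ratCoords (weylMap X)) (P a) /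
          MvPolynomial.eval (ratCoords (weylMap X)) Q := by
  classical
  choose P Q H using h
  refine ⟨fun a => P a * ∏ b ∈ univ.erase a, Q b, ∏ b, Q b, fun X hX => ?_⟩
  have hne : ∀ b, MvPolynomial.eval (ratCoords (weylMap X)) (Q b) ≠ 0 := fun b => (H b X hX).1
  refine ⟨?_, fun a => ?_⟩
  · rw [map_prod]
    exact prod_ne_zero_iff.mpr fun b _ => hne b
  · rw [(H a X hX).2, ← mul_prod_erase univ Q (mem_univ a), map_mul, map_mul,
      mul_div_mul_right]
    rw [map_prod]
    exact prod_ne_zero_iff.mpr fun b _ => hne b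

/-! ### Matrices of rational functions -/

/-- All entries are rational functions of the coefficients of the Weyl function. -/
def IsRationalMatOn {ι κ : Type*} (U : Set (TodaMat n)) (A : TodaMat n → Matrix ι κ ℝ) : Prop :=
  ∀ a b, IsRationalOn U fun X => A X a b

theorem IsRationalMatOn.mul {ι κ μ : Type*} [Fintype κ] {A : TodaMat n → Matrix ι κ ℝ}
    {B : TodaMat n → Matrix κ μ ℝ} (hA : IsRationalMatOn U A) (hB : IsRationalMatOn U B) :
    IsRationalMatOn U fun X => A X * B X := by
  intro a b
  simp only [Matrix.mul_apply]
  exact IsRationalOn.sum _ fun c _ => (hA a c).mul (hB c b)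

variable {ι : Type*} [Fintype ι] [DecidableEq ι] {A : TodaMat n → Matrix ι ι ℝ}

theorem IsRationalMatOn.pow (hA : IsRationalMatOn U A) (k : ℕ) :
    IsRationalMatOn U fun X => A X ^ k := by
  induction k with
  | zero => intro a b; simpa only [pow_zero] using isRationalOn_const _
  | succ k ih => simpa only [pow_succ] using ih.mul hA

theorem IsRationalMatOn.det (hA : IsRationalMatOn U A) : IsRationalOn U fun X => (A X).det := by
  simp only [Matrix.det_apply']
  exact IsRationalOn.sum _ fun σ _ => (isRationalOn_const _).mul
    (IsRationalOn.prod _ fun a _ => hA _ _)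

theorem IsRationalMatOn.inv (hA : IsRationalMatOn U A) (h : ∀ X ∈ U, (A X).det ≠ 0) :
    IsRationalMatOn U fun X => (A X)⁻¹ := by
  intro a b
  simp only [Matrix.inv_def, Matrix.smul_apply, Ring.inverse_eq_inv', smul_eq_mul,
    Matrix.adjugate_apply]
  refine (hA.det.inv h).mul (IsRationalMatOn.det fun c d => ?_)
  simp only [Matrix.updateRow_apply]
  split_ifs
  · exact isRationalOn_const _
  · exact hA _ _

theorem IsRationalMatOn.zpow (hA : IsRationalMatOn U A) (h : ∀ X ∈ U, (A X).det ≠ 0) (k : ℤ) :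
    IsRationalMatOn U fun X => A X ^ k := by
  obtain ⟨k, rfl | rfl⟩ := k.eq_nat_or_neg
  · simpa only [zpow_natCast] using hA.pow k
  · simpa only [Matrix.zpow_neg_natCast, ← Matrix.inv_pow'] using (hA.inv h).pow k

theorem isRationalMatOn_companion : IsRationalMatOn U fun X => companion (weylMap X).1 := by
  intro a b
  refine Fin.lastCases ?_ (fun b => ?_) b
  · simp only [companion_apply_last]
    exact (isRationalOn_fst a).neg
  · simp only [companion_apply_castSucc]
    exact isRationalOn_const _

theorem isRationalOn_moment (k : ℕ) : IsRationalOn U fun X => (X ^ k) 0 0 := by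
  simp only [pow_apply_zero_zero, mulVec, dotProduct]
  refine IsRationalOn.sum _ fun c _ => (isRationalMatOn_companion.pow k _ _).mul ?_
  refine Fin.lastCases ?_ (fun c => ?_) c
  · simpa [monicVec] using isRationalOn_const 1
  · simpa [monicVec] using isRationalOn_snd c

theorem isRationalOn_trace : IsRationalOn U fun X => X.trace := by
  refine (isRationalOn_fst (Fin.last n)).neg.congr fun X _ => ?_
  rw [Matrix.trace_eq_neg_charpoly_coeff]
  simp [weylMap]

/-- The companion matrix with the trace removed. -/
theorem isRationalMatOn_companion_sub : IsRationalMatOn U fun X =>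
    companion (weylMap X).1 - (X.trace / (n + 1)) • (1 : TodaMat n) := by
  intro a b
  simp only [Matrix.sub_apply, Matrix.smul_apply, smul_eq_mul, div_eq_mul_inv]
  exact (isRationalMatOn_companion a b).sub
    ((isRationalOn_trace.mul (isRationalOn_const _)).mul (isRationalOn_const _))

theorem tracelessPart_eq_krylov_conj {X : TodaMat n} (h : IsHessenberg X) :
    tracelessPart X = krylov X *
      (companion (weylMap X).1 - (X.trace / (n + 1)) • (1 : TodaMat n)) * (krylov X)⁻¹ := by
  rw [tracelessPart, mul_sub, sub_mul, ← eq_krylov_conj h, mul_smul_comm, mul_one, smul_mul_assoc,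
    Matrix.mul_nonsing_inv _ h.isUnit_det_krylov]

theorem inv_krylov_mulVec {X : TodaMat n} (h : IsHessenberg X) (a : Fin (n + 1)) :
    (krylov X)⁻¹ a 0 = (1 : TodaMat n) a 0 := by
  have h1 := congrFun (congrFun (Matrix.nonsing_inv_mul _ h.isUnit_det_krylov) a) 0
  rw [← h1, Matrix.mul_apply, sum_eq_single 0]
  · simp [krylov]
  · intro b _ hb
    have : krylov X b 0 = 0 := by simp [krylov, Matrix.one_apply_ne hb]
    rw [this, mul_zero]
  · simp

/-- The products of a left and of a right Krylov vector are rational functions of the Weyl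
function. -/
theorem isRationalOn_zpow_mul_pow (hH : ∀ X ∈ U, IsHessenberg X)
    (hd : ∀ X ∈ U, (tracelessPart X).det ≠ 0) (k : ℤ) (b : ℕ) :
    IsRationalOn U fun X => (tracelessPart X ^ k * X ^ b) 0 0 := by
  set D : TodaMat n → TodaMat n := fun X =>
    companion (weylMap X).1 - (X.trace / (n + 1)) • (1 : TodaMat n) with hD
  -- Negative powers must be evaluated on the side of the companion matrix, where invertibility
  -- transfers by conjugation.
  have hDd : ∀ X ∈ U, (D X).det ≠ 0 := by
    intro X hX
    have h1 := hd X hX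
    rw [tracelessPart_eq_krylov_conj (hH X hX), Matrix.det_mul, Matrix.det_mul] at h1
    exact right_ne_zero_of_mul (left_ne_zero_of_mul h1)
  have hR := ((isRationalMatOn_companion_sub (U := U)).zpow hDd k).mul
    ((isRationalMatOn_companion (U := U)).pow b)
  refine (IsRationalOn.sum univ fun (c : Fin (n + 1)) _ =>
    (isRationalOn_moment (c : ℕ)).mul (hR c 0)).congr fun X hX => ?_
  have hK := (hH X hX).isUnit_det_krylov
  -- After conjugation by K only moments are needed: K⁻¹ fixes e_0, and the first row of K consists
  -- of moments.
  have e : tracelessPart X ^ k * X ^ b =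
      krylov X * (D X ^ k * companion (weylMap X).1 ^ b) * (krylov X)⁻¹ := by
    have e1 : X ^ b = krylov X * companion (weylMap X).1 ^ b * (krylov X)⁻¹ := by
      conv_lhs => rw [eq_krylov_conj (hH X hX)]
      exact matrix_conj_pow hK b
    rw [tracelessPart_eq_krylov_conj (hH X hX), matrix_conj_zpow hK, e1]
    simp only [mul_assoc]
    rw [Matrix.nonsing_inv_mul_cancel_left _ _ hK]
  rw [e, Matrix.mul_apply, sum_eq_single 0]
  · rw [inv_krylov_mulVec (hH X hX), Matrix.one_apply_eq, mul_one, Matrix.mul_apply]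
    rfl
  · intro c _ hc
    rw [inv_krylov_mulVec (hH X hX), Matrix.one_apply_ne hc, mul_zero]
  · simp

theorem sum_eq_sum_Iio_add (s : Fin (n + 1)) {F : Fin (n + 1) → ℝ} (h : ∀ d, s < d → F d = 0) :
    ∑ d, F d = ∑ d ∈ Finset.Iio s, F d + F s := by
  rw [← sum_subset (subset_univ (Finset.Iic s)) fun d _ hd => h d (by simpa using hd),
    ← Finset.Iio_insert, sum_insert (by simp), add_comm]

/-- The factors of a triangular factorization depend rationally on the product. -/
theorem isRationalOn_triangular {G : TodaMat n → TodaMat n}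
    {K : TodaMat n → Fin (n + 1) → ℕ → ℝ} (hG : ∀ X ∈ U, IsLower (G X))
    (hGd : ∀ X ∈ U, ∀ a, G X a a ≠ 0)
    (hK : ∀ X ∈ U, ∀ (a : Fin (n + 1)) (b : ℕ), b < a → K X a b = 0)
    (hKd : ∀ X ∈ U, ∀ a : Fin (n + 1), K X a a = 1)
    (hGK : ∀ a b, IsRationalOn U fun X => ∑ d, G X a d * K X d b) (s : Fin (n + 1)) :
    (∀ a, IsRationalOn U fun X => G X a s) ∧ ∀ b, IsRationalOn U fun X => K X s b := by
  induction s using WellFoundedLT.induction with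
  | ind s ih =>
    have h1 : ∀ a, IsRationalOn U fun X => G X a s := by
      intro a
      -- The pivot step of the factorization: contributions of earlier pivots are subtracted. Column
      -- s of G comes out directly because K has unit diagonal; row s of K then needs division by
      -- G_ss.
      refine ((hGK a s).sub (IsRationalOn.sum (Finset.Iio s) fun d hd =>
        ((ih d (Finset.mem_Iio.mp hd)).1 a).mul ((ih d (Finset.mem_Iio.mp hd)).2 s))).congr
        fun X hX => ?_
      rw [sum_eq_sum_Iio_add s fun d hd => by rw [hK X hX d s hd, mul_zero], hKd X hX, mul_one,
        add_sub_cancel_left]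
    refine ⟨h1, fun b => ?_⟩
    refine (((hGK s b).sub (IsRationalOn.sum (Finset.Iio s) fun d hd =>
      ((ih d (Finset.mem_Iio.mp hd)).1 s).mul ((ih d (Finset.mem_Iio.mp hd)).2 b))).mul
      ((h1 s).inv fun X hX => hGd X hX s)).congr fun X hX => ?_
    rw [sum_eq_sum_Iio_add s fun d hd => by rw [hG X hX s d hd, zero_mul], add_sub_cancel_left,
      mul_right_comm, mul_inv_cancel₀ (hGd X hX s), one_mul]

/-- The matrix entries are rational functions of the Weyl function. -/
theorem isRationalOn_apply (s : ℕ → Prop) (hH : ∀ X ∈ U, IsHessenberg X)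
    (hs : ∀ X ∈ U, IsStaircase s (tracelessPart X)) (hd : ∀ X ∈ U, (tracelessPart X).det ≠ 0)
    (a b : Fin (n + 1)) : IsRationalOn U fun X => X a b := by
  have hu : ∀ X ∈ U, IsUnit (tracelessPart X).det := fun X hX => isUnit_iff_ne_zero.mpr (hd X hX)
  have hK : ∀ (c : Fin (n + 1)) (k : ℕ), IsRationalOn U fun X => (X ^ k) c 0 := fun c =>
    (isRationalOn_triangular (G := fun X => stairRows s (tracelessPart X))
      (K := fun X c k => (X ^ k) c 0)
      (fun X hX => ((hs X hX).stairRows_lower (hu X hX)).1)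
      (fun X hX => ((hs X hX).stairRows_lower (hu X hX)).2)
      (fun X hX c k hk => ((hH X hX).pow_apply k).1 c hk)
      (fun X hX c => ((hH X hX).pow_apply c).2 c rfl)
      (fun c k => (isRationalOn_zpow_mul_pow hH hd (stairExp s c) k).congr fun X _ => by
        rw [Matrix.mul_apply]; rfl) c).2
  have hKm : IsRationalMatOn U (krylov (n := n)) := fun c k => hK c k
  -- With K known, X is recovered as K C K⁻¹.
  refine ((hKm.mul isRationalMatOn_companion).mul
    (hKm.inv fun X hX => (hH X hX).isUnit_det_krylov.ne_zero) a b).congr fun X hX => ?_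
  conv_lhs => rw [eq_krylov_conj (hH X hX)]

end Rational

/-! ### The domain of the inverse Moser map -/

section Domain

open Finset Matrix

variable {n r : ℕ}

/-- The set of those matrices of the orbit whose traceless part is invertible. -/
def moserDomain (i : Fin (r + 1) → Fin (n + 1)) : Set (TodaMat n) :=
  {X | (tracelessPart X).det ≠ 0} ∩ todaOrbit i

section Smooth

variable {E : Type*} [NormedAddCommGroup E] [NormedSpace ℝ E]

theorem contDiffAt_todaMat {F : E → TodaMat n} {x : E} :
    ContDiffAt ℝ ∞ F x ↔ ∀ i j, ContDiffAt ℝ ∞ (fun y => F y i j) x :=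
  contDiffAt_pi.trans (forall_congr' fun _ => contDiffAt_pi)

theorem contDiffAt_todaMat_mul {F G : E → TodaMat n} {x : E} (hF : ContDiffAt ℝ ∞ F x)
    (hG : ContDiffAt ℝ ∞ G x) : ContDiffAt ℝ ∞ (fun y => F y * G y) x := by
  rw [contDiffAt_todaMat] at *
  intro i j
  simp only [Matrix.mul_apply]
  exact ContDiffAt.sum fun k _ => (hF i k).mul (hG k j)

/-- The points of an orbit depend smoothly on their parameters. -/
theorem contDiffAt_orbit {B A : E → TodaMat n} (hB : ContDiff ℝ ∞ B) (hA : ContDiff ℝ ∞ A) {x : E}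
    (hx : (B x).det ≠ 0) :
    ContDiffAt ℝ ∞ (fun y => subdiagJ n + upperPart (B y * A y * (B y)⁻¹)) x := by
  have h1 : ContDiffAt ℝ ∞ (fun y => (B y)⁻¹) x :=
    contDiffAt_todaMat.mpr fun a b => contDiffAt_matrix_inv (contDiff_matrix.mp hB) hx a b
  have h2 : ContDiffAt ℝ ∞ (fun y => B y * A y * (B y)⁻¹) x :=
    contDiffAt_todaMat_mul (contDiffAt_todaMat_mul hB.contDiffAt hA.contDiffAt) h1
  exact (contDiff_const.add (contDiff_id.upperPart)).contDiffAt.comp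
    (g := fun M : TodaMat n => subdiagJ n + upperPart M) x h2

end Smooth

theorem contDiff_tracelessPart : ContDiff ℝ ∞ (tracelessPart (n := n)) := by
  have h : ContDiff ℝ ∞ fun X : TodaMat n => X.trace := by
    simp only [Matrix.trace, Matrix.diag]
    exact ContDiff.sum fun i _ => contDiff_todaMat_apply i i
  unfold tracelessPart
  exact contDiff_id.sub ((h.div_const _).smul contDiff_const)

theorem isOpen_det_tracelessPart : IsOpen {X : TodaMat n | (tracelessPart X).det ≠ 0} :=
  isOpen_ne_fun (contDiff_det (contDiff_matrix.mp contDiff_tracelessPart)).continuous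
    continuous_const

/-! ### Points with invertible traceless part -/

theorem sum_Iio_val (a : Fin (n + 1)) (f : ℕ → ℝ) :
    ∑ k ∈ Finset.Iio a, f k = ∑ k ∈ range (a : ℕ), f k := by
  rw [← Nat.Iio_eq_range, ← Fin.map_valEmbedding_Iio, sum_map]
  rfl

/-- A lower triangular matrix whose conjugates of the index matrices have no zero on the
diagonal. -/
noncomputable def genericLower (n : ℕ) : TodaMat n :=
  Matrix.of fun a c => if a = c then (a : ℝ) + 1 else if c < a then -1 else 0

/-- The inverse of `genericLower n`. -/
noncomputable def genericLowerInv (n : ℕ) : TodaMat n :=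
  Matrix.of fun a c => if a = c then ((a : ℝ) + 1)⁻¹ else
    if c < a then ((c : ℝ) + 1)⁻¹ * ((c : ℝ) + 2)⁻¹ else 0

theorem isLower_genericLower : IsLower (genericLower n) := fun a c h => by
  simp [genericLower, h.ne, h.not_gt]

theorem genericLower_mul_inv : genericLower n * genericLowerInv n = 1 := by
  ext a d
  rw [Matrix.mul_apply, sum_eq_sum_Iio_add a fun k hk => by
    rw [isLower_genericLower a k hk, zero_mul]]
  set f : ℕ → ℝ := fun k => if k = d then ((d : ℝ) + 1)⁻¹ else
    if (d : ℕ) < k then ((d : ℝ) + 1)⁻¹ * ((d : ℝ) + 2)⁻¹ else 0 with hf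
  have hv : ∀ k : Fin (n + 1), genericLowerInv n k d = f k := by
    intro k
    simp only [genericLowerInv, Matrix.of_apply, hf, Fin.ext_iff, Fin.lt_def]
    split_ifs with h
    · rw [h]
    · rfl
    · rfl
  have h1 : ∑ k ∈ Finset.Iio a, genericLower n a k * genericLowerInv n k d =
      -∑ k ∈ range (a : ℕ), f k := by
    rw [← sum_Iio_val, ← sum_neg_distrib]
    refine sum_congr rfl fun k hk => ?_
    have hka := Finset.mem_Iio.mp hk
    rw [hv, genericLower, Matrix.of_apply, if_neg hka.ne', if_pos hka, neg_one_mul]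
  -- The partial column sums of the inverse have a closed form, which exactly balances the diagonal
  -- entry a + 1 against the entries -1 before it.
  have h2 : ∀ m : ℕ, ∑ k ∈ range m, f k =
      if (d : ℕ) < m then ((m : ℝ) + 1) * (((d : ℝ) + 1)⁻¹ * ((d : ℝ) + 2)⁻¹) else 0 := by
    have hd1 : (d : ℝ) + 1 ≠ 0 := by positivity
    have hd2 : (d : ℝ) + 2 ≠ 0 := by positivity
    intro m
    induction m with
    | zero => simp
    | succ m ih =>
      rw [sum_range_succ, ih, hf]
      rcases lt_trichotomy m (d : ℕ) with h | h | h
      · rw [if_neg (by omega), if_neg (by omega)]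
        simp only [if_neg h.ne, if_neg h.not_gt, add_zero]
      · rw [if_neg (by omega), if_pos (by omega)]
        simp only [if_pos h, zero_add]
        rw [← h] at hd1 hd2 ⊢
        push_cast
        field_simp
        ring
      · rw [if_pos h, if_pos (by omega)]
        simp only [if_neg h.ne', if_pos h]
        push_cast
        ring
  rw [h1, h2, hv, genericLower, Matrix.of_apply, if_pos rfl, Matrix.one_apply]
  simp only [hf, Fin.ext_iff]
  rcases lt_trichotomy (a : ℕ) (d : ℕ) with h | h | h
  · simp [h.ne, h.not_gt]
  · have hd1 : (d : ℝ) + 1 ≠ 0 := by positivity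
    simp [h, hd1]
  · simp [h.ne', h]

theorem isUnit_det_genericLower : IsUnit (genericLower n).det := by
  have := congrArg Matrix.det (genericLower_mul_inv (n := n))
  rw [Matrix.det_mul, Matrix.det_one] at this
  exact IsUnit.of_mul_eq_one _ this

theorem Fin.sum_succ_sub_castSucc (h : Fin (r + 1) → ℝ) :
    ∑ l : Fin r, (h l.succ - h l.castSucc) = h (Fin.last r) - h 0 := by
  have h1 := Fin.sum_univ_succ h
  have h2 := Fin.sum_univ_castSucc h
  rw [sum_sub_distrib]
  linarith

theorem genericLower_conj_diag_ne_zero {i : Fin (r + 1) → Fin (n + 1)} (hr : 0 < r)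
    (hi : StrictMono i) (h0 : i 0 = 0) (hl : i (Fin.last r) = Fin.last n) (a : Fin (n + 1)) :
    (genericLower n * indexMat i * (genericLower n)⁻¹) a a ≠ 0 := by
  rw [Matrix.inv_eq_right_inv genericLower_mul_inv, mul_indexMat_mul_apply]
  have ha1 : (a : ℝ) + 1 ≠ 0 := by positivity
  have ha2 : (a : ℝ) + 2 ≠ 0 := by positivity
  -- A potential for the products of entries: each term of the diagonal entry is a difference of
  -- values of g at consecutive indices. The sum telescopes to g(n) - g(0), independently of the
  -- intermediate elements of I.
  set g : Fin (n + 1) → ℝ := fun x => if x < a then 0 else if x = a then -((a : ℝ) + 1)⁻¹ else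
    -(((a : ℝ) + 1)⁻¹ * ((a : ℝ) + 2)⁻¹) with hg
  have key : ∀ x y : Fin (n + 1), x < y →
      genericLower n a x * genericLowerInv n y a = g y - g x := by
    intro x y hxy
    simp only [genericLower, genericLowerInv, Matrix.of_apply, hg]
    rcases lt_trichotomy x a with hx | rfl | hx
    · rcases lt_trichotomy y a with hy | rfl | hy
      · simp [hx, hy, hx.ne', hy.ne, hy.not_gt]
      · simp [hx, hx.ne']
      · simp [hx, hx.ne', hy.ne', hy, hy.not_gt]
    · simp only [if_true, lt_irrefl, if_false, hxy.ne', hxy, hxy.not_gt]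
      field_simp
      ring
    · have hy := hx.trans hxy
      simp [hx.ne, hx.ne', hx.not_gt, hy.ne', hy.not_gt]
  rw [sum_congr rfl fun l _ => key _ _ (hi l.castSucc_lt_succ),
    Fin.sum_succ_sub_castSucc fun j => g (i j), h0, hl]
  have hlt : (0 : Fin (n + 1)) < Fin.last n := by
    rw [← h0, ← hl]
    exact hi (by rw [Fin.lt_def]; simpa using hr)
  simp only [hg]
  by_cases hz : a = 0
  · subst hz
    simp only [lt_irrefl, if_false, if_true, hlt.ne', hlt.not_gt]
    norm_num
  · have hz' : 0 < a := Fin.pos_iff_ne_zero.mpr hz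
    simp only [hz', if_true, sub_zero, (Fin.le_last a).not_gt, if_false]
    split_ifs
    · exact neg_ne_zero.mpr (inv_ne_zero ha1)
    · exact neg_ne_zero.mpr (mul_ne_zero (inv_ne_zero ha1) (inv_ne_zero ha2))

/-- At t = 0 the matrix is upper triangular with nonzero diagonal; invertibility persists for small
nonzero t. -/
theorem exists_det_add_upperPart_ne_zero {N : TodaMat n} (hN : ∀ a, N a a ≠ 0) :
    ∃ t : ℝ, t ≠ 0 ∧ (t • subdiagJ n + upperPart N).det ≠ 0 := by
  have hc : ContinuousAt (fun t : ℝ => (t • subdiagJ n + upperPart N).det) 0 := by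
    refine (contDiff_det fun a b => ?_).continuous.continuousAt
    simp only [Matrix.add_apply, Matrix.smul_apply, smul_eq_mul]
    fun_prop
  have h0 : ((0 : ℝ) • subdiagJ n + upperPart N).det ≠ 0 := by
    rw [zero_smul, zero_add, Matrix.det_of_isUpperTriangular, prod_ne_zero_iff]
    · intro a _
      simpa [upperPart] using hN a
    · intro a b hab
      simp only [upperPart, Matrix.of_apply]
      exact if_neg (not_le.mpr hab)
  have h1 := (hc.eventually_ne h0).filter_mono (nhdsWithin_le_nhds (s := {0}ᶜ))
  obtain ⟨t, ht, ht0⟩ := (h1.and self_mem_nhdsWithin).exists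
  exact ⟨t, ht0, ht⟩

/-- Conjugation by the diagonal matrix of powers of t turns t J into J, so the small parameter is
absorbed into the lower triangular factor. -/
theorem exists_orbit_det_ne_zero {i : Fin (r + 1) → Fin (n + 1)} (hr : 0 < r)
    (hi : StrictMono i) (h0 : i 0 = 0) (hl : i (Fin.last r) = Fin.last n) :
    ∃ b : TodaMat n, IsLower b ∧ IsUnit b.det ∧
      (subdiagJ n + upperPart (b * indexMat i * b⁻¹)).det ≠ 0 := by
  set w := genericLower n
  set N := w * indexMat i * w⁻¹ with hN
  obtain ⟨t, ht0, ht⟩ := exists_det_add_upperPart_ne_zero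
    (genericLower_conj_diag_ne_zero hr hi h0 hl)
  set D : TodaMat n := Matrix.diagonal fun a => t ^ (a : ℕ) with hD
  set D' : TodaMat n := Matrix.diagonal fun a => (t⁻¹) ^ (a : ℕ) with hD'
  have hDD : D' * D = 1 := by
    rw [hD, hD', Matrix.diagonal_mul_diagonal, ← Matrix.diagonal_one]
    congr 1
    funext a
    rw [← mul_pow, inv_mul_cancel₀ ht0, one_pow]
  have hDl : IsLower D' := fun a b h => Matrix.diagonal_apply_ne _ h.ne
  have hdet : D'.det * D.det = 1 := by rw [← Matrix.det_mul, hDD, Matrix.det_one]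
  have e : subdiagJ n + upperPart (D' * w * indexMat i * (D' * w)⁻¹) =
      D' * (t • subdiagJ n + upperPart N) * D := by
    rw [Matrix.mul_inv_rev, Matrix.inv_eq_right_inv hDD]
    have : D' * w * indexMat i * (w⁻¹ * D) = D' * N * D := by
      rw [hN]; simp only [mul_assoc]
    rw [this]
    ext a c
    rw [hD, Matrix.mul_diagonal, hD', Matrix.diagonal_mul]
    simp only [Matrix.add_apply, upperPart, Matrix.of_apply, Matrix.smul_apply, smul_eq_mul,
      subdiagJ, Matrix.mul_diagonal, Matrix.diagonal_mul, mul_add, add_mul]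
    congr 1
    · split_ifs with h
      · rw [h, inv_pow, pow_succ]
        field_simp
      · ring
    · split_ifs <;> ring
  refine ⟨D' * w, hDl.mul isLower_genericLower, ?_, ?_⟩
  · rw [Matrix.det_mul]
    exact (IsUnit.of_mul_eq_one _ hdet).mul isUnit_det_genericLower
  · rw [e, Matrix.det_mul, Matrix.det_mul, mul_right_comm, hdet, one_mul]
    exact ht

/-! ### Density -/

/-- Polynomial functions of one real variable. -/
def IsPolynomialFun (f : ℝ → ℝ) : Prop := ∃ P : Polynomial ℝ, ∀ s, f s = P.eval s

theorem isPolynomialFun_const (c : ℝ) : IsPolynomialFun fun _ => c := ⟨Polynomial.C c, by simp⟩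

theorem IsPolynomialFun.add {f g : ℝ → ℝ} (hf : IsPolynomialFun f) (hg : IsPolynomialFun g) :
    IsPolynomialFun fun s => f s + g s := by
  obtain ⟨P, hP⟩ := hf
  obtain ⟨Q, hQ⟩ := hg
  exact ⟨P + Q, fun s => by simp [hP, hQ]⟩

theorem IsPolynomialFun.mul {f g : ℝ → ℝ} (hf : IsPolynomialFun f) (hg : IsPolynomialFun g) :
    IsPolynomialFun fun s => f s * g s := by
  obtain ⟨P, hP⟩ := hf
  obtain ⟨Q, hQ⟩ := hg
  exact ⟨P * Q, fun s => by simp [hP, hQ]⟩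

theorem IsPolynomialFun.sum {ι : Type*} (t : Finset ι) {F : ι → ℝ → ℝ}
    (h : ∀ a ∈ t, IsPolynomialFun (F a)) : IsPolynomialFun fun s => ∑ a ∈ t, F a s := by
  choose! P hP using h
  exact ⟨∑ a ∈ t, P a, fun s => by
    rw [Polynomial.eval_finsetSum]; exact sum_congr rfl fun a ha => hP a ha s⟩

theorem IsPolynomialFun.prod {ι : Type*} (t : Finset ι) {F : ι → ℝ → ℝ}
    (h : ∀ a ∈ t, IsPolynomialFun (F a)) : IsPolynomialFun fun s => ∏ a ∈ t, F a s := by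
  choose! P hP using h
  exact ⟨∏ a ∈ t, P a, fun s => by
    rw [Polynomial.eval_prod]; exact prod_congr rfl fun a ha => hP a ha s⟩

theorem IsPolynomialFun.det {ι : Type*} [Fintype ι] [DecidableEq ι] {A : ℝ → Matrix ι ι ℝ}
    (h : ∀ a b, IsPolynomialFun fun s => A s a b) : IsPolynomialFun fun s => (A s).det := by
  simp only [Matrix.det_apply']
  exact IsPolynomialFun.sum _ fun σ _ => (isPolynomialFun_const _).mul
    (IsPolynomialFun.prod _ fun a _ => h _ _)

theorem IsPolynomialFun.eventually_ne {f : ℝ → ℝ} (hf : IsPolynomialFun f) {t : ℝ} (ht : f t ≠ 0)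
    (s : ℝ) : ∀ᶠ x in 𝓝[≠] s, f x ≠ 0 := by
  obtain ⟨P, hP⟩ := hf
  have hP0 : P ≠ 0 := by
    rintro rfl
    exact ht (by simp [hP])
  have hfin : ({x | f x = 0} \ {s}).Finite := by
    refine (Polynomial.finite_setOfPred_isRoot hP0).subset fun x hx => ?_
    have := hx.1
    rw [mem_ofPred_eq, hP] at this
    exact this
  rw [eventually_nhdsWithin_iff]
  filter_upwards [hfin.isClosed.isOpen_compl.mem_nhds (by simp : s ∈ _)] with x hx hxs h0
  exact hx ⟨h0, hxs⟩

theorem exists_orbit_of_mem_todaOrbit {i : Fin (r + 1) → Fin (n + 1)} {X : TodaMat n}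
    (hX : X ∈ todaOrbit i) : ∃ (ν : ℝ) (b : TodaMat n), IsLower b ∧ IsUnit b.det ∧
      X = subdiagJ n + upperPart (b * (indexMat i + ν • 1) * b⁻¹) := by
  obtain ⟨ν, b, hb, hu, e⟩ := mem_iUnion.mp hX
  exact ⟨ν, b, hb, hu, e⟩

theorem mem_todaOrbit {i : Fin (r + 1) → Fin (n + 1)} {b : TodaMat n} (hb : IsLower b)
    (hu : IsUnit b.det) (ν : ℝ) :
    subdiagJ n + upperPart (b * (indexMat i + ν • 1) * b⁻¹) ∈ todaOrbit i :=
  mem_iUnion.mpr ⟨ν, b, hb, hu, rfl⟩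

theorem upperPart_smul (c : ℝ) (A : TodaMat n) : upperPart (c • A) = c • upperPart A := by
  ext a b
  simp only [upperPart, Matrix.of_apply, Matrix.smul_apply]
  split_ifs <;> simp

/-- Replacing b⁻¹ by the adjugate clears the denominators and makes the nondegeneracy condition
polynomial in b. -/
theorem det_smul_add_upperPart_adjugate {b : TodaMat n} (hu : b.det ≠ 0) (A : TodaMat n) :
    (b.det • subdiagJ n + upperPart (b * A * b.adjugate)).det =
      b.det ^ (n + 1) * (subdiagJ n + upperPart (b * A * b⁻¹)).det := by
  have e : b.det • subdiagJ n + upperPart (b * A * b.adjugate) =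
      b.det • (subdiagJ n + upperPart (b * A * b⁻¹)) := by
    rw [smul_add, ← upperPart_smul, ← mul_smul_comm, Matrix.inv_def, Ring.inverse_eq_inv',
      smul_smul, mul_inv_cancel₀ hu, one_smul]
  rw [e, Matrix.det_smul, Fintype.card_fin]

/-- The domain is dense in the orbit. -/
theorem todaOrbit_subset_closure {i : Fin (r + 1) → Fin (n + 1)} (hr : 0 < r)
    (hi : StrictMono i) (h0 : i 0 = 0) (hl : i (Fin.last r) = Fin.last n) :
    todaOrbit i ⊆ closure (moserDomain i) := by
  intro X hX
  obtain ⟨ν, b, hb, hu, rfl⟩ := exists_orbit_of_mem_todaOrbit hX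
  obtain ⟨w, hw, hwu, hwd⟩ := exists_orbit_det_ne_zero hr hi h0 hl
  set B : ℝ → TodaMat n := fun s => b + s • (w - b) with hB
  have hB0 : B 0 = b := by simp [hB]
  have hB1 : B 1 = w := by simp [hB]
  have hBl : ∀ s, IsLower (B s) := fun s p q h => by simp [hB, hb p q h, hw p q h]
  have hBp : ∀ a c, IsPolynomialFun fun s => B s a c := fun a c =>
    ⟨Polynomial.C (b a c) + Polynomial.X * Polynomial.C ((w - b) a c), fun s => by simp [hB]⟩
  have hBs : ContDiff ℝ ∞ B := contDiff_matrix.mpr fun a c => by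
    simp only [hB, Matrix.add_apply, Matrix.smul_apply, smul_eq_mul]
    fun_prop
  -- The extra factor det B(s) lets one nonvanishing polynomial guarantee both that B(s) is
  -- invertible and that the traceless part is.
  set F : ℝ → ℝ := fun s => (B s).det *
    ((B s).det • subdiagJ n + upperPart (B s * indexMat i * (B s).adjugate)).det with hF
  have hFp : IsPolynomialFun F := by
    refine (IsPolynomialFun.det hBp).mul (IsPolynomialFun.det fun a c => ?_)
    simp only [Matrix.add_apply, Matrix.smul_apply, smul_eq_mul, upperPart, Matrix.of_apply]
    refine ((IsPolynomialFun.det hBp).mul (isPolynomialFun_const _)).add ?_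
    split_ifs
    · simp only [mul_indexMat_mul_apply, Matrix.adjugate_apply]
      refine IsPolynomialFun.sum _ fun l _ => (hBp _ _).mul (IsPolynomialFun.det fun x y => ?_)
      simp only [Matrix.updateRow_apply]
      split_ifs
      · exact isPolynomialFun_const _
      · exact hBp _ _
    · exact isPolynomialFun_const _
  have hF1 : F 1 ≠ 0 := by
    simp only [hF, hB1]
    rw [det_smul_add_upperPart_adjugate hwu.ne_zero]
    exact mul_ne_zero hwu.ne_zero (mul_ne_zero (pow_ne_zero _ hwu.ne_zero) hwd)
  have hc : ContinuousAt (fun s => subdiagJ n + upperPart (B s * (indexMat i + ν • 1) * (B s)⁻¹)) 0 :=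
    (contDiffAt_orbit hBs contDiff_const (by rw [hB0]; exact hu.ne_zero)).continuousAt
  have ht := hc.tendsto.mono_left (nhdsWithin_le_nhds (s := {0}ᶜ))
  rw [hB0] at ht
  refine mem_closure_of_tendsto ht ?_
  filter_upwards [hFp.eventually_ne hF1 0] with s hs
  have h1 : (B s).det ≠ 0 := left_ne_zero_of_mul hs
  have h2 := right_ne_zero_of_mul hs
  rw [det_smul_add_upperPart_adjugate h1] at h2
  have h3 := isUnit_iff_ne_zero.mpr h1
  refine ⟨?_, mem_todaOrbit (hBl s) h3 ν⟩
  rw [mem_ofPred_eq, tracelessPart_orbit hi h3]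
  exact right_ne_zero_of_mul h2

end Domain

/-! ### Local coordinates on an orbit -/

section Chart

open Finset Matrix

variable {n r : ℕ}

/-- `dn a` and `up a` are the neighbours of `a` in the index sequence: `dn a < a ≤ up a`. -/
structure IsBlockFun (i : Fin (r + 1) → Fin (n + 1)) (dn up : Fin (n + 1) → Fin (n + 1)) :
    Prop where
  up_zero : up 0 = 0
  block : ∀ a, a ≠ 0 → ∃ l : Fin r, dn a = i l.castSucc ∧ up a = i l.succ ∧ dn a < a ∧ a ≤ up a

theorem exists_isBlockFun {i : Fin (r + 1) → Fin (n + 1)} (h0 : i 0 = 0)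
    (hl : i (Fin.last r) = Fin.last n) : ∃ dn up, IsBlockFun i dn up := by
  classical
  have h : ∀ a : Fin (n + 1), ∃ d u : Fin (n + 1), (a = 0 → u = 0) ∧
      (a ≠ 0 → ∃ l : Fin r, d = i l.castSucc ∧ u = i l.succ ∧ d < a ∧ a ≤ u) := by
    intro a
    by_cases ha : a = 0
    · exact ⟨0, 0, fun _ => rfl, fun h => absurd ha h⟩
    · obtain ⟨l, h1, h2⟩ := exists_block h0 hl ha
      exact ⟨i l.castSucc, i l.succ, fun h => absurd h ha, fun _ => ⟨l, rfl, rfl, h1, h2⟩⟩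
  choose dn up h1 h2 using h
  exact ⟨dn, up, h1 0 rfl, h2⟩

namespace IsBlockFun

variable {i : Fin (r + 1) → Fin (n + 1)} {dn up : Fin (n + 1) → Fin (n + 1)}

theorem succ_ne_zero (hi : StrictMono i) (l : Fin r) : i l.succ ≠ 0 :=
  ((Fin.zero_le _).trans_lt (hi l.castSucc_lt_succ)).ne'

theorem dn_lt (h : IsBlockFun i dn up) {a : Fin (n + 1)} (ha : a ≠ 0) : dn a < a := by
  obtain ⟨_, _, _, h1, _⟩ := h.block a ha
  exact h1

theorem le_up (h : IsBlockFun i dn up) (a : Fin (n + 1)) : a ≤ up a := by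
  by_cases ha : a = 0
  · rw [ha]; exact Fin.zero_le _
  · obtain ⟨_, _, _, _, h1⟩ := h.block a ha
    exact h1

theorem eq_of_block (hi : StrictMono i) {k l : Fin r} (h1 : i k.castSucc < i l.succ)
    (h2 : i l.succ ≤ i k.succ) : k = l := by
  have h1 := hi.lt_iff_lt.mp h1
  have h2 := hi.le_iff_le.mp h2
  rw [Fin.lt_def, Fin.val_castSucc, Fin.val_succ] at h1
  rw [Fin.le_def, Fin.val_succ, Fin.val_succ] at h2
  exact Fin.ext (by omega)

theorem dn_succ (h : IsBlockFun i dn up) (hi : StrictMono i) (l : Fin r) :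
    dn (i l.succ) = i l.castSucc := by
  obtain ⟨k, h1, h2, h3, h4⟩ := h.block _ (succ_ne_zero hi l)
  rw [h1] at h3
  rw [h2] at h4
  rw [h1, eq_of_block hi h3 h4]

theorem up_index (h : IsBlockFun i dn up) (hi : StrictMono i) (h0 : i 0 = 0) (l : Fin (r + 1)) :
    up (i l) = i l := by
  induction l using Fin.cases with
  | zero => rw [h0, h.up_zero]
  | succ l =>
    obtain ⟨k, h1, h2, h3, h4⟩ := h.block _ (succ_ne_zero hi l)
    rw [h1] at h3
    rw [h2] at h4
    rw [h2, eq_of_block hi h3 h4]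

theorem dn_up_ne (h : IsBlockFun i dn up) (hi : StrictMono i) {c : Fin (n + 1)} (hc : up c ≠ 0) :
    c ≠ dn (up c) := by
  have hc0 : c ≠ 0 := fun h' => hc (by rw [h', h.up_zero])
  obtain ⟨l, h1, h2, h3, _⟩ := h.block c hc0
  rw [h2, h.dn_succ hi, ← h1]
  exact h3.ne'

end IsBlockFun

/-- The lower triangular matrices that are transversal to the stabilizer of the index matrix. -/
def chartMat (dn up : Fin (n + 1) → Fin (n + 1)) (θ : RatCoeff n) : TodaMat n :=
  -- The position (up 0, 0) = (0, 0) is suppressed, and the free parameter θ.1 0 is reserved for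
  -- shifting ν. This leaves n + n + 1 parameters, the dimension of the space of rational functions.
  Matrix.of fun a c => (if a = up c then (Fin.cons 0 θ.2 : Fin (n + 1) → ℝ) c else 0) +
    if a ≠ 0 ∧ c = dn a then θ.1 a else 0

variable {i : Fin (r + 1) → Fin (n + 1)} {dn up : Fin (n + 1) → Fin (n + 1)}

theorem chartMat_smul (s : ℝ) (θ : RatCoeff n) :
    chartMat dn up (s • θ) = s • chartMat dn up θ := by
  ext a c
  simp only [chartMat, Matrix.of_apply, Matrix.smul_apply, smul_eq_mul, Prod.smul_fst,
    Prod.smul_snd, Pi.smul_apply, mul_add, mul_ite, mul_zero]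
  congr 2
  induction c using Fin.cases <;> simp

theorem chartMat_zero : chartMat dn up (0 : RatCoeff n) = 0 := by
  have := chartMat_smul (dn := dn) (up := up) 0 (0 : RatCoeff n)
  rwa [zero_smul, zero_smul] at this

theorem contDiff_chartMat : ContDiff ℝ ∞ (chartMat (n := n) dn up) := by
  refine contDiff_matrix.mpr fun a c => ?_
  simp only [chartMat, Matrix.of_apply]
  refine ContDiff.add ?_ ?_
  · split_ifs
    · induction c using Fin.cases with
      | zero => simp only [Fin.cons_zero]; exact contDiff_const
      | succ c => simp only [Fin.cons_succ]; exact contDiff_snd_apply c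
    · exact contDiff_const
  · split_ifs
    · exact contDiff_fst_apply a
    · exact contDiff_const

theorem isLower_chartMat (h : IsBlockFun i dn up) (θ : RatCoeff n) :
    IsLower (chartMat dn up θ) := by
  intro a c hac
  rw [chartMat, Matrix.of_apply, if_neg, if_neg, add_zero]
  · rintro ⟨ha, rfl⟩
    exact (h.dn_lt ha).not_gt hac
  · rintro rfl
    exact (h.le_up c).not_gt hac

theorem chartMat_up (h : IsBlockFun i dn up) (hi : StrictMono i) (θ : RatCoeff n)
    (c : Fin (n + 1)) : chartMat dn up θ (up c) c = (Fin.cons 0 θ.2 : Fin (n + 1) → ℝ) c := by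
  rw [chartMat, Matrix.of_apply, if_pos rfl, if_neg, add_zero]
  rintro ⟨h1, h2⟩
  exact h.dn_up_ne hi h1 h2

theorem chartMat_dn (h : IsBlockFun i dn up) (hi : StrictMono i) (h0 : i 0 = 0) (θ : RatCoeff n)
    {a : Fin (n + 1)} (ha : a ≠ 0) : chartMat dn up θ a (dn a) = θ.1 a := by
  rw [chartMat, Matrix.of_apply, if_neg, if_pos ⟨ha, rfl⟩, zero_add]
  obtain ⟨l, h1, _, h3, _⟩ := h.block a ha
  intro e
  rw [h1, h.up_index hi h0, ← h1] at e
  exact h3.ne' e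

theorem mul_indexMat_apply_succ (hi : StrictMono i) (b : TodaMat n) (a : Fin (n + 1)) (l : Fin r) :
    (b * indexMat i) a (i l.succ) = b a (i l.castSucc) := by
  have := mul_indexMat_mul_apply i b 1 a (i l.succ)
  rw [mul_one] at this
  rw [this, sum_eq_single l, Matrix.one_apply_eq, mul_one]
  · intro k _ hk
    rw [Matrix.one_apply_ne, mul_zero]
    exact fun e => hk (Fin.succ_injective _ (hi.injective e))
  · simp

theorem mul_indexMat_apply_of_ne (b : TodaMat n) (a c : Fin (n + 1))
    (hc : ∀ l : Fin r, i l.succ ≠ c) : (b * indexMat i) a c = 0 := by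
  have := mul_indexMat_mul_apply i b 1 a c
  rw [mul_one] at this
  rw [this]
  exact sum_eq_zero fun l _ => by rw [Matrix.one_apply_ne (hc l), mul_zero]

theorem indexMat_mul_apply_castSucc (hi : StrictMono i) (b : TodaMat n) (c : Fin (n + 1))
    (l : Fin r) : (indexMat i * b) (i l.castSucc) c = b (i l.succ) c := by
  have := mul_indexMat_mul_apply i 1 b (i l.castSucc) c
  rw [one_mul] at this
  rw [this, sum_eq_single l, Matrix.one_apply_eq, one_mul]
  · intro k _ hk
    rw [Matrix.one_apply_ne, zero_mul]
    exact fun e => hk (Fin.castSucc_injective _ (hi.injective e)).symm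
  · simp

theorem indexMat_mul_apply_of_ne (b : TodaMat n) (a c : Fin (n + 1))
    (ha : ∀ l : Fin r, i l.castSucc ≠ a) : (indexMat i * b) a c = 0 := by
  have := mul_indexMat_mul_apply i 1 b a c
  rw [one_mul] at this
  rw [this]
  exact sum_eq_zero fun l _ => by rw [Matrix.one_apply_ne (ha l).symm, zero_mul]

/-- The chart is an immersion. -/
theorem eq_zero_of_upperPart_commutator (h : IsBlockFun i dn up) (hi : StrictMono i) (h0 : i 0 = 0)
    {θ : RatCoeff n} (hθ : upperPart (chartMat dn up θ * indexMat i -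
      indexMat i * chartMat dn up θ + θ.1 0 • 1) = 0) : θ = 0 := by
  set β := chartMat dn up θ with hβ
  have entry : ∀ a c : Fin (n + 1), a ≤ c → (β * indexMat i) a c - (indexMat i * β) a c +
      θ.1 0 * (1 : TodaMat n) a c = 0 := by
    intro a c hac
    have := congrFun (congrFun hθ a) c
    simpa [upperPart, hac] using this
  have hdn : ∀ l : Fin r, β (i l.succ) (i l.castSucc) = θ.1 (i l.succ) := by
    intro l
    rw [← h.dn_succ hi l]
    exact chartMat_dn h hi h0 θ (IsBlockFun.succ_ne_zero hi l)
  set y : Fin (r + 1) → ℝ := Fin.cons 0 fun l : Fin r => θ.1 (i l.succ) with hy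
  have hleft : ∀ l : Fin (r + 1), (β * indexMat i) (i l) (i l) = y l := by
    intro l
    induction l using Fin.cases with
    | zero =>
      rw [mul_indexMat_apply_of_ne, hy, Fin.cons_zero]
      intro l
      rw [h0]
      exact IsBlockFun.succ_ne_zero hi l
    | succ l => rw [mul_indexMat_apply_succ hi, hdn, hy, Fin.cons_succ]
  -- The diagonal entries at the indices form a chain with constant increment θ.1 0 that starts at 0
  -- and ends at -θ.1 0. Hence (r + 1) θ.1 0 = 0 and the whole chain vanishes.
  have hstep : ∀ l : Fin r, y l.succ - y l.castSucc = θ.1 0 := by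
    intro l
    have h1 := entry (i l.castSucc) (i l.castSucc) le_rfl
    rw [hleft, indexMat_mul_apply_castSucc hi, hdn, Matrix.one_apply_eq] at h1
    have h2 : y l.succ = θ.1 (i l.succ) := by rw [hy, Fin.cons_succ]
    linarith
  have hlast : y (Fin.last r) + θ.1 0 = 0 := by
    have h1 := entry (i (Fin.last r)) (i (Fin.last r)) le_rfl
    rw [hleft, indexMat_mul_apply_of_ne, Matrix.one_apply_eq] at h1
    · linarith
    · intro l e
      exact (Fin.castSucc_lt_last l).ne (hi.injective e)
  have hz : θ.1 0 = 0 := by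
    have h1 := Fin.sum_succ_sub_castSucc y
    simp only [hstep, sum_const, card_univ, Fintype.card_fin, nsmul_eq_mul] at h1
    have h2 : y 0 = 0 := rfl
    have h3 : ((r : ℝ) + 1) * θ.1 0 = 0 := by linarith
    exact (mul_eq_zero.mp h3).resolve_left (by positivity)
  have hy0 : ∀ l, y l = 0 := by
    intro l
    induction l using Fin.induction with
    | zero => rfl
    | succ l ih =>
      have := hstep l
      rw [ih, hz, sub_zero] at this
      exact this
  have h1 : ∀ a, θ.1 a = 0 := by
    intro a
    by_cases ha : a = 0
    · rw [ha, hz]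
    by_cases hs : ∃ l, i l = a
    · obtain ⟨l, rfl⟩ := hs
      induction l using Fin.cases with
      | zero => exact absurd h0 ha
      | succ l =>
        have := hy0 l.succ
        rwa [hy, Fin.cons_succ] at this
    -- Off the index set, row a of X_I vanishes, so the entry (a, up a) of the commutator isolates
    -- the parameter at (a, dn a).
    · obtain ⟨l, e1, e2, _, _⟩ := h.block a ha
      have e := entry a (up a) (h.le_up a)
      rw [hz, zero_mul, add_zero, indexMat_mul_apply_of_ne _ _ _ fun k hk => hs ⟨_, hk⟩, sub_zero,
        e2, mul_indexMat_apply_succ hi, ← e1, hβ, chartMat_dn h hi h0 θ ha] at e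
      exact e
  set x : Fin (n + 1) → ℝ := Fin.cons 0 θ.2 with hx
  have hup : ∀ c, β (up c) c = x c := chartMat_up h hi θ
  -- The entries between consecutive indices equate neighbouring diagonal parameters, the first of
  -- which is the suppressed zero.
  have hxi : ∀ l, x (i l) = 0 := by
    intro l
    induction l using Fin.induction with
    | zero => rw [h0]; rfl
    | succ l ih =>
      have e := entry (i l.castSucc) (i l.succ) (hi l.castSucc_lt_succ).le
      have e1 := hup (i l.castSucc)
      have e2 := hup (i l.succ)
      rw [h.up_index hi h0] at e1 e2
      rw [hz, mul_indexMat_apply_succ hi, indexMat_mul_apply_castSucc hi, e1, e2, ih] at e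
      linarith
  have h2 : ∀ c, x c = 0 := by
    intro c
    by_cases hs : ∃ l, i l = c
    · obtain ⟨l, rfl⟩ := hs
      exact hxi l
    -- Off the index set, column c of X_I vanishes, and the entry (dn c, c) isolates the parameter
    -- at (up c, c).
    · have hc : c ≠ 0 := fun e => hs ⟨0, h0.trans e.symm⟩
      obtain ⟨l, e1, e2, e3, _⟩ := h.block c hc
      have e := entry (dn c) c e3.le
      rw [hz, zero_mul, add_zero, mul_indexMat_apply_of_ne _ _ _ fun k hk => hs ⟨_, hk⟩, e1,
        indexMat_mul_apply_castSucc hi, ← e2, hup, zero_sub, neg_eq_zero] at e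
      exact e
  refine Prod.ext (funext h1) (funext fun j => ?_)
  exact h2 j.succ

/-- A chart of the orbit. -/
noncomputable def orbitChart (i : Fin (r + 1) → Fin (n + 1)) (dn up : Fin (n + 1) → Fin (n + 1))
    (b : TodaMat n) (ν : ℝ) (θ : RatCoeff n) : TodaMat n :=
  subdiagJ n + upperPart (b * (1 + chartMat dn up θ) * (indexMat i + (ν + θ.1 0) • 1) *
    (b * (1 + chartMat dn up θ))⁻¹)

theorem orbitChart_zero (b : TodaMat n) (ν : ℝ) :
    orbitChart i dn up b ν 0 = subdiagJ n + upperPart (b * (indexMat i + ν • 1) * b⁻¹) := by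
  simp [orbitChart, chartMat_zero]

theorem contDiff_orbitChart_left (b : TodaMat n) :
    ContDiff ℝ ∞ fun θ : RatCoeff n => b * (1 + chartMat dn up θ) :=
  contDiff_const.todaMat_mul (contDiff_const.add contDiff_chartMat)

theorem contDiffAt_orbitChart {b : TodaMat n} (hu : IsUnit b.det) (ν : ℝ) :
    ContDiffAt ℝ ∞ (orbitChart i dn up b ν) 0 := by
  refine contDiffAt_orbit (contDiff_orbitChart_left b)
    (contDiff_const.add ((contDiff_const.add (contDiff_fst_apply 0)).smul contDiff_const)) ?_
  rw [chartMat_zero, add_zero, mul_one]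
  exact hu.ne_zero

theorem eventually_orbitChart_mem (h : IsBlockFun i dn up) {b : TodaMat n} (hb : IsLower b)
    (hu : IsUnit b.det) (ν : ℝ) : ∀ᶠ θ in 𝓝 (0 : RatCoeff n),
      orbitChart i dn up b ν θ ∈ todaOrbit i := by
  have hc : ContinuousAt (fun θ : RatCoeff n => (b * (1 + chartMat dn up θ)).det) 0 :=
    (contDiff_det (contDiff_matrix.mp (contDiff_orbitChart_left b))).continuous.continuousAt
  have h0 : (b * (1 + chartMat dn up (0 : RatCoeff n))).det ≠ 0 := by
    rw [chartMat_zero, add_zero, mul_one]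
    exact hu.ne_zero
  filter_upwards [hc.eventually_ne h0] with θ hθ
  refine mem_todaOrbit (hb.mul fun p q hpq => ?_) (isUnit_iff_ne_zero.mpr hθ) _
  rw [Matrix.add_apply, isLower_chartMat h θ p q hpq, IsLower.one p q hpq, add_zero]

theorem hasDerivAt_upperPart {A : ℝ → TodaMat n} {A' : TodaMat n} {t : ℝ}
    (h : HasDerivAt A A' t) : HasDerivAt (fun s => upperPart (A s)) (upperPart A') t := by
  rw [hasDerivAt_matrix] at *
  intro a c
  simp only [upperPart, Matrix.of_apply]
  split_ifs
  · exact h a c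
  · exact hasDerivAt_const _ _

/-- The scalar ν commutes with everything, so only the commutator with X_I and the variation of ν
remain. -/
theorem hasDerivAt_orbitChart (b : TodaMat n) (ν : ℝ) (θ : RatCoeff n) :
    HasDerivAt (fun s : ℝ => orbitChart i dn up b ν (s • θ))
      (upperPart (b * (chartMat dn up θ * indexMat i -
        indexMat i * chartMat dn up θ + θ.1 0 • 1) * b⁻¹)) 0 := by
  set β := chartMat dn up θ with hβ
  have h1 : HasDerivAt (fun s : ℝ => (1 : TodaMat n) + s • β) β 0 := hasDerivAt_add_smul _ _ _
  have h2 : HasDerivAt (fun s : ℝ => (1 + s • β : TodaMat n)⁻¹) (-β) 0 := by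
    have := hasDerivAt_matrix_inv (A := (1 : TodaMat n)) (V := β) (by simp)
    simpa using this
  have h3 : HasDerivAt (fun s : ℝ => (indexMat i + ν • 1) + s • (θ.1 0 • (1 : TodaMat n)))
      (θ.1 0 • 1) 0 := hasDerivAt_add_smul _ _ _
  have h4 := ((hasDerivAt_const (0 : ℝ) b).matrix_mul ((h1.matrix_mul h3).matrix_mul h2)).matrix_mul
    (hasDerivAt_const (0 : ℝ) b⁻¹)
  have h5 := (hasDerivAt_upperPart h4).const_add (subdiagJ n)
  have e : (fun s : ℝ => orbitChart i dn up b ν (s • θ)) = fun s : ℝ => subdiagJ n + upperPart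
      (b * ((1 + s • β) * ((indexMat i + ν • 1) + s • (θ.1 0 • (1 : TodaMat n))) *
        (1 + s • β)⁻¹) * b⁻¹) := by
    funext s
    rw [orbitChart, chartMat_smul, Matrix.mul_inv_rev, Prod.smul_fst, Pi.smul_apply, smul_eq_mul,
      add_smul, mul_smul, add_assoc]
    simp only [mul_assoc, hβ]
  rw [e]
  refine h5.congr_deriv ?_
  congr 1
  simp only [zero_smul, add_zero, inv_one, mul_one, one_mul, zero_mul, zero_add, mul_zero]
  congr 2
  simp only [mul_add, add_mul, mul_neg, mul_smul_comm, smul_mul_assoc, mul_one, one_mul]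
  abel

theorem eq_zero_of_hasDerivAt_orbitChart (h : IsBlockFun i dn up) (hi : StrictMono i)
    (h0 : i 0 = 0) {b : TodaMat n} (hb : IsLower b) (hu : IsUnit b.det) (ν : ℝ) {θ : RatCoeff n}
    (hθ : HasDerivAt (fun s : ℝ => orbitChart i dn up b ν (s • θ)) 0 0) : θ = 0 := by
  have h1 := (hasDerivAt_orbitChart (i := i) (dn := dn) (up := up) b ν θ).unique hθ
  refine eq_zero_of_upperPart_commutator h hi h0 ?_
  -- Conjugation by b does not affect whether the upper part vanishes, so the question reduces to b
  -- = 1.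
  set M := chartMat dn up θ * indexMat i - indexMat i * chartMat dn up θ + θ.1 0 • 1
  have h2 := upperPart_conj (hb.inv hu) hb (b * M * b⁻¹)
  rw [h1, mul_zero, zero_mul] at h2
  have e : b⁻¹ * (b * M * b⁻¹) * b = M := by
    rw [mul_assoc b, Matrix.nonsing_inv_mul_cancel_left _ _ hu, Matrix.nonsing_inv_mul_cancel_right _ _ hu]
  rw [e] at h2
  rw [h2]
  ext a c
  simp [upperPart]

end Chart

/-! ### The image of the Moser map -/

section Image

open Finset Matrix

variable {n r : ℕ}

/-- A map with a differentiable left inverse is open along an immersion of full dimension. -/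
theorem image_mem_nhds_of_leftInverse {E F : Type*} [NormedAddCommGroup E] [NormedSpace ℝ E]
    [NormedAddCommGroup F] [NormedSpace ℝ F] [FiniteDimensional ℝ F] {U : Set E} {W : E → F}
    {φ : F → E} {Ψ : F → E} (hW : ContDiff ℝ ∞ W) (hΨ : ContDiffAt ℝ ∞ Ψ 0)
    (hφ : DifferentiableAt ℝ φ (W (Ψ 0))) (hφW : ∀ x ∈ U, φ (W x) = x)
    (hU : ∀ᶠ θ in 𝓝 0, Ψ θ ∈ U) (hinj : ∀ θ, HasDerivAt (fun s : ℝ => Ψ (s • θ)) 0 0 → θ = 0) :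
    W '' U ∈ 𝓝 (W (Ψ 0)) := by
  have := FiniteDimensional.complete ℝ F
  have hg : ContDiffAt ℝ ∞ (fun θ => W (Ψ θ)) 0 := hW.contDiffAt.comp 0 hΨ
  have hs := hg.hasStrictFDerivAt (by simp)
  set g' := fderiv ℝ (fun θ => W (Ψ θ)) 0
  have hker : ∀ θ, g' θ = 0 → θ = 0 := by
    intro θ hθ
    refine hinj θ ?_
    -- Near 0 the chart Ψ equals φ ∘ W ∘ Ψ, so a direction killed by the derivative of W ∘ Ψ is
    -- killed by that of Ψ, which the immersion hypothesis forbids.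
    have h1 : HasFDerivAt (fun θ => φ (W (Ψ θ))) ((fderiv ℝ φ (W (Ψ 0))).comp g') 0 :=
      hφ.hasFDerivAt.comp (0 : F) hs.hasFDerivAt
    have h2 : HasFDerivAt Ψ ((fderiv ℝ φ (W (Ψ 0))).comp g') 0 :=
      h1.congr_of_eventuallyEq (hU.mono fun θ hθ => (hφW _ hθ).symm)
    have h3 : HasDerivAt (fun s : ℝ => s • θ) θ 0 := by
      simpa using (hasDerivAt_id (0 : ℝ)).smul_const θ
    have h4 := HasFDerivAt.comp_hasDerivAt_of_eq (0 : ℝ) h2 h3 (by simp)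
    refine h4.congr_deriv ?_
    rw [ContinuousLinearMap.comp_apply, hθ, map_zero]
  have hinj' : Function.Injective (g' : F →ₗ[ℝ] F) := by
    rw [← LinearMap.ker_eq_bot, LinearMap.ker_eq_bot']
    exact hker
  have hsurj : g'.range = ⊤ :=
    LinearMap.range_eq_top.mpr (LinearMap.injective_iff_surjective.mp hinj')
  have hmap := hs.map_nhds_eq_of_surj hsurj
  rw [← hmap, Filter.mem_map]
  filter_upwards [hU] with θ hθ using mem_image_of_mem W hθ

theorem contDiff_ratCoords (P : MvPolynomial (Fin (n + 1) ⊕ Fin n) ℝ) :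
    ContDiff ℝ ∞ fun a : RatCoeff n => MvPolynomial.eval (ratCoords a) P := by
  induction P using MvPolynomial.induction_on with
  | C c => simp only [MvPolynomial.eval_C]; exact contDiff_const
  | add P Q hP hQ => simp only [map_add]; exact hP.add hQ
  | mul_X P j hP =>
    simp only [map_mul, MvPolynomial.eval_X]
    refine hP.mul ?_
    rcases j with j | j
    · exact contDiff_fst_apply j
    · exact contDiff_snd_apply j

theorem isHessenberg_of_mem_todaOrbit {i : Fin (r + 1) → Fin (n + 1)} {X : TodaMat n}
    (hX : X ∈ todaOrbit i) : IsHessenberg X := by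
  obtain ⟨A, hA, _⟩ := mem_todaOrbit_coadOrbit i X hX
  exact IsHessenberg.of_mem_coadOrbit hA

theorem isStaircase_of_mem_todaOrbit {i : Fin (r + 1) → Fin (n + 1)} (hi : StrictMono i)
    (h0 : i 0 = 0) (hl : i (Fin.last r) = Fin.last n) {X : TodaMat n} (hX : X ∈ todaOrbit i) :
    IsStaircase (IsIndex i) (tracelessPart X) := by
  obtain ⟨ν, b, hb, hu, rfl⟩ := exists_orbit_of_mem_todaOrbit hX
  rw [tracelessPart_orbit hi hu]
  exact isStaircase_orbit hi h0 hl hb hu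

/-- The rational map with numerators `P` and denominator `Q`. -/
noncomputable def ratMat (P : Fin (n + 1) → Fin (n + 1) → MvPolynomial (Fin (n + 1) ⊕ Fin n) ℝ)
    (Q : MvPolynomial (Fin (n + 1) ⊕ Fin n) ℝ) (a : RatCoeff n) : TodaMat n :=
  Matrix.of fun x y => MvPolynomial.eval (ratCoords a) (P x y) / MvPolynomial.eval (ratCoords a) Q

theorem contDiffAt_ratMat (P : Fin (n + 1) → Fin (n + 1) → MvPolynomial (Fin (n + 1) ⊕ Fin n) ℝ)
    {Q : MvPolynomial (Fin (n + 1) ⊕ Fin n) ℝ} {a : RatCoeff n}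
    (ha : MvPolynomial.eval (ratCoords a) Q ≠ 0) : ContDiffAt ℝ ∞ (ratMat P Q) a :=
  contDiffAt_todaMat.mpr fun x y =>
    (contDiff_ratCoords (P x y)).contDiffAt.div (contDiff_ratCoords Q).contDiffAt ha

theorem isMoserDomain_moserDomain {i : Fin (r + 1) → Fin (n + 1)} (hr : 0 < r)
    (hi : StrictMono i) (h0 : i 0 = 0) (hl : i (Fin.last r) = Fin.last n) :
    IsMoserDomain (todaOrbit i) (moserDomain i) := by
  obtain ⟨P, Q, H⟩ := exists_common_denominator (U := moserDomain i)
    (F := fun (ab : Fin (n + 1) × Fin (n + 1)) X => X ab.1 ab.2)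
    fun ab => isRationalOn_apply (IsIndex i) (fun X hX => isHessenberg_of_mem_todaOrbit hX.2)
      (fun X hX => isStaircase_of_mem_todaOrbit hi h0 hl hX.2) (fun X hX => hX.1) ab.1 ab.2
  refine ⟨⟨_, isOpen_det_tracelessPart, rfl⟩, todaOrbit_subset_closure hr hi h0 hl, ?_,
    fun a b => P (a, b), Q, fun X hX => ⟨(H X hX).1, fun a b => (H X hX).2 (a, b)⟩⟩
  have hφ : ∀ X ∈ moserDomain i, ratMat (fun a b => P (a, b)) Q (weylMap X) = X := by
    intro X hX
    ext a b
    exact ((H X hX).2 (a, b)).symm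
  rw [isOpen_iff_mem_nhds]
  rintro _ ⟨X, hX, rfl⟩
  obtain ⟨ν, b, hb, hu, e⟩ := exists_orbit_of_mem_todaOrbit hX.2
  obtain ⟨dn, up, hB⟩ := exists_isBlockFun h0 hl
  rw [← orbitChart_zero (dn := dn) (up := up)] at e
  have hΨ := contDiffAt_orbitChart (i := i) (dn := dn) (up := up) hu ν
  have hd : DifferentiableAt ℝ (ratMat (fun a b => P (a, b)) Q) (weylMap X) :=
    (contDiffAt_ratMat _ (H X hX).1).differentiableAt (by simp)
  have hX1 := hX.1
  rw [e] at hd hX1 ⊢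
  refine image_mem_nhds_of_leftInverse contDiff_weylMap hΨ hd hφ ?_
    fun θ hθ => eq_zero_of_hasDerivAt_orbitChart hB hi h0 hb hu ν hθ
  filter_upwards [eventually_orbitChart_mem hB hb hu ν,
    hΨ.continuousAt.eventually (isOpen_det_tracelessPart.mem_nhds hX1)] with θ h1 h2
  exact ⟨h2, h1⟩

end Image

/-! ### Transport of Poisson brackets along a map with a smooth inverse -/

section Transport

variable {E F : Type*} [NormedAddCommGroup E] [NormedSpace ℝ E] [NormedAddCommGroup F]
  [NormedSpace ℝ F] {U : Set E} {W : E → F} {φ : F → E}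

/-- `φ` inverts `W` smoothly on the open set `W '' U`. -/
structure IsSmoothInverseOn (U : Set E) (W : E → F) (φ : F → E) : Prop where
  contDiff : ContDiff ℝ ∞ W
  isOpen_image : IsOpen (W '' U)
  contDiffAt : ∀ x ∈ U, ContDiffAt ℝ ∞ φ (W x)
  leftInv : ∀ x ∈ U, φ (W x) = x

namespace IsSmoothInverseOn

theorem eventually_image (h : IsSmoothInverseOn U W φ) {x : E} (hx : x ∈ U) :
    ∀ᶠ a in 𝓝 (W x), ∃ y ∈ U, W y = a :=
  h.isOpen_image.mem_nhds (mem_image_of_mem W hx)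

theorem tendsto (h : IsSmoothInverseOn U W φ) {x : E} (hx : x ∈ U) :
    Tendsto φ (𝓝 (W x)) (𝓝[U] x) := by
  refine tendsto_nhdsWithin_iff.mpr ⟨?_, ?_⟩
  · have := (h.contDiffAt x hx).continuousAt.tendsto
    rwa [h.leftInv x hx] at this
  · filter_upwards [h.eventually_image hx] with a ⟨y, hy, e⟩
    rw [← e, h.leftInv y hy]
    exact hy

theorem smoothNear_comp (h : IsSmoothInverseOn U W φ) {x : E} (hx : x ∈ U)
    {f : E → ℝ} (hf : SmoothNear U f x) :
    SmoothNear univ (f ∘ φ) (W x) := by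
  rw [smoothNear_univ]
  filter_upwards [(h.tendsto hx).eventually hf, h.eventually_image hx] with a ha ⟨y, hy, e⟩
  have hφ := h.contDiffAt y hy
  rw [e] at hφ
  -- f is smooth only along U; since φ maps the open image back into U, the composition is smooth in
  -- the ordinary sense.
  have h1 : ContDiffWithinAt ℝ ∞ (f ∘ φ) (W '' U) a := by
    refine ContDiffWithinAt.comp a ha hφ.contDiffWithinAt ?_
    rintro _ ⟨z, hz, rfl⟩
    rw [h.leftInv z hz]
    exact hz
  exact h1.contDiffAt (h.isOpen_image.mem_nhds ⟨y, hy, e⟩)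

theorem smoothNear_pullback (h : IsSmoothInverseOn U W φ) {x : E} {G : F → ℝ} (hG : SmoothNear univ G (W x)) :
    SmoothNear U (G ∘ W) x := by
  rw [smoothNear_univ] at hG
  refine Filter.Eventually.filter_mono nhdsWithin_le_nhds ?_
  filter_upwards [h.contDiff.continuous.continuousAt.eventually hG] with y hy
  exact (hy.comp y h.contDiff.contDiffAt).contDiffWithinAt

theorem comp_eventuallyEq (h : IsSmoothInverseOn U W φ) {x : E} (hx : x ∈ U)
    {f : E → ℝ} {G : F → ℝ} (hfG : ∀ y ∈ U, f y = G (W y)) :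
    f ∘ φ =ᶠ[𝓝 (W x)] G := by
  filter_upwards [h.eventually_image hx] with a ⟨y, hy, e⟩
  rw [Function.comp_apply, ← e, h.leftInv y hy, hfG y hy]

end IsSmoothInverseOn

theorem IsPoissonBracketOn.congr_right {R : (F → ℝ) → (F → ℝ) → F → ℝ} {V : Set F}
    (hR : IsPoissonBracketOn V R) {a : F} (ha : a ∈ V) {f g g' : F → ℝ} (hf : SmoothNear V f a)
    (hg : SmoothNear V g a) (hg' : SmoothNear V g' a) (h : g =ᶠ[𝓝[V] a] g') :
    R f g a = R f g' a := by
  rw [hR.skew a ha f g hf hg, hR.skew a ha f g' hf hg', hR.congr a ha g g' f hg hf h]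

theorem IsPoissonBracketOn.pullback {R : (F → ℝ) → (F → ℝ) → F → ℝ}
    (hR : IsPoissonBracketOn univ R) (h : IsSmoothInverseOn U W φ) :
    IsPoissonBracketOn U fun f g x => R (f ∘ φ) (g ∘ φ) (W x) := by
  have smooth : ∀ x ∈ U, ∀ f g : E → ℝ, SmoothNear U f x → SmoothNear U g x →
      SmoothNear U (fun x => R (f ∘ φ) (g ∘ φ) (W x)) x := fun x hx f g hf hg =>
    h.smoothNear_pullback (hR.smooth (W x) (mem_univ _) _ _ (h.smoothNear_comp hx hf)
      (h.smoothNear_comp hx hg))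
  refine ⟨fun x hx f f' g hf hg hff' => ?_, smooth, fun x hx f g k hf hg hk => ?_,
    fun x hx c f g hf hg => ?_, fun x hx f g hf hg => ?_, fun x hx f g k hf hg hk => ?_,
    fun x hx f g k hf hg hk => ?_⟩
  · refine hR.congr (W x) (mem_univ _) _ _ _ (h.smoothNear_comp hx hf) (h.smoothNear_comp hx hg) ?_
    rw [nhdsWithin_univ]
    exact (h.tendsto hx).eventually hff'
  · exact hR.add (W x) (mem_univ _) _ _ _ (h.smoothNear_comp hx hf) (h.smoothNear_comp hx hg)
      (h.smoothNear_comp hx hk)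
  · exact hR.smul (W x) (mem_univ _) _ _ _ (h.smoothNear_comp hx hf) (h.smoothNear_comp hx hg)
  · exact hR.skew (W x) (mem_univ _) _ _ (h.smoothNear_comp hx hf) (h.smoothNear_comp hx hg)
  · have := hR.leibniz (W x) (mem_univ _) _ _ _ (h.smoothNear_comp hx hf)
      (h.smoothNear_comp hx hg) (h.smoothNear_comp hx hk)
    simp only [Function.comp_apply, h.leftInv x hx] at this
    exact this
  -- The inner bracket on U, carried back by φ, agrees with the inner bracket of R near W(x);
  -- locality of R then reduces Jacobi on U to Jacobi for R.
  · have key : ∀ f g k : E → ℝ, SmoothNear U f x → SmoothNear U g x → SmoothNear U k x →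
        R (f ∘ φ) ((fun x => R (g ∘ φ) (k ∘ φ) (W x)) ∘ φ) (W x) =
          R (f ∘ φ) (R (g ∘ φ) (k ∘ φ)) (W x) := by
      intro f g k hf hg hk
      refine hR.congr_right (mem_univ _) (h.smoothNear_comp hx hf)
        (h.smoothNear_comp hx (smooth x hx g k hg hk))
        (hR.smooth (W x) (mem_univ _) _ _ (h.smoothNear_comp hx hg) (h.smoothNear_comp hx hk)) ?_
      rw [nhdsWithin_univ]
      exact h.comp_eventuallyEq hx fun _ _ => rfl
    rw [key f g k hf hg hk, key g k f hg hk hf, key k f g hk hf hg]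
    exact hR.jacobi (W x) (mem_univ _) _ _ _ (h.smoothNear_comp hx hf) (h.smoothNear_comp hx hg)
      (h.smoothNear_comp hx hk)

end Transport

/-! ### The main theorem -/

section Main

variable {n r : ℕ}

theorem exists_isSmoothInverseOn {M U : Set (TodaMat n)} (h : IsMoserDomain M U) :
    ∃ φ, IsSmoothInverseOn U weylMap φ := by
  obtain ⟨_, _, hV, P, Q, H⟩ := h
  refine ⟨ratMat P Q, contDiff_weylMap, hV, fun X hX => contDiffAt_ratMat P (H X hX).1,
    fun X hX => ?_⟩
  ext a b
  exact ((H X hX).2 a b).symm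

theorem isMoserPullback_pullback {U : Set (TodaMat n)} {φ : RatCoeff n → TodaMat n}
    (h : IsSmoothInverseOn U weylMap φ)
    {R : (RatCoeff n → ℝ) → (RatCoeff n → ℝ) → RatCoeff n → ℝ} (hR : IsPoissonBracketOn univ R) :
    IsMoserPullback U R fun f g X => R (f ∘ φ) (g ∘ φ) (weylMap X) := by
  intro X hX F G hF hG
  have e : ∀ K : RatCoeff n → ℝ, (K ∘ weylMap) ∘ φ =ᶠ[𝓝[univ] weylMap X] K := by
    intro K
    rw [nhdsWithin_univ]
    exact h.comp_eventuallyEq hX fun _ _ => rfl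
  have hs : ∀ K : RatCoeff n → ℝ, SmoothNear univ K (weylMap X) →
      SmoothNear univ ((K ∘ weylMap) ∘ φ) (weylMap X) := fun K hK =>
    h.smoothNear_comp hX (h.smoothNear_pullback hK)
  beta_reduce
  rw [hR.congr _ (mem_univ _) _ _ _ (hs F hF) (hs G hG) (e F),
    hR.congr_right (mem_univ _) hF (hs G hG) hG (e G)]

/-- The solution stays in U for nearby times, so f ∘ γ equals (f ∘ φ) ∘ W ∘ γ, and the derivative of
W ∘ γ is the Hamiltonian vector field computed in the coordinates (p, q). -/
theorem laxGeneratedBy_pullback {i : Fin (r + 1) → Fin (n + 1)} {φ : RatCoeff n → TodaMat n}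
    (h : IsSmoothInverseOn (moserDomain i) weylMap φ) (k : Fin (n + 1)) (m : ℕ) :
    LaxGeneratedBy m (moserDomain i)
      (fun f g X => ratBracket (Pi.single k 1) (f ∘ φ) (g ∘ φ) (weylMap X))
      ((m : ℤ) + 1 - (k : ℤ)) := by
  intro T γ hT hγ t ht hU hdet f hf
  set j : ℤ := (m : ℤ) + 1 - (k : ℤ) with hj
  have hH : ∀ X ∈ moserDomain i, IsHessenberg X := fun X hX => isHessenberg_of_mem_todaOrbit hX.2
  have hfφ := (smoothNear_univ.mp (h.smoothNear_comp hU hf)).self_of_nhds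
  have hγ' : ∀ᶠ s in 𝓝 t, HasDerivAt γ (laxField m (γ s)) s := by
    filter_upwards [hT.mem_nhds ht] with s hs using hγ s hs
  have hmem : ∀ᶠ s in 𝓝 t, γ s ∈ moserDomain i := by
    filter_upwards [eventually_mem_todaOrbit m hT hγ ht hU.2,
      (hγ t ht).continuousAt.eventually (isOpen_det_tracelessPart.mem_nhds hU.1)] with s h1 h2
    exact ⟨h2, h1⟩
  have h1 := (hfφ.differentiableAt (by simp)).hasFDerivAt.comp_hasDerivAt t
    (hasDerivAt_weylMap m hγ')
  have h2 : (fun s => f (γ s)) =ᶠ[𝓝 t] (f ∘ φ) ∘ fun s => weylMap (γ s) := by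
    filter_upwards [hmem] with s hs
    rw [Function.comp_apply, Function.comp_apply, h.leftInv _ hs]
  refine (h1.congr_of_eventuallyEq h2).congr_deriv ?_
  have hd : j ≤ 0 → (companion (weylMap (γ t)).1).det ≠ 0 := fun h0 => by
    rw [← (hH _ hU).det_eq]
    exact hdet h0
  rw [← ratBracket_todaHam k (f ∘ φ) hd]
  have h3 : todaHam j ∘ φ =ᶠ[𝓝 (weylMap (γ t))] fun b => todaHam j (companion b.1) :=
    h.comp_eventuallyEq hU fun X hX => todaHam_eq (hH X hX) j
  simp only [ratBracket, bivectorBracket, h3.fderiv_eq]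
  rfl

theorem theorem3p3 (n : ℕ) :
    ∃ R : Fin (n + 1) → (RatCoeff n → ℝ) → (RatCoeff n → ℝ) → RatCoeff n → ℝ,
      CompatiblePoissonOn univ R ∧ (∀ k : Fin (n + 1), SatisfiesRatBracket (k : ℕ) (R k)) ∧
      ∀ (r : ℕ) (i : Fin (r + 1) → Fin (n + 1)),
        0 < r → StrictMono i → i 0 = 0 → i (Fin.last r) = Fin.last n →
        (∀ m : ℕ, 1 ≤ m → m ≤ n → LaxRestrictsTo m (todaOrbit i)) ∧
        ∃ U : Set (TodaMat n), IsMoserDomain (todaOrbit i) U ∧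
          ∃ B : Fin (n + 1) → (TodaMat n → ℝ) → (TodaMat n → ℝ) → TodaMat n → ℝ,
            CompatiblePoissonOn U B ∧
            (∀ k, IsMoserPullback U (R k) (B k)) ∧
            ∀ (k : Fin (n + 1)) (m : ℕ), 1 ≤ m → m ≤ n →
              LaxGeneratedBy m U (B k) ((m : ℤ) + 1 - (k : ℤ)) := by
  refine ⟨fun k => ratBracket (Pi.single k 1), compatiblePoissonOn_ratBracket,
    satisfiesRatBracket_ratBracket, fun r i hr hi h0 hl => ⟨fun m _ _ => laxRestrictsTo_todaOrbit m i,
      moserDomain i, isMoserDomain_moserDomain hr hi h0 hl, ?_⟩⟩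
  obtain ⟨φ, hφ⟩ := exists_isSmoothInverseOn (isMoserDomain_moserDomain hr hi h0 hl)
  exact ⟨fun k f g X => ratBracket (Pi.single k 1) (f ∘ φ) (g ∘ φ) (weylMap X),
    ⟨fun k => (compatiblePoissonOn_ratBracket.1 k).pullback hφ,
      fun c => (compatiblePoissonOn_ratBracket.2 c).pullback hφ⟩,
    fun k => isMoserPullback_pullback hφ (compatiblePoissonOn_ratBracket.1 k),
    fun k m _ _ => laxGeneratedBy_pullback hφ k m⟩

end Main
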